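/- **Setting.** Let $\{1,\dots,p\}$ be partitioned into $d$ groups, $(j)$ being the $j$-th group, $b_j=|(j)|$, $b=\max_j b_j$. For $v\in\mathbb R^p$ put $\|v\|_1=\sum_i|v_i|$, $\|v\|_{1,2}=\sum_{j}\|v_{(j)}\|_2$, $\|v\|_{\infty,2}=\max_j\|v_{(j)}\|_2$, and $H_a(x)=\mathrm{sgn}(x)\max(|x|-a,0)$ (applied coordinatewise). Let $s,s_g$ be positive integers with $s_g\le d$ and $s_g\le s\le\max_{|\Omega|=s_g}\sum_{j\in\Omega}b_j$. Write $L=s\log(es_gb)+s_g\log(d/s_g)$ and $L'=s\log(es_gb)+s_g\log(ed/s_g)$. Let $Y=X\beta^*+\varepsilon$, where - $\beta^*\in\mathbb R^p$ is $(s,s_g)$-sparse: it has at most $s$ nonzero coordinates, and they lie in at most $s_g$ groups; $T$ is its support; - the rows $X_1,\dots,X_n$ of $X\in\mathbb R^{n\times p}$ are i.i.d. with mean $0$ and covariance matrix $\Sigma$, whose eigenvalues lie in $[2/3,3/2]$, and $\mathbb E\exp(a^\top\Sigma^{-1/2}X_k)\le\exp(\kappa^2\|a\|_2^2/2)$ for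 all $a\in\mathbb R^p$; - $\max_{i\notin T}\|\Sigma_{i,T}\Sigma_{T,T}^{-1}\|_2\le c/\sqrt s$; - $\varepsilon$ is independent of $X$ and has i.i.d. $N(0,\sigma^2)$ coordinates, $\sigma>0$. For a constant $K>0$ let $\lambda=K\sigma\sqrt{Ln/s}$, $\lambda_g=\sqrt{s/s_g}\,\lambda$, $\alpha=\lambda/(n\sigma)$, $\gamma=\sqrt{s/s_g}\,\lambda/(n\sigma)$. Let $\hat\beta$ be a (measurable) minimizer of $\|Y-X\beta\|_2^2+\lambda\|\beta\|_1+\lambda_g\|\beta\|_{1,2}$, let $\hat\Sigma=\frac1n X^\top X$, and let $\hat M$ be a matrix with rows $\hat m_1^\top,\dots,\hat m_p^\top$, depending measurably on $X$ only, such that $\hat m_i$ solves $$\text{minimize } m^\top\hat\Sigma m\quad\text{subject to}\quad\|H_\alpha(\hat\Sigma m-e_i)\|_{\infty,2}\le\gamma$$ whenever this program has a feasible point ($\hat m_i$ is arbitrary otherwise). The debiased sparse group Lasso estimator is $\hat\beta^u=\hat\beta+\frac1n\hat MX^\top(Y-X\hat\beta)$. **Theorem.** For every $\kappa>0$ there are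 constants $c,C_0,C_1>0$ such that for every $K\ge C_0$: 1. There are constants $C,c'>0$ (depending on $\kappa$ and $K$ only) such that in the setting above, if $n\ge C_1L$, there are random vectors $\Delta,w$ with $\sqrt n(\hat\beta^u-\beta^*)=\Delta+w$, where the conditional law of $w$ given $X$ is $N(0,\sigma^2\hat M\hat\Sigma\hat M^\top)$ and, with probability at least $1-C\exp(-c'L/s)$, $$\|\Delta\|_\infty\le\frac{C\,L'}{\sqrt n}\,\sigma .$$ 2. For every fixed $\sigma>0$ and every sequence of such problems (with the same $\kappa,\sigma,c,K$, everything else being allowed to vary) along which $\sqrt n/L'\to\infty$, and for every choice of a coordinate $i\in\{1,\dots,p\}$ in each problem of the sequence, $$\frac{\sqrt n(\hat\beta^u_i-\beta^*_i)}{\sqrt{\hat m_i^\top\hat\Sigma\hat m_i}}\to N(0,\sigma^2)\quad\text{in distribution.}$$ -/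

import Mathlib

open MeasureTheory ProbabilityTheory Filter Topology
open scoped Matrix MatrixOrder

namespace SparseGroupLasso

noncomputable section

/-! ### Norms and thresholding for vectors with grouped coordinates

The coordinates are indexed by `Fin p`; `g : Fin p → Fin d` sends a coordinate to its group, so
that the `j`-th group is `{i | g i = j}`. Vectors are plain functions `Fin p → ℝ`, and every norm
is written out. -/

/-- The number `b_j` of coordinates in group `j`. -/
def groupSize {p d : ℕ} (g : Fin p → Fin d) (j : Fin d) : ℕ :=
  (Finset.univ.filter fun i => g i = j).card

/-- The largest group size `b = max_j b_j`. -/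
def maxGroupSize {p d : ℕ} (g : Fin p → Fin d) : ℕ :=
  Finset.univ.sup (groupSize g)

/-- The support of a vector. -/
def supp {p : ℕ} (v : Fin p → ℝ) : Finset (Fin p) :=
  Finset.univ.filter fun i => v i ≠ 0

/-- The set of groups on which a vector does not vanish identically. -/
def groupSupp {p d : ℕ} (g : Fin p → Fin d) (v : Fin p → ℝ) : Finset (Fin d) :=
  Finset.univ.filter fun j => ∃ i, g i = j ∧ v i ≠ 0

/-- The Euclidean norm. -/
def norm2 {ι : Type*} [Fintype ι] (v : ι → ℝ) : ℝ :=
  √(∑ i, v i ^ 2)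

/-- The norm `‖v‖₁`. -/
def norm1 {p : ℕ} (v : Fin p → ℝ) : ℝ :=
  ∑ i, |v i|

/-- The Euclidean norm of the part of `v` in group `j`. -/
def groupNorm {p d : ℕ} (g : Fin p → Fin d) (v : Fin p → ℝ) (j : Fin d) : ℝ :=
  √(∑ i with g i = j, v i ^ 2)

/-- The norm `‖v‖_{1,2}`. -/
def normOneTwo {p d : ℕ} (g : Fin p → Fin d) (v : Fin p → ℝ) : ℝ :=
  ∑ j, groupNorm g v j

/-- The norm `‖v‖_{∞,2}` (a maximum over finitely many groups). -/
def normInfTwo {p d : ℕ} (g : Fin p → Fin d) (v : Fin p → ℝ) : ℝ :=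
  ⨆ j, groupNorm g v j

/-- Soft-thresholding `H_a(x) = sgn(x) ((|x| - a) ∨ 0)`. -/
def softThreshold (a x : ℝ) : ℝ :=
  Real.sign x * max (|x| - a) 0

/-- `v` is `(s, s_g)`-sparse, where `s` and `s_g` are positive integers with `s_g ≤ d` and
`s_g ≤ s ≤ max_{|Ω| = s_g} ∑_{j ∈ Ω} b_j`. -/
structure IsSparse {p d : ℕ} (g : Fin p → Fin d) (s sg : ℕ) (v : Fin p → ℝ) : Prop where
  sg_pos : 0 < sg
  sg_le_d : sg ≤ d
  sg_le_s : sg ≤ s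
  s_le : ∃ S : Finset (Fin d), S.card = sg ∧ s ≤ ∑ j ∈ S, groupSize g j
  card_groupSupp : (groupSupp g v).card ≤ sg
  card_supp : (supp v).card ≤ s

/-! ### The model -/

/-- The deterministic data of a double sparse regression problem. -/
structure Problem where
  /-- sample size -/
  n : ℕ
  /-- number of covariates -/
  p : ℕ
  /-- number of groups -/
  d : ℕ
  /-- element-wise sparsity -/
  s : ℕ
  /-- group-wise sparsity -/
  sg : ℕ
  /-- the group of each covariate -/
  group : Fin p → Fin d
  /-- covariance matrix of the covariates -/
  Sig : Matrix (Fin p) (Fin p) ℝ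
  /-- the true coefficient vector `β*` -/
  beta : Fin p → ℝ

namespace Problem

/-- The largest group size. -/
def b (M : Problem) : ℕ := maxGroupSize M.group

/-- `s log(e s_g b) + s_g log(d / s_g)`. -/
def rate (M : Problem) : ℝ :=
  M.s * Real.log (Real.exp 1 * M.sg * M.b) + M.sg * Real.log (M.d / M.sg)

/-- `s log(e s_g b) + s_g log(e d / s_g)`. -/
def rate' (M : Problem) : ℝ :=
  M.s * Real.log (Real.exp 1 * M.sg * M.b) + M.sg * Real.log (Real.exp 1 * M.d / M.sg)

/-- The tuning parameter `λ = K σ √((s log(e s_g b) + s_g log(d / s_g)) n / s)`. -/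
def lam (M : Problem) (K σ : ℝ) : ℝ := K * σ * √(M.rate * M.n / M.s)

/-- The tuning parameter `λ_g = √(s / s_g) λ`. -/
def lamg (M : Problem) (K σ : ℝ) : ℝ := √((M.s : ℝ) / M.sg) * M.lam K σ

/-- The thresholding level `α = λ / (n σ)`. -/
def alpha (M : Problem) (K σ : ℝ) : ℝ := M.lam K σ / (M.n * σ)

/-- The constraint level `γ = √(s / s_g) λ / (n σ)`. -/
def gam (M : Problem) (K σ : ℝ) : ℝ := √((M.s : ℝ) / M.sg) * (M.lam K σ / (M.n * σ))

/-- `max_{i ∉ T} ‖Σ_{i,T} Σ_{T,T}⁻¹‖₂ ≤ c / √s` with `T` the support of `β*`. -/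
def WeakDependence (M : Problem) (c : ℝ) : Prop :=
  ∀ i, i ∉ supp M.beta →
    norm2 ((fun t : supp M.beta => M.Sig i t) ᵥ*
      (M.Sig.submatrix (fun t : supp M.beta => (t : Fin M.p))
        (fun t : supp M.beta => (t : Fin M.p)))⁻¹)
      ≤ c / √(M.s : ℝ)

/-- The sample covariance matrix `(1/n) ∑ₖ xₖ xₖᵀ` of a design matrix with rows `xₖ`. -/
def sampleCov (M : Problem) (x : Fin M.n → Fin M.p → ℝ) : Matrix (Fin M.p) (Fin M.p) ℝ :=
  (1 / (M.n : ℝ)) • ∑ k, Matrix.vecMulVec (x k) (x k)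

/-- The objective function of the sparse group Lasso. -/
def objective (M : Problem) (lam lamg : ℝ) (x : Fin M.n → Fin M.p → ℝ) (y : Fin M.n → ℝ)
    (v : Fin M.p → ℝ) : ℝ :=
  norm2 (y - Matrix.of x *ᵥ v) ^ 2 + lam * norm1 v + lamg * normOneTwo M.group v

/-- `v` is a sparse group Lasso estimate: a minimizer of the objective function. -/
def IsSGLasso (M : Problem) (lam lamg : ℝ) (x : Fin M.n → Fin M.p → ℝ) (y : Fin M.n → ℝ)
    (v : Fin M.p → ℝ) : Prop :=
  ∀ v', M.objective lam lamg x y v ≤ M.objective lam lamg x y v'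

/-- The constraint `‖H_α(Σ̂ m - e_i)‖_{∞,2} ≤ γ`. -/
def Feasible (M : Problem) (al ga : ℝ) (x : Fin M.n → Fin M.p → ℝ) (i : Fin M.p)
    (m : Fin M.p → ℝ) : Prop :=
  normInfTwo M.group
    (fun j => softThreshold al ((M.sampleCov x *ᵥ m) j - (Pi.single i 1 : Fin M.p → ℝ) j)) ≤ ga

/-- `m` solves: minimize `mᵀ Σ̂ m` subject to `‖H_α(Σ̂ m - e_i)‖_{∞,2} ≤ γ`. -/
def IsSolution (M : Problem) (al ga : ℝ) (x : Fin M.n → Fin M.p → ℝ) (i : Fin M.p)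
    (m : Fin M.p → ℝ) : Prop :=
  M.Feasible al ga x i m ∧
    ∀ m', M.Feasible al ga x i m' → m ⬝ᵥ M.sampleCov x *ᵥ m ≤ m' ⬝ᵥ M.sampleCov x *ᵥ m'

end Problem

/-- The random elements of a double sparse regression problem. -/
structure Sample (M : Problem) (Ω : Type*) where
  /-- the design matrix, given by its rows -/
  X : Ω → Fin M.n → Fin M.p → ℝ
  /-- the noise -/
  eps : Ω → Fin M.n → ℝ
  /-- the sparse group Lasso estimator `β̂` -/
  betaHat : Ω → Fin M.p → ℝ
  /-- the matrix `M̂` with rows `m̂_i`, as a function of the design matrix -/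
  Mhat : (Fin M.n → Fin M.p → ℝ) → Fin M.p → Fin M.p → ℝ

namespace Sample

variable {M : Problem} {Ω : Type*}

/-- The response `Y = X β* + ε`. -/
def Y (D : Sample M Ω) (ω : Ω) : Fin M.n → ℝ :=
  Matrix.of (D.X ω) *ᵥ M.beta + D.eps ω

/-- The debiased estimator `β̂ᵘ = β̂ + (1/n) M̂ Xᵀ (Y - X β̂)`. -/
def betaU (D : Sample M Ω) (ω : Ω) : Fin M.p → ℝ :=
  D.betaHat ω + (1 / (M.n : ℝ)) •
    (Matrix.of (D.Mhat (D.X ω)) *ᵥ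
      ((Matrix.of (D.X ω))ᵀ *ᵥ (D.Y ω - Matrix.of (D.X ω) *ᵥ D.betaHat ω)))

/-- The covariance matrix `σ² M̂ Σ̂ M̂ᵀ` at the design matrix `x`. -/
def covMat (D : Sample M Ω) (σ : ℝ) (x : Fin M.n → Fin M.p → ℝ) :
    Matrix (Fin M.p) (Fin M.p) ℝ :=
  σ ^ 2 • (Matrix.of (D.Mhat x) * M.sampleCov x * (Matrix.of (D.Mhat x))ᵀ)

/-- The standardized coordinate `√n (β̂ᵘ_i - β*_i) / √(m̂_iᵀ Σ̂ m̂_i)`. -/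
def standardized (D : Sample M Ω) (i : Fin M.p) (ω : Ω) : ℝ :=
  √(M.n : ℝ) * (D.betaU ω i - M.beta i) /
    √(D.Mhat (D.X ω) i ⬝ᵥ M.sampleCov (D.X ω) *ᵥ D.Mhat (D.X ω) i)

variable [MeasurableSpace Ω]

/-- The rows of `X` are i.i.d., centered, with covariance matrix `Σ` whose eigenvalues lie in
`[2/3, 3/2]`, and `E exp(aᵀ Σ^{-1/2} X_k) ≤ exp(κ² ‖a‖² / 2)` for every vector `a`. -/
structure SubGaussianDesign (D : Sample M Ω) (P : Measure Ω) (κ : ℝ) : Prop where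
  measurable : Measurable D.X
  indep : iIndepFun (fun k ω => D.X ω k) P
  identDistrib : ∀ k l, IdentDistrib (fun ω => D.X ω k) (fun ω => D.X ω l) P P
  mean : ∀ k i, ∫ ω, D.X ω k i ∂P = 0
  cov : ∀ k i j, cov[fun ω => D.X ω k i, fun ω => D.X ω k j; P] = M.Sig i j
  eigenvalues : ∃ h : M.Sig.IsHermitian, ∀ i, 2 / 3 ≤ h.eigenvalues i ∧ h.eigenvalues i ≤ 3 / 2
  subGaussian : ∀ k (a : Fin M.p → ℝ),
    Integrable (fun ω => Real.exp (a ⬝ᵥ (CFC.sqrt M.Sig)⁻¹ *ᵥ D.X ω k)) P ∧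
    ∫ ω, Real.exp (a ⬝ᵥ (CFC.sqrt M.Sig)⁻¹ *ᵥ D.X ω k) ∂P ≤ Real.exp (κ ^ 2 * norm2 a ^ 2 / 2)

/-- The noise variables are i.i.d. `N(0, σ²)` and independent of the design. -/
structure GaussianNoise (D : Sample M Ω) (P : Measure Ω) (σ : ℝ) : Prop where
  measurable : Measurable D.eps
  law : ∀ k, P.map (fun ω => D.eps ω k) = gaussianReal 0 (σ ^ 2).toNNReal
  indep : iIndepFun (fun k ω => D.eps ω k) P
  indep_design : IndepFun D.X D.eps P

/-- All assumptions on a problem and its sample: sparsity of `β*`, the design and noise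
assumptions, weak dependence with constant `c`, and the definitions of `β̂` and of `M̂` with the
tuning parameters belonging to the constant `K`. A row `m̂_i` is unrestricted (apart from
measurability) at those design matrices for which the defining program has no feasible point. -/
structure Assumptions (D : Sample M Ω) (P : Measure Ω) (κ σ c K : ℝ) : Prop where
  sparse : IsSparse M.group M.s M.sg M.beta
  design : D.SubGaussianDesign P κ
  weakDependence : M.WeakDependence c
  noise : D.GaussianNoise P σ
  measurable_betaHat : Measurable D.betaHat
  betaHat_spec : ∀ ω, M.IsSGLasso (M.lam K σ) (M.lamg K σ) (D.X ω) (D.Y ω) (D.betaHat ω)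
  measurable_Mhat : Measurable D.Mhat
  Mhat_spec : ∀ x i, (∃ m, M.Feasible (M.alpha K σ) (M.gam K σ) x i m) →
    M.IsSolution (M.alpha K σ) (M.gam K σ) x i (D.Mhat x i)

/-- `w | X ∼ N(0, σ² M̂ Σ̂ M̂ᵀ)`: almost surely, the regular conditional distribution of `w` given
the design matrix is this multivariate Gaussian distribution. -/
def CondGaussian (D : Sample M Ω) (P : Measure Ω) [IsProbabilityMeasure P] (σ : ℝ)
    (w : Ω → Fin M.p → ℝ) : Prop :=
  ∀ᵐ x ∂(P.map D.X),
    condDistrib (fun ω => (WithLp.toLp 2 (w ω) : EuclideanSpace ℝ (Fin M.p))) D.X P x =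
      multivariateGaussian 0 (D.covMat σ x)

end Sample

end

end SparseGroupLasso

/-! Write `h = β̂ - β*`. Since `Y - Xβ̂ = ε - Xh`, the scaled error `√n (β̂ᵘ - β*)` is the sum of a
remainder `√n (I - M̂Σ̂) h` and a noise term `n^{-1/2} M̂Xᵀε`. As `M̂` depends on `X` only, the
noise term is linear in `ε` once `X` is frozen, hence conditionally Gaussian
(`condGaussian_noiseTerm`).

The remainder is a product of two errors measured in dual ways. With `N(h) = ‖h‖₁/√s +
‖h‖_{1,2}/√s_g` (`mixedNorm`), the thresholded constraint gives `|((I - M̂Σ̂) h)_i| ≤ (λ√s/(nσ))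
N(h)` (`abs_sub_le_of_feasible`), and the sparse group Lasso satisfies `N(h) ≤ 122 λ√s/n`
(`isSGLasso_mixedNorm_le`). Multiplying, and using `λ²s = K²σ²Ln`, bounds the remainder by `122
K²σL/√n`.

These estimates need three random events: a restricted isometry for `Σ̂`, a bound on `Xᵀε`, and
feasibility of the programs, for which `Σ⁻¹e_i` is a witness. The common device is a duality
(`abs_dotProduct_le_atomicNorm`): a vector with little mass on every doubly sparse set is a small
functional for `N + ‖·‖₂`. So it is enough to control finite nets of doubly sparse test vectors, of
cardinality `exp(5L)`, or `exp(4L/s_g)` when only one group at a time matters; a Bernstein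
inequality for products of sub-Gaussian variables beats these counts. The total failure probability
is at most `6 exp(-L/s)`.

For asymptotic normality, a feasible row has variance proxy at least `1/16`, so the standardized
coordinate is close to the inner product of `ε` with a unit vector depending on `X`, whose law is
exactly `N(0, σ²)`. The difficulty is that `exp(-L/s)` need not tend to `0`. But if `L/s` is
bounded, then so are `p` and `d` (`dimension_le`), and a classical argument in bounded dimension,
with `Σ̂` invertible, takes over. `exists_measure_exceptional_le` joins the two regimes. -/

namespace SparseGroupLasso

/-! ### Double sparsity: duality -/

section Duality

variable {p d : ℕ} {g : Fin p → Fin d}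

/-- If every subset of `A` with at most `r` elements carries square mass at most `c`, and the entries
indexed by `A` are large, then `A` itself carries square mass at most `c`. -/
lemma sum_sq_le_of_subsets {A : Finset (Fin p)} {v : Fin p → ℝ} {r : ℕ} {a c : ℝ}
    (ha : 0 ≤ a) (hr : 0 < r) (hac : c ≤ r * a ^ 2) (hA : ∀ l ∈ A, a < |v l|)
    (h : ∀ S ⊆ A, S.card ≤ r → ∑ l ∈ S, v l ^ 2 ≤ c) :
    A.card ≤ r ∧ ∑ l ∈ A, v l ^ 2 ≤ c := by
  -- Otherwise an `r`-element subset of `A` would carry mass greater than `r a² ≥ c`.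
  have hcard : A.card < r := by
    by_contra! hlt
    obtain ⟨S, hSA, hS⟩ := Finset.exists_subset_card_eq hlt
    have h1 := h S hSA hS.le
    have h2 : ∑ l ∈ S, a ^ 2 < ∑ l ∈ S, v l ^ 2 := by
      refine Finset.sum_lt_sum_of_nonempty (Finset.card_pos.1 (hS ▸ hr)) fun l hl => ?_
      rw [← sq_abs (v l)]
      exact pow_lt_pow_left₀ (hA l (hSA hl)) ha two_ne_zero
    rw [Finset.sum_const, hS, nsmul_eq_mul] at h2
    linarith
  exact ⟨hcard.le, h A subset_rfl hcard.le⟩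

lemma abs_softThreshold {a : ℝ} (ha : 0 ≤ a) (x : ℝ) :
    |softThreshold a x| = max (|x| - a) 0 := by
  unfold softThreshold
  rcases eq_or_ne x 0 with rfl | hx
  · simp [ha]
  · have h : |Real.sign x| = 1 := by
      rcases hx.lt_or_gt with h | h
      · simp [Real.sign_of_neg h]
      · simp [Real.sign_of_pos h]
    rw [abs_mul, h, one_mul, abs_of_nonneg (le_max_right _ _)]

lemma normInfTwo_le {v : Fin p → ℝ} {c : ℝ} (hc : 0 ≤ c) (h : ∀ j, groupNorm g v j ≤ c) :
    normInfTwo g v ≤ c := by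
  rcases isEmpty_or_nonempty (Fin d) with hd | hd
  · simpa [normInfTwo, Real.iSup_of_isEmpty] using hc
  · exact ciSup_le h

lemma groupNorm_le_normInfTwo (v : Fin p → ℝ) (j : Fin d) :
    groupNorm g v j ≤ normInfTwo g v :=
  le_ciSup (f := fun j => groupNorm g v j) (Set.finite_range _).bddAbove j

/-- A vector with small mass on all small subsets of each group satisfies the thresholded
constraint. -/
lemma normInfTwo_softThreshold_le {v : Fin p → ℝ} {r : ℕ} {a c : ℝ} (ha : 0 ≤ a) (hc : 0 ≤ c)
    (hr : 0 < r) (hac : c ^ 2 ≤ r * a ^ 2)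
    (h : ∀ S : Finset (Fin p), S.card ≤ r → (S.image g).card ≤ 1 → ∑ l ∈ S, v l ^ 2 ≤ c ^ 2) :
    normInfTwo g (fun l => softThreshold a (v l)) ≤ c := by
  refine normInfTwo_le hc fun j => ?_
  refine Real.sqrt_le_iff.2 ⟨hc, ?_⟩
  -- Thresholding kills the entries outside `A` and shrinks those in `A`, so the mass of `v` on `A`
  -- suffices; `c² ≤ r a²` is what keeps `A` small enough to be tested.
  set A : Finset (Fin p) := Finset.univ.filter fun l => g l = j ∧ a < |v l| with hA
  have hAc : ∑ l ∈ A, v l ^ 2 ≤ c ^ 2 := by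
    refine (sum_sq_le_of_subsets ha hr hac (fun l hl => (Finset.mem_filter.1 hl).2.2)
      fun S hS hSr => h S hSr ?_).2
    rw [Finset.card_le_one]
    intro x hx y hy
    obtain ⟨x', hx', rfl⟩ := Finset.mem_image.1 hx
    obtain ⟨y', hy', rfl⟩ := Finset.mem_image.1 hy
    rw [(Finset.mem_filter.1 (hS hx')).2.1, (Finset.mem_filter.1 (hS hy')).2.1]
  refine le_trans ?_ hAc
  rw [hA, ← Finset.filter_filter, Finset.sum_filter (fun l => a < |v l|)]
  refine Finset.sum_le_sum fun l _ => ?_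
  rw [← sq_abs, abs_softThreshold ha]
  split_ifs with hl
  · rw [max_eq_left (by linarith), ← sq_abs (v l)]
    exact pow_le_pow_left₀ (by linarith) (by linarith) 2
  · rw [max_eq_right (by linarith)]; norm_num

lemma norm2_sq {ι : Type*} [Fintype ι] (v : ι → ℝ) : norm2 v ^ 2 = ∑ i, v i ^ 2 :=
  Real.sq_sqrt (Finset.sum_nonneg fun _ _ => sq_nonneg _)

lemma norm2_nonneg {ι : Type*} [Fintype ι] (v : ι → ℝ) : 0 ≤ norm2 v := Real.sqrt_nonneg _

lemma groupNorm_nonneg (v : Fin p → ℝ) (j : Fin d) : 0 ≤ groupNorm g v j := Real.sqrt_nonneg _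

lemma groupNorm_sq (v : Fin p → ℝ) (j : Fin d) :
    groupNorm g v j ^ 2 = ∑ i with g i = j, v i ^ 2 :=
  Real.sq_sqrt (Finset.sum_nonneg fun _ _ => sq_nonneg _)

lemma sum_groupNorm_sq (v : Fin p → ℝ) : ∑ j, groupNorm g v j ^ 2 = norm2 v ^ 2 := by
  simp_rw [groupNorm_sq, norm2_sq]
  exact Finset.sum_fiberwise _ _ _

/-- Cauchy-Schwarz on a set of coordinates. -/
lemma sum_mul_le_of_sum_sq_le {ι : Type*} {A : Finset ι} {u h : ι → ℝ} {m k : ℝ}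
    (hm : 0 ≤ m) (hk : 0 ≤ k) (hu : ∑ l ∈ A, u l ^ 2 ≤ m ^ 2) (hh : ∑ l ∈ A, h l ^ 2 ≤ k ^ 2) :
    ∑ l ∈ A, |u l * h l| ≤ m * k := by
  have h1 := Finset.sum_mul_sq_le_sq_mul_sq A (fun l => |u l|) (fun l => |h l|)
  simp only [sq_abs] at h1
  simp_rw [abs_mul]
  refine (pow_le_pow_iff_left₀ (Finset.sum_nonneg fun _ _ => by positivity) (by positivity)
    two_ne_zero).1 ?_
  calc _ ≤ _ := h1
    _ ≤ m ^ 2 * k ^ 2 := by gcongr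
    _ = _ := by ring

/-- The norm `‖h‖₁ / √s + ‖h‖_{1,2} / √s_g`. -/
noncomputable def mixedNorm (g : Fin p → Fin d) (s sg : ℕ) (h : Fin p → ℝ) : ℝ :=
  norm1 h / √(s : ℝ) + normOneTwo g h / √(sg : ℝ)

/-- The sum of `mixedNorm` and the Euclidean norm. -/
noncomputable def atomicNorm (g : Fin p → Fin d) (s sg : ℕ) (h : Fin p → ℝ) : ℝ :=
  mixedNorm g s sg h + norm2 h

lemma norm1_nonneg (v : Fin p → ℝ) : 0 ≤ norm1 v := Finset.sum_nonneg fun _ _ => abs_nonneg _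

lemma normOneTwo_nonneg (v : Fin p → ℝ) : 0 ≤ normOneTwo g v :=
  Finset.sum_nonneg fun _ _ => groupNorm_nonneg _ _

lemma mixedNorm_nonneg (s sg : ℕ) (v : Fin p → ℝ) : 0 ≤ mixedNorm g s sg v :=
  add_nonneg (div_nonneg (norm1_nonneg v) (Real.sqrt_nonneg _))
    (div_nonneg (normOneTwo_nonneg v) (Real.sqrt_nonneg _))

lemma atomicNorm_nonneg (s sg : ℕ) (v : Fin p → ℝ) : 0 ≤ atomicNorm g s sg v :=
  add_nonneg (mixedNorm_nonneg s sg v) (norm2_nonneg v)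

/-- A vector that is uniformly bounded on doubly sparse sets defines a functional bounded by the
atomic norm. -/
lemma abs_dotProduct_le_atomicNorm {s sg : ℕ} (hsg : 0 < sg) (hs : sg ≤ s) {v : Fin p → ℝ} {M : ℝ}
    (hM : 0 ≤ M)
    (h : ∀ S : Finset (Fin p), S.card ≤ 2 * s → (S.image g).card ≤ sg → ∑ l ∈ S, v l ^ 2 ≤ M ^ 2)
    (x : Fin p → ℝ) : |v ⬝ᵥ x| ≤ M * atomicNorm g s sg x := by
  classical
  have hs0 : 0 < s := hsg.trans_le hs
  have hsR : (0 : ℝ) < s := by exact_mod_cast hs0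
  have hsgR : (0 : ℝ) < sg := by exact_mod_cast hsg
  -- The functional splits into three pieces, one for each term of the norm: entries of size at most
  -- `a` pair with `‖x‖₁`, the large entries of groups where these have mass at most `c²` pair with
  -- `‖x‖_{1,2}`, and the large entries of the remaining groups pair with `‖x‖₂`.
  set a := M / √(s : ℝ) with ha
  set c := M / √(sg : ℝ) with hc
  have ha0 : 0 ≤ a := by positivity
  have hc0 : 0 ≤ c := by positivity
  have hsa : s * a ^ 2 = M ^ 2 := by
    rw [ha, div_pow, Real.sq_sqrt hsR.le]; field_simp
  have hsc : sg * c ^ 2 = M ^ 2 := by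
    rw [hc, div_pow, Real.sq_sqrt hsgR.le]; field_simp
  let A : Fin d → Finset (Fin p) := fun j => Finset.univ.filter fun l => g l = j ∧ a < |v l|
  have hAg : ∀ j, ∀ l ∈ A j, g l = j := fun j l hl => (Finset.mem_filter.1 hl).2.1
  have hAa : ∀ j, ∀ l ∈ A j, a < |v l| := fun j l hl => (Finset.mem_filter.1 hl).2.2
  let J : Finset (Fin d) := Finset.univ.filter fun j => c ^ 2 < ∑ l ∈ A j, v l ^ 2
  -- This is `⌈s / sg⌉`, so `s ≤ r * sg ≤ 2 * s`; the rounding is the reason for testing sets of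
  -- size `2 * s`.
  set r := (s + sg - 1) / sg with hr
  have hr1 : s ≤ r * sg := by
    have := Nat.lt_div_mul_add (a := s + sg - 1) hsg
    rw [← hr] at this
    omega
  have hr2 : r * sg ≤ 2 * s := by
    have := Nat.div_mul_le_self (s + sg - 1) sg
    rw [← hr] at this
    omega
  have hr0 : 0 < r := by
    rcases Nat.eq_zero_or_pos r with h0 | h0
    · rw [h0] at hr1; omega
    · exact h0
  have hca : c ^ 2 ≤ r * a ^ 2 := by
    have h1 : (s : ℝ) ≤ r * sg := by exact_mod_cast hr1
    have h2 : (sg : ℝ) * c ^ 2 ≤ sg * (r * a ^ 2) := by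
      rw [hsc, ← hsa]
      calc (s : ℝ) * a ^ 2 ≤ (r * sg) * a ^ 2 := by gcongr
        _ = _ := by ring
    exact le_of_mul_le_mul_left h2 hsgR
  have hdisj : ∀ {ι : Finset (Fin d)} {B : Fin d → Finset (Fin p)}, (∀ j, B j ⊆ A j) →
      Set.PairwiseDisjoint (ι : Set (Fin d)) B := by
    intro ι B hB i _ j _ hij
    refine Finset.disjoint_left.2 fun l hi hj => hij ?_
    rw [← hAg i l (hB i hi), ← hAg j l (hB j hj)]
  -- If `sg` groups were heavy, at most `r` entries of each would already carry mass above `c²`.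
  -- Their union has at most `2 * s` entries in `sg` groups and mass above `sg * c² = M²`.
  have hJ : J.card < sg := by
    by_contra! hlt
    obtain ⟨J', hJ'J, hJ'⟩ := Finset.exists_subset_card_eq hlt
    have hex : ∀ j, ∃ S ⊆ A j, S.card ≤ r ∧ (j ∈ J' → c ^ 2 < ∑ l ∈ S, v l ^ 2) := by
      intro j
      by_contra! hcon
      have hj := (hcon ∅ (Finset.empty_subset _) (by simp)).1
      have := (sum_sq_le_of_subsets ha0 hr0 hca (hAa j) fun S hS hSr => (hcon S hS hSr).2).2
      have h2 := (Finset.mem_filter.1 (hJ'J hj)).2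
      linarith
    choose S hSA hSr hSc using hex
    have h1 := h (J'.biUnion S) ?_ ?_
    · rw [Finset.sum_biUnion (hdisj hSA)] at h1
      have h2 : ∑ j ∈ J', c ^ 2 < ∑ j ∈ J', ∑ l ∈ S j, v l ^ 2 :=
        Finset.sum_lt_sum_of_nonempty (Finset.card_pos.1 (hJ' ▸ hsg)) hSc
      rw [Finset.sum_const, hJ', nsmul_eq_mul, hsc] at h2
      linarith
    · refine (Finset.card_biUnion_le_card_mul _ _ r fun j _ => hSr j).trans ?_
      rw [hJ', mul_comm]; exact hr2
    · rw [← hJ']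
      refine Finset.card_le_card fun j hj => ?_
      obtain ⟨l, hl, rfl⟩ := Finset.mem_image.1 hj
      obtain ⟨j', hj', hl'⟩ := Finset.mem_biUnion.1 hl
      rwa [hAg j' l (hSA j' hl')]
  -- The heavy groups number fewer than `sg`, so every subset of their large entries with at most
  -- `s` elements is an admissible test set.
  have hB : ∑ l ∈ J.biUnion A, v l ^ 2 ≤ M ^ 2 := by
    refine (sum_sq_le_of_subsets ha0 hs0 hsa.ge ?_ fun S hS hSs => h S (by omega) ?_).2
    · intro l hl
      obtain ⟨j, _, hl'⟩ := Finset.mem_biUnion.1 hl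
      exact hAa j l hl'
    · refine le_trans (Finset.card_le_card fun j hj => ?_) hJ.le
      obtain ⟨l, hl, rfl⟩ := Finset.mem_image.1 hj
      obtain ⟨j', hj', hl'⟩ := Finset.mem_biUnion.1 (hS hl)
      rwa [hAg j' l hl']
  have hmain : ∑ l, |v l * x l| ≤ a * norm1 x + (M * norm2 x + c * normOneTwo g x) := by
    have hsplit : ∑ l, |v l * x l| = ∑ l with ¬ a < |v l|, |v l * x l| +
        ∑ j, ∑ l ∈ A j, |v l * x l| := by
      rw [← Finset.sum_filter_add_sum_filter_not Finset.univ (fun l => a < |v l|), add_comm]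
      congr 1
      rw [← Finset.sum_fiberwise (Finset.univ.filter fun l => a < |v l|) g]
      refine Finset.sum_congr rfl fun j _ => Finset.sum_congr ?_ fun _ _ => rfl
      ext l; simp [A, and_comm]
    have hJsplit : ∑ j, ∑ l ∈ A j, |v l * x l| =
        ∑ l ∈ J.biUnion A, |v l * x l| + ∑ j ∈ Jᶜ, ∑ l ∈ A j, |v l * x l| := by
      rw [Finset.sum_biUnion (hdisj fun _ => subset_rfl), Finset.sum_add_sum_compl]
    rw [hsplit, hJsplit]
    gcongr
    · unfold norm1
      rw [Finset.mul_sum]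
      refine le_trans (Finset.sum_le_sum fun l hl => ?_)
        (Finset.sum_le_sum_of_subset_of_nonneg (Finset.subset_univ
          (Finset.univ.filter fun l => ¬ a < |v l|)) fun l _ _ =>
          mul_nonneg ha0 (abs_nonneg (x l)))
      rw [abs_mul]
      have := (Finset.mem_filter.1 hl).2
      gcongr
      linarith
    · refine sum_mul_le_of_sum_sq_le hM (norm2_nonneg x) hB ?_
      rw [norm2_sq]
      exact Finset.sum_le_sum_of_subset_of_nonneg (Finset.subset_univ _) fun _ _ _ => sq_nonneg _
    · unfold normOneTwo
      rw [Finset.mul_sum]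
      refine le_trans (Finset.sum_le_sum (g := fun j => c * groupNorm g x j) fun j hj => ?_)
        (Finset.sum_le_sum_of_subset_of_nonneg (Finset.subset_univ _) fun j _ _ =>
          mul_nonneg hc0 (groupNorm_nonneg x j))
      refine sum_mul_le_of_sum_sq_le hc0 (groupNorm_nonneg x j) ?_ ?_
      · have := Finset.mem_compl.1 hj
        simpa [J] using this
      · rw [groupNorm_sq]
        refine Finset.sum_le_sum_of_subset_of_nonneg (fun l hl => ?_) fun _ _ _ => sq_nonneg _
        simpa using hAg j l hl
  calc |v ⬝ᵥ x| ≤ ∑ l, |v l * x l| := Finset.abs_sum_le_sum_abs _ _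
    _ ≤ _ := hmain
    _ = M * atomicNorm g s sg x := by
      rw [atomicNorm, mixedNorm, ha, hc]; ring

end Duality

/-! ### Finite nets for doubly sparse vectors -/

section Nets

/-- A ball of radius `2` in a finite-dimensional space is covered by at most `5 ^ dim` unit balls
centered in it. -/
lemma exists_finset_cover_ball (E : Type*) [NormedAddCommGroup E] [NormedSpace ℝ E]
    [FiniteDimensional ℝ E] :
    ∃ t : Finset E, t.card ≤ 5 ^ Module.finrank ℝ E ∧ (∀ c ∈ t, ‖c‖ ≤ 2) ∧
      ∀ x : E, ‖x‖ ≤ 2 → ∃ c ∈ t, ‖x - c‖ ≤ 1 := by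
  classical
  -- A `1`-separated subset of maximal cardinality is a `1`-net; the volume bound `5 ^ dim` makes
  -- the maximum exist.
  let Q : ℕ → Prop := fun k => ∃ t : Finset E, t.card = k ∧ (∀ c ∈ t, ‖c‖ ≤ 2) ∧
    ∀ c ∈ t, ∀ c' ∈ t, c ≠ c' → 1 ≤ ‖c - c'‖
  have hQ0 : Q 0 := ⟨∅, by simp⟩
  obtain ⟨t, htc, ht2, hts⟩ :=
    Nat.findGreatest_spec (P := Q) (Nat.zero_le (5 ^ Module.finrank ℝ E)) hQ0
  refine ⟨t, Besicovitch.card_le_of_separated t ht2 hts, ht2, fun x hx => ?_⟩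
  by_contra! hcon
  have hxt : x ∉ t := fun h => by simpa using (hcon x h).trans_le' zero_le_one
  have hins : Q (t.card + 1) := by
    refine ⟨insert x t, Finset.card_insert_of_notMem hxt, ?_, ?_⟩
    · intro c hc
      rcases Finset.mem_insert.1 hc with rfl | hc
      exacts [hx, ht2 c hc]
    · intro c hc c' hc' hne
      rcases Finset.mem_insert.1 hc with hx | hc <;> rcases Finset.mem_insert.1 hc' with hx' | hc'
      · exact absurd (hx.trans hx'.symm) hne
      · rw [hx]; exact (hcon c' hc').le
      · rw [hx', norm_sub_rev]; exact (hcon c hc).le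
      · exact hts c hc c' hc' hne
  have hle : t.card + 1 ≤ 5 ^ Module.finrank ℝ E := by
    obtain ⟨t', h1, h2, h3⟩ := hins
    exact h1 ▸ Besicovitch.card_le_of_separated t' h2 h3
  have := Nat.le_findGreatest hle hins
  omega

variable {p d : ℕ} {g : Fin p → Fin d}

/-- Halving a `1`-net of the radius-`2` ball gives test vectors in the unit ball. The net point `c`
nearest to `2 v_S / ‖v_S‖` has `⟨c, v_S⟩ ≥ 2‖v_S‖ - ‖v_S‖`, so the test vector `c / 2` detects at
least half of `‖v_S‖`. -/
lemma exists_net_of_support (S : Finset (Fin p)) :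
    ∃ N : Finset (Fin p → ℝ), N.card ≤ 5 ^ S.card ∧ (∀ w ∈ N, norm2 w ≤ 1) ∧
      ∀ (v : Fin p → ℝ) (M : ℝ), (∀ w ∈ N, |w ⬝ᵥ v| ≤ M) → ∑ l ∈ S, v l ^ 2 ≤ (2 * M) ^ 2 := by
  classical
  obtain ⟨t, ht, ht2, htc⟩ := exists_finset_cover_ball (EuclideanSpace ℝ S)
  rw [finrank_euclideanSpace, Fintype.card_coe] at ht
  let φ : EuclideanSpace ℝ S → Fin p → ℝ := fun c i => if h : i ∈ S then c ⟨i, h⟩ / 2 else 0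
  have hsum : ∀ (c : EuclideanSpace ℝ S) (f : Fin p → ℝ → ℝ), (∀ i, f i 0 = 0) →
      ∑ i, f i (φ c i) = ∑ i : S, f i (c i / 2) := by
    intro c f hf
    rw [← Finset.sum_subset (Finset.subset_univ S), ← Finset.sum_coe_sort S]
    · exact Finset.sum_congr rfl fun i _ => by simp [φ]
    · intro i _ hi
      simp [φ, hi, hf]
  refine ⟨t.image φ, Finset.card_image_le.trans ht, ?_, ?_⟩
  · intro w hw
    obtain ⟨c, hc, rfl⟩ := Finset.mem_image.1 hw
    refine Real.sqrt_le_one.2 ?_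
    rw [hsum c (fun _ x => x ^ 2) (by simp)]
    have h1 := ht2 c hc
    have h2 : ‖c‖ ^ 2 ≤ 2 ^ 2 := by gcongr
    rw [EuclideanSpace.real_norm_sq_eq] at h2
    simp_rw [div_pow]
    rw [← Finset.sum_div]
    linarith
  · intro v M hM
    set vS : EuclideanSpace ℝ S := WithLp.toLp 2 fun i => v i with hvS
    have hn : ∑ l ∈ S, v l ^ 2 = ‖vS‖ ^ 2 := by
      rw [EuclideanSpace.real_norm_sq_eq, ← Finset.sum_coe_sort S]
    rw [hn]
    rcases eq_or_ne vS 0 with h0 | h0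
    · rw [h0, norm_zero, zero_pow two_ne_zero]; positivity
    have hpos : 0 < ‖vS‖ := norm_pos_iff.2 h0
    obtain ⟨c, hc, hcu⟩ := htc ((2 / ‖vS‖) • vS) (by
      rw [norm_smul, Real.norm_of_nonneg (div_nonneg zero_le_two hpos.le),
        div_mul_cancel₀ _ hpos.ne'])
    have h1 := hM (φ c) (Finset.mem_image_of_mem φ hc)
    have h2 : φ c ⬝ᵥ v = inner ℝ c vS / 2 := by
      rw [dotProduct, hsum c (fun i x => x * v i) (by simp), PiLp.inner_apply, Finset.sum_div]
      refine Finset.sum_congr rfl fun i _ => ?_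
      simp [hvS]; ring
    have h3 : inner ℝ ((2 / ‖vS‖) • vS) vS = 2 * ‖vS‖ := by
      rw [real_inner_smul_left, real_inner_self_eq_norm_sq]; field_simp
    have h4 : inner ℝ ((2 / ‖vS‖) • vS - c) vS ≤ 1 * ‖vS‖ :=
      (real_inner_le_norm _ _).trans (by gcongr)
    rw [inner_sub_left, h3] at h4
    rw [h2] at h1
    have h5 := (le_abs_self _).trans h1
    exact pow_le_pow_left₀ hpos.le (by linarith) 2

lemma card_groups_le (G : Finset (Fin d)) :
    (Finset.univ.filter fun i => g i ∈ G).card ≤ G.card * maxGroupSize g := by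
  classical
  have h : (Finset.univ.filter fun i => g i ∈ G) =
      G.biUnion fun j => Finset.univ.filter fun i => g i = j := by
    ext i; simp
  rw [h]
  exact Finset.card_biUnion_le_card_mul _ _ _ fun j _ =>
    Finset.le_sup (f := groupSize g) (Finset.mem_univ j)

/-- A finite net testing the mass of a vector on all sets of at most `m` coordinates meeting at most
`k` groups. -/
lemma exists_net (g : Fin p → Fin d) (m : ℕ) {k : ℕ} (hk : k ≤ d) :
    ∃ N : Finset (Fin p → ℝ), N.card ≤ d.choose k * (k * maxGroupSize g) ^ m * 5 ^ m ∧
      (∀ w ∈ N, norm2 w ≤ 1) ∧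
      ∀ (v : Fin p → ℝ) (M : ℝ), (∀ w ∈ N, |w ⬝ᵥ v| ≤ M) →
        ∀ S : Finset (Fin p), S.card ≤ m → (S.image g).card ≤ k →
          ∑ l ∈ S, v l ^ 2 ≤ (2 * M) ^ 2 := by
  classical
  choose N hN hN1 hNS using fun S : Finset (Fin p) => exists_net_of_support S
  let F : Finset (Finset (Fin p)) := Finset.univ.filter fun S =>
    S.Nonempty ∧ S.card ≤ m ∧ (S.image g).card ≤ k
  -- An overcount: choose `k` groups, then `m` coordinates in them with repetition. A nonempty set
  -- of at most `m` coordinates is the image of some map from `Fin m`; the empty set is treated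
  -- apart.
  let F' : Finset (Finset (Fin p)) := (Finset.univ.powersetCard k).biUnion fun G : Finset (Fin d) =>
    (Fintype.piFinset fun _ : Fin m => Finset.univ.filter fun i => g i ∈ G).image
      fun f => Finset.univ.image f
  have hFF' : F ⊆ F' := by
    intro S hS
    obtain ⟨hne, hm, hgk⟩ := (Finset.mem_filter.1 hS).2
    obtain ⟨G, hG1, _, hG2⟩ := Finset.exists_subsuperset_card_eq (Finset.subset_univ (S.image g)) hgk
      (by simpa using hk)
    have : Nonempty S := hne.to_subtype
    obtain ⟨e⟩ : Nonempty (S ↪ Fin m) :=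
      Function.Embedding.nonempty_of_card_le (by simpa using hm)
    obtain ⟨f, hsurj⟩ : ∃ f : Fin m → S, Function.Surjective f :=
      ⟨_, Function.invFun_surjective e.injective⟩
    refine Finset.mem_biUnion.2 ⟨G, Finset.mem_powersetCard.2 ⟨Finset.subset_univ _, hG2⟩,
      Finset.mem_image.2 ⟨fun a => (f a : Fin p), ?_, ?_⟩⟩
    · rw [Fintype.mem_piFinset]
      intro a
      simp only [Finset.mem_filter, Finset.mem_univ, true_and]
      exact hG1 (Finset.mem_image_of_mem g (f a).2)
    · ext i
      simp only [Finset.mem_image, Finset.mem_univ, true_and]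
      constructor
      · rintro ⟨a, rfl⟩; exact (f a).2
      · intro hi
        obtain ⟨a, ha⟩ := hsurj ⟨i, hi⟩
        exact ⟨a, by rw [ha]⟩
  have hF : F.card ≤ d.choose k * (k * maxGroupSize g) ^ m := by
    refine (Finset.card_le_card hFF').trans ((Finset.card_biUnion_le_card_mul _ _
      ((k * maxGroupSize g) ^ m) fun G hG => ?_).trans ?_)
    · refine Finset.card_image_le.trans ?_
      rw [Fintype.card_piFinset]
      simp only [Finset.prod_const, Finset.card_univ, Fintype.card_fin]
      rw [← (Finset.mem_powersetCard.1 hG).2]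
      exact Nat.pow_le_pow_left (card_groups_le G) m
    · rw [Finset.card_powersetCard]; simp
  refine ⟨F.biUnion N, ?_, ?_, ?_⟩
  · refine (Finset.card_biUnion_le_card_mul _ _ (5 ^ m) fun S hS => ?_).trans (by gcongr)
    exact (hN S).trans (Nat.pow_le_pow_right (by norm_num) (Finset.mem_filter.1 hS).2.2.1)
  · intro w hw
    obtain ⟨S, _, hwS⟩ := Finset.mem_biUnion.1 hw
    exact hN1 S w hwS
  · intro v M hM S hSm hSk
    rcases S.eq_empty_or_nonempty with rfl | hne
    · rw [Finset.sum_empty]; positivity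
    · exact hNS S v M fun w hw => hM w
        (Finset.mem_biUnion.2 ⟨S, Finset.mem_filter.2 ⟨Finset.mem_univ _, hne, hSm, hSk⟩, hw⟩)

end Nets

/-! ### A Bernstein inequality for products of sub-Gaussian variables -/

section Bernstein

variable {Ω : Type*} [MeasurableSpace Ω] {P : Measure Ω} [IsProbabilityMeasure P]

lemma lintegral_exp_sq_gaussianReal_le :
    ∫⁻ x, ENNReal.ofReal (Real.exp (x ^ 2 / 4)) ∂(gaussianReal 0 1) ≤ ENNReal.ofReal 2 := by
  rw [gaussianReal_of_var_ne_zero _ one_ne_zero, lintegral_withDensity_eq_lintegral_mul _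
    (measurable_gaussianPDF 0 1) (by fun_prop)]
  have h1 : ∀ x : ℝ, (gaussianPDF 0 1 * fun x => ENNReal.ofReal (Real.exp (x ^ 2 / 4))) x =
      ENNReal.ofReal ((√(2 * Real.pi))⁻¹ * Real.exp (-(1 / 4) * x ^ 2)) := by
    intro x
    rw [Pi.mul_apply, gaussianPDF, ← ENNReal.ofReal_mul (gaussianPDFReal_nonneg _ _ _),
      gaussianPDFReal, mul_assoc, ← Real.exp_add]
    congr 3
    · simp
    · simp; ring
  simp_rw [h1]
  have hint : Integrable fun x : ℝ => (√(2 * Real.pi))⁻¹ * Real.exp (-(1 / 4) * x ^ 2) :=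
    (integrable_exp_neg_mul_sq (by norm_num)).const_mul _
  rw [← ofReal_integral_eq_lintegral_ofReal hint (ae_of_all _ fun x => by positivity),
    integral_const_mul, integral_gaussian]
  refine ENNReal.ofReal_le_ofReal ?_
  rw [inv_mul_le_iff₀ (by positivity), ← Real.sqrt_sq (zero_le_two : (0 : ℝ) ≤ 2),
    ← Real.sqrt_mul (by positivity)]
  refine Real.sqrt_le_sqrt ?_
  rw [Real.sqrt_sq zero_le_two]
  have := Real.pi_pos
  rw [div_div_eq_mul_div]
  nlinarith

/-- The square of a sub-Gaussian variable has an exponential moment. -/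
lemma integrable_exp_sq_of_hasSubgaussianMGF {X : Ω → ℝ} {c : NNReal} (hc : 0 < c)
    (hX : Measurable X) (h : HasSubgaussianMGF X c P) :
    Integrable (fun ω => Real.exp (X ω ^ 2 / (4 * c))) P ∧
      ∫ ω, Real.exp (X ω ^ 2 / (4 * c)) ∂P ≤ 2 := by
  have hc' : (0 : ℝ) < c := hc
  have hle : ∫⁻ ω, ENNReal.ofReal (Real.exp (X ω ^ 2 / (4 * c))) ∂P ≤ ENNReal.ofReal 2 := by
    -- Linearize the square with an auxiliary standard Gaussian `Z`: `exp(x²/(4c)) = E exp(Z x /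
    -- √(2c))`. After exchanging the integrals, the sub-Gaussian bound at `Z / √(2c)` leaves `E
    -- exp(Z²/4) = √2`.
    have h1 : ∀ ω, ENNReal.ofReal (Real.exp (X ω ^ 2 / (4 * c))) =
        ∫⁻ x, ENNReal.ofReal (Real.exp (x / √(2 * c) * X ω)) ∂(gaussianReal 0 1) := by
      intro ω
      have h2 := congrFun (mgf_id_gaussianReal (μ := 0) (v := 1)) (X ω / √(2 * c))
      rw [mgf] at h2
      have h3 : ∀ x : ℝ, x / √(2 * c) * X ω = X ω / √(2 * c) * id x := fun x => by simp; ring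
      simp_rw [h3]
      have hi : Integrable (fun x => Real.exp (X ω / √(2 * c) * id x)) (gaussianReal 0 1) :=
        integrable_exp_mul_gaussianReal _
      rw [← ofReal_integral_eq_lintegral_ofReal hi (ae_of_all _ fun x => (Real.exp_pos _).le), h2,
        div_pow, Real.sq_sqrt (by positivity)]
      congr 2
      simp; field_simp; norm_num
    simp_rw [h1]
    rw [lintegral_lintegral_swap (by fun_prop)]
    refine le_trans (lintegral_mono fun x => ?_) lintegral_exp_sq_gaussianReal_le
    rw [← ofReal_integral_eq_lintegral_ofReal (h.integrable_exp_mul _)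
      (ae_of_all _ fun x => (Real.exp_pos _).le)]
    refine ENNReal.ofReal_le_ofReal ((h.mgf_le _).trans (le_of_eq ?_))
    rw [div_pow, Real.sq_sqrt (by positivity)]
    congr 1
    field_simp; norm_num
  have hint : Integrable (fun ω => Real.exp (X ω ^ 2 / (4 * c))) P := by
    refine ⟨by fun_prop, ?_⟩
    rw [hasFiniteIntegral_iff_ofReal (ae_of_all _ fun x => (Real.exp_pos _).le)]
    exact hle.trans_lt ENNReal.ofReal_lt_top
  refine ⟨hint, ?_⟩
  rw [← ofReal_integral_eq_lintegral_ofReal hint (ae_of_all _ fun x => (Real.exp_pos _).le)] at hle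
  exact (ENNReal.ofReal_le_ofReal_iff zero_le_two).1 hle

/-- The linear term is kept because it integrates to zero for a centered variable; `sq_mul_exp_le`
absorbs the quadratic term into an exponential moment. -/
lemma exp_le_one_add_add_sq_mul_exp_abs (x : ℝ) :
    Real.exp x ≤ 1 + x + x ^ 2 * Real.exp |x| := by
  have h1 : Real.exp x - 1 ≤ x * Real.exp x := by
    have := Real.add_one_le_exp (-x)
    have h2 : (1 - x) * Real.exp x ≤ 1 := by
      calc (1 - x) * Real.exp x ≤ Real.exp (-x) * Real.exp x := by gcongr; linarith
        _ = 1 := by rw [← Real.exp_add]; simp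
    linarith
  have h3 := Real.add_one_le_exp x
  have h4 : 1 ≤ Real.exp |x| := Real.one_le_exp (abs_nonneg x)
  rcases le_total 0 x with hx | hx
  · rw [abs_of_nonneg hx]
    nlinarith
  · nlinarith [sq_nonneg x]

lemma sq_mul_exp_le {l μ z : ℝ} (hμ : 0 < μ) (hl : |l| ≤ μ / 2) :
    (l * z) ^ 2 * Real.exp |l * z| ≤ 8 * l ^ 2 / μ ^ 2 * Real.exp (μ * |z|) := by
  have h1 : (μ * |z| / 2) ^ 2 ≤ 2 * Real.exp (μ * |z| / 2) := by
    have := Real.quadratic_le_exp_of_nonneg (x := μ * |z| / 2) (by positivity)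
    have h0 : 0 ≤ μ * |z| / 2 := by positivity
    linarith
  have h2 : Real.exp |l * z| ≤ Real.exp (μ * |z| / 2) := by
    rw [abs_mul]
    gcongr
    calc |l| * |z| ≤ μ / 2 * |z| := by gcongr
      _ = _ := by ring
  have h3 : (l * z) ^ 2 = 4 * l ^ 2 / μ ^ 2 * (μ * |z| / 2) ^ 2 := by
    rw [mul_pow, ← sq_abs z]
    field_simp
    norm_num
  calc (l * z) ^ 2 * Real.exp |l * z|
      ≤ (4 * l ^ 2 / μ ^ 2 * (2 * Real.exp (μ * |z| / 2))) * Real.exp (μ * |z| / 2) := by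
        rw [h3]; gcongr
    _ = 8 * l ^ 2 / μ ^ 2 * (Real.exp (μ * |z| / 2) * Real.exp (μ * |z| / 2)) := by ring
    _ = _ := by rw [← Real.exp_add]; ring_nf

/-- Moment generating function of a centered product of sub-Gaussian variables. -/
lemma mgf_mul_sub_le {X Y : Ω → ℝ} {c : NNReal} (hc : 0 < c) (hX : Measurable X)
    (hY : Measurable Y) (hsX : HasSubgaussianMGF X c P) (hsY : HasSubgaussianMGF Y c P)
    {l : ℝ} (hl : |l| ≤ 1 / (8 * c)) :
    Integrable (fun ω => Real.exp (l * (X ω * Y ω - ∫ ω, X ω * Y ω ∂P))) P ∧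
      mgf (fun ω => X ω * Y ω - ∫ ω, X ω * Y ω ∂P) P l ≤ Real.exp (768 * c ^ 2 * l ^ 2) := by
  have hc' : (0 : ℝ) < c := hc
  obtain ⟨iX, bX⟩ := integrable_exp_sq_of_hasSubgaussianMGF hc hX hsX
  obtain ⟨iY, bY⟩ := integrable_exp_sq_of_hasSubgaussianMGF hc hY hsY
  set m := ∫ ω, X ω * Y ω ∂P with hm
  have iS : Integrable (fun ω => Real.exp (X ω ^ 2 / (4 * c)) + Real.exp (Y ω ^ 2 / (4 * c))) P :=
    iX.add iY
  have bS : ∫ ω, (Real.exp (X ω ^ 2 / (4 * c)) + Real.exp (Y ω ^ 2 / (4 * c))) ∂P ≤ 4 := by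
    rw [integral_add iX iY]; linarith
  have hprod : ∀ x y : ℝ, |x * y| ≤ (x ^ 2 + y ^ 2) / 2 := fun x y => by
    rw [abs_le]; constructor <;> nlinarith [sq_nonneg (x + y), sq_nonneg (x - y)]
  have hXYb : ∀ ω, |X ω * Y ω| ≤
      2 * c * (Real.exp (X ω ^ 2 / (4 * c)) + Real.exp (Y ω ^ 2 / (4 * c)) - 2) := by
    intro ω
    have h1 := Real.add_one_le_exp (X ω ^ 2 / (4 * c))
    have h2 := Real.add_one_le_exp (Y ω ^ 2 / (4 * c))
    calc |X ω * Y ω| ≤ (X ω ^ 2 + Y ω ^ 2) / 2 := hprod _ _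
      _ = 2 * c * (X ω ^ 2 / (4 * c) + Y ω ^ 2 / (4 * c)) := by field_simp; norm_num
      _ ≤ _ := by gcongr; linarith
  have iB : Integrable (fun ω => 2 * c * (Real.exp (X ω ^ 2 / (4 * c)) +
      Real.exp (Y ω ^ 2 / (4 * c)) - 2)) P := (iS.sub (integrable_const 2)).const_mul _
  have iXY : Integrable (fun ω => X ω * Y ω) P :=
    iB.mono' (by fun_prop) (ae_of_all _ hXYb)
  have hmb : |m| ≤ 4 * c := by
    calc |m| ≤ ∫ ω, |X ω * Y ω| ∂P := abs_integral_le_integral_abs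
      _ ≤ ∫ ω, 2 * c * (Real.exp (X ω ^ 2 / (4 * c)) + Real.exp (Y ω ^ 2 / (4 * c)) - 2) ∂P :=
        integral_mono iXY.abs iB hXYb
      _ = 2 * c * (∫ ω, (Real.exp (X ω ^ 2 / (4 * c)) + Real.exp (Y ω ^ 2 / (4 * c))) ∂P - 2) := by
        rw [integral_const_mul, integral_sub iS (integrable_const 2)]; simp
      _ ≤ 2 * c * (4 - 2) := by gcongr
      _ = _ := by ring
  -- The centering `|m| ≤ 4c` costs a factor `e ≤ 3`, and convexity separates the two squares; the
  -- expectation is then at most `3/2 * 4 = 6`.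
  have hE : ∀ ω, Real.exp (1 / (4 * c) * |X ω * Y ω - m|) ≤
      3 / 2 * (Real.exp (X ω ^ 2 / (4 * c)) + Real.exp (Y ω ^ 2 / (4 * c))) := by
    intro ω
    have h1 : 1 / (4 * c) * |X ω * Y ω - m| ≤
        1 + (X ω ^ 2 / (4 * c) / 2 + Y ω ^ 2 / (4 * c) / 2) := by
      calc 1 / (4 * c) * |X ω * Y ω - m| ≤ 1 / (4 * c) * ((X ω ^ 2 + Y ω ^ 2) / 2 + 4 * c) := by
            gcongr
            exact (abs_sub _ _).trans (add_le_add (hprod _ _) hmb)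
        _ = _ := by field_simp; ring
    have h2 : ∀ a b : ℝ, Real.exp (a / 2 + b / 2) ≤ (Real.exp a + Real.exp b) / 2 := by
      intro a b
      have ha : Real.exp a = Real.exp (a / 2) * Real.exp (a / 2) := by rw [← Real.exp_add]; ring_nf
      have hb : Real.exp b = Real.exp (b / 2) * Real.exp (b / 2) := by rw [← Real.exp_add]; ring_nf
      rw [Real.exp_add, ha, hb]
      nlinarith [sq_nonneg (Real.exp (a / 2) - Real.exp (b / 2))]
    calc _ ≤ Real.exp (1 + (X ω ^ 2 / (4 * c) / 2 + Y ω ^ 2 / (4 * c) / 2)) := by gcongr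
      _ = Real.exp 1 * Real.exp (X ω ^ 2 / (4 * c) / 2 + Y ω ^ 2 / (4 * c) / 2) := Real.exp_add _ _
      _ ≤ 3 * ((Real.exp (X ω ^ 2 / (4 * c)) + Real.exp (Y ω ^ 2 / (4 * c))) / 2) := by
        gcongr
        · exact Real.exp_one_lt_three.le
        · exact h2 _ _
      _ = _ := by ring
  have iE : Integrable (fun ω => Real.exp (1 / (4 * c) * |X ω * Y ω - m|)) P :=
    (iS.const_mul (3 / 2)).mono' (by fun_prop) (ae_of_all _ fun ω => by
      rw [Real.norm_of_nonneg (Real.exp_pos _).le]; exact hE ω)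
  have bE : ∫ ω, Real.exp (1 / (4 * c) * |X ω * Y ω - m|) ∂P ≤ 6 := by
    calc _ ≤ ∫ ω, 3 / 2 * (Real.exp (X ω ^ 2 / (4 * c)) + Real.exp (Y ω ^ 2 / (4 * c))) ∂P :=
          integral_mono iE (iS.const_mul _) hE
      _ = 3 / 2 * ∫ ω, (Real.exp (X ω ^ 2 / (4 * c)) + Real.exp (Y ω ^ 2 / (4 * c))) ∂P :=
          integral_const_mul _ _
      _ ≤ 3 / 2 * 4 := by gcongr
      _ = 6 := by norm_num
  have hl2 : |l| ≤ 1 / (4 * c) / 2 := by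
    refine hl.trans (le_of_eq ?_); field_simp; norm_num
  have hpt : ∀ ω, Real.exp (l * (X ω * Y ω - m)) ≤ 1 + l * (X ω * Y ω - m) +
      8 * l ^ 2 / (1 / (4 * c)) ^ 2 * Real.exp (1 / (4 * c) * |X ω * Y ω - m|) := fun ω =>
    (exp_le_one_add_add_sq_mul_exp_abs _).trans
      (add_le_add le_rfl (sq_mul_exp_le (by positivity) hl2))
  have iZ : Integrable (fun ω => l * (X ω * Y ω - m)) P := (iXY.sub (integrable_const m)).const_mul l
  have iC : Integrable (fun ω => 1 + l * (X ω * Y ω - m)) P :=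
    (integrable_const 1).add iZ
  have iR : Integrable (fun ω => 1 + l * (X ω * Y ω - m) +
      8 * l ^ 2 / (1 / (4 * c)) ^ 2 * Real.exp (1 / (4 * c) * |X ω * Y ω - m|)) P :=
    iC.add (iE.const_mul _)
  have iL : Integrable (fun ω => Real.exp (l * (X ω * Y ω - m))) P :=
    iR.mono' (by fun_prop) (ae_of_all _ fun ω => by
      rw [Real.norm_of_nonneg (Real.exp_pos _).le]; exact hpt ω)
  refine ⟨iL, ?_⟩
  have h0 : ∫ ω, (1 + l * (X ω * Y ω - m)) ∂P = 1 := by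
    rw [integral_add (integrable_const 1) iZ,
      integral_const_mul, integral_sub iXY (integrable_const m)]
    simp [hm]
  calc mgf (fun ω => X ω * Y ω - m) P l
      ≤ ∫ ω, (1 + l * (X ω * Y ω - m) +
      8 * l ^ 2 / (1 / (4 * c)) ^ 2 * Real.exp (1 / (4 * c) * |X ω * Y ω - m|)) ∂P :=
        integral_mono iL iR hpt
    _ = 1 + 8 * l ^ 2 / (1 / (4 * c)) ^ 2 * ∫ ω, Real.exp (1 / (4 * c) * |X ω * Y ω - m|) ∂P := by
      rw [integral_add iC (iE.const_mul _), h0, integral_const_mul]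
    _ ≤ 1 + 8 * l ^ 2 / (1 / (4 * c)) ^ 2 * 6 := by gcongr
    -- Here `768 = 8 * 4² * 6`.
    _ = 768 * c ^ 2 * l ^ 2 + 1 := by field_simp; ring
    _ ≤ _ := Real.add_one_le_exp _

lemma measure_sum_mul_sub_ge_le {n : ℕ} {X Y : Fin n → Ω → ℝ} {c : NNReal} (hc : 1 ≤ c)
    (hX : ∀ k, Measurable (X k)) (hY : ∀ k, Measurable (Y k))
    (hsX : ∀ k, HasSubgaussianMGF (X k) c P) (hsY : ∀ k, HasSubgaussianMGF (Y k) c P)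
    (hind : iIndepFun (fun k ω => X k ω * Y k ω) P) {m : ℝ} (hm : ∀ k, ∫ ω, X k ω * Y k ω ∂P = m)
    {t : ℝ} (ht0 : 0 ≤ t) (ht1 : t ≤ 1) :
    P.real {ω | n * t ≤ ∑ k, X k ω * Y k ω - n * m} ≤ Real.exp (-(n * t ^ 2 / (3072 * c ^ 2))) := by
  have hc1 : (1 : ℝ) ≤ c := by exact_mod_cast hc
  -- The minimizer of the Chernoff exponent `-l t + 768 c² l²`. The conditions `t ≤ 1 ≤ c` keep it
  -- in the range where the moment generating function is controlled.
  set l : ℝ := t / (1536 * c ^ 2) with hl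
  have hl0 : 0 ≤ l := by positivity
  have hl1 : |l| ≤ 1 / (8 * c) := by
    rw [abs_of_nonneg hl0, hl, div_le_div_iff₀ (by positivity) (by positivity)]
    nlinarith
  have key := fun k => mgf_mul_sub_le (lt_of_lt_of_le one_pos hc) (hX k) (hY k) (hsX k) (hsY k) hl1
  simp_rw [hm] at key
  have hind' : iIndepFun (fun k ω => X k ω * Y k ω - m) P :=
    hind.comp (fun _ x => x - m) fun _ => by fun_prop
  have hset : {ω | n * t ≤ ∑ k, X k ω * Y k ω - n * m} =
      {ω | n * t ≤ (∑ k, fun ω => X k ω * Y k ω - m) ω} := by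
    ext ω; simp [Finset.sum_apply, Finset.sum_sub_distrib]
  rw [hset]
  refine (measure_ge_le_exp_mul_mgf (n * t) hl0 ?_).trans ?_
  · exact hind'.integrable_exp_mul_sum (fun k => by fun_prop) fun k _ => (key k).1
  · rw [hind'.mgf_sum (fun k => by fun_prop)]
    calc _ ≤ Real.exp (-l * (n * t)) * ∏ _k : Fin n, Real.exp (768 * c ^ 2 * l ^ 2) := by
          gcongr with k hk
          · exact fun k _ => mgf_nonneg
          · exact (key k).2
      _ = Real.exp (-l * (n * t) + n * (768 * c ^ 2 * l ^ 2)) := by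
          rw [Finset.prod_const, ← Real.exp_nat_mul, ← Real.exp_add]; simp
      _ = _ := by
          congr 1; rw [hl]; field_simp; ring

/-- Bernstein's inequality for products of sub-Gaussian variables, in the Gaussian regime. -/
lemma measure_abs_sum_mul_sub_ge_le {n : ℕ} {X Y : Fin n → Ω → ℝ} {c : NNReal} (hc : 1 ≤ c)
    (hX : ∀ k, Measurable (X k)) (hY : ∀ k, Measurable (Y k))
    (hsX : ∀ k, HasSubgaussianMGF (X k) c P) (hsY : ∀ k, HasSubgaussianMGF (Y k) c P)
    (hind : iIndepFun (fun k ω => X k ω * Y k ω) P) {m : ℝ} (hm : ∀ k, ∫ ω, X k ω * Y k ω ∂P = m)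
    {t : ℝ} (ht0 : 0 ≤ t) (ht1 : t ≤ 1) :
    P.real {ω | n * t ≤ |∑ k, X k ω * Y k ω - n * m|} ≤
      2 * Real.exp (-(n * t ^ 2 / (3072 * c ^ 2))) := by
  have h1 := measure_sum_mul_sub_ge_le hc hX hY hsX hsY hind hm ht0 ht1
  have h2 := measure_sum_mul_sub_ge_le (X := fun k => -X k) (m := -m) hc (fun k => (hX k).neg) hY
    (fun k => (hsX k).neg) hsY (by
      have := hind.comp (fun _ x => -x) fun _ => measurable_neg
      convert this using 2
      ext ω; simp) (fun k => by
      simp_rw [← hm k, Pi.neg_apply, neg_mul, integral_neg]) ht0 ht1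
  have hsub : {ω | n * t ≤ |∑ k, X k ω * Y k ω - n * m|} ⊆
      {ω | n * t ≤ ∑ k, X k ω * Y k ω - n * m} ∪
        {ω | n * t ≤ ∑ k, (-X k) ω * Y k ω - n * -m} := by
    intro ω hω
    rcases le_abs'.1 (Set.mem_ofPred_eq ▸ hω) with h | h
    · right
      simp only [Set.mem_ofPred_eq, Pi.neg_apply, neg_mul, Finset.sum_neg_distrib]
      linarith
    · left; exact h
  calc _ ≤ _ := measureReal_mono hsub
    _ ≤ _ := measureReal_union_le _ _
    _ ≤ _ := by linarith

end Bernstein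

/-! ### Quadratic forms -/

section QuadraticForms

lemma dotProduct_self_eq_norm2_sq {ι : Type*} [Fintype ι] (v : ι → ℝ) : v ⬝ᵥ v = norm2 v ^ 2 := by
  rw [norm2_sq, dotProduct]; exact Finset.sum_congr rfl fun i _ => by ring

lemma quadraticForm_bounds {p : ℕ} {A : Matrix (Fin p) (Fin p) ℝ} {a b : ℝ} (hA : A.IsHermitian)
    (h : ∀ i, a ≤ hA.eigenvalues i ∧ hA.eigenvalues i ≤ b) (u : Fin p → ℝ) :
    a * norm2 u ^ 2 ≤ u ⬝ᵥ A *ᵥ u ∧ u ⬝ᵥ A *ᵥ u ≤ b * norm2 u ^ 2 := by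
  set U : Matrix (Fin p) (Fin p) ℝ := (hA.eigenvectorUnitary : Matrix (Fin p) (Fin p) ℝ) with hU
  have hUU : U * Uᵀ = 1 := by
    have := Unitary.coe_mul_star_self hA.eigenvectorUnitary
    simpa [Matrix.star_eq_conjTranspose, Matrix.conjTranspose_eq_transpose_of_trivial] using this
  have hspec : A = U * Matrix.diagonal hA.eigenvalues * Uᵀ := by
    have := hA.spectral_theorem
    rw [Unitary.conjStarAlgAut_apply] at this
    simpa [Matrix.star_eq_conjTranspose, Matrix.conjTranspose_eq_transpose_of_trivial,
      Function.comp_def] using this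
  set y := Uᵀ *ᵥ u with hy
  have hyn : ∑ i, y i ^ 2 = norm2 u ^ 2 := by
    rw [← norm2_sq, ← dotProduct_self_eq_norm2_sq, ← dotProduct_self_eq_norm2_sq, hy,
      Matrix.dotProduct_mulVec, Matrix.vecMul_transpose, Matrix.mulVec_mulVec, hUU,
      Matrix.one_mulVec]
  have hq : u ⬝ᵥ A *ᵥ u = ∑ i, hA.eigenvalues i * y i ^ 2 := by
    conv_lhs => rw [hspec]
    rw [← Matrix.mulVec_mulVec, ← Matrix.mulVec_mulVec, Matrix.dotProduct_mulVec,
      ← Matrix.mulVec_transpose, ← hy, dotProduct]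
    refine Finset.sum_congr rfl fun i _ => ?_
    rw [Matrix.mulVec_diagonal]; ring
  rw [hq, ← hyn, Finset.mul_sum, Finset.mul_sum]
  exact ⟨Finset.sum_le_sum fun i _ => mul_le_mul_of_nonneg_right (h i).1 (sq_nonneg _),
    Finset.sum_le_sum fun i _ => mul_le_mul_of_nonneg_right (h i).2 (sq_nonneg _)⟩

lemma norm2_pos {ι : Type*} [Fintype ι] {u : ι → ℝ} (hu : u ≠ 0) : 0 < norm2 u := by
  obtain ⟨i, hi⟩ := Function.ne_iff.1 hu
  exact Real.sqrt_pos.2 (Finset.sum_pos' (fun _ _ => sq_nonneg _)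
    ⟨i, Finset.mem_univ i, by have : u i ≠ 0 := hi; positivity⟩)

lemma norm2_single {p : ℕ} (i : Fin p) : norm2 (Pi.single i 1 : Fin p → ℝ) = 1 := by
  rw [norm2, Finset.sum_eq_single i] <;> simp +contextual

lemma abs_apply_le_norm2 {ι : Type*} [Fintype ι] (u : ι → ℝ) (i : ι) : |u i| ≤ norm2 u := by
  rw [← Real.sqrt_sq_eq_abs]
  exact Real.sqrt_le_sqrt (Finset.single_le_sum (f := fun i => u i ^ 2)
    (fun _ _ => sq_nonneg _) (Finset.mem_univ i))

end QuadraticForms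

/-! ### Concentration in the random design -/

section Design

variable {Ω : Type*} [MeasurableSpace Ω] {P : Measure Ω} {M : Problem}
  {D : Sample M Ω} {κ σ : ℝ}

lemma posDef_Sig (h : D.SubGaussianDesign P κ) : M.Sig.PosDef := by
  obtain ⟨hH, he⟩ := h.eigenvalues
  exact hH.posDef_iff_eigenvalues_pos.2 fun i => by linarith [(he i).1]

lemma quadraticForm_Sig_bounds (h : D.SubGaussianDesign P κ) (u : Fin M.p → ℝ) :
    2 / 3 * norm2 u ^ 2 ≤ u ⬝ᵥ M.Sig *ᵥ u ∧ u ⬝ᵥ M.Sig *ᵥ u ≤ 3 / 2 * norm2 u ^ 2 := by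
  obtain ⟨hH, he⟩ := h.eigenvalues
  exact quadraticForm_bounds hH he u

/-- A sub-Gaussian parameter shared by the normalized noise and by the projections of the design. -/
noncomputable def subGaussianParam (κ : ℝ) : NNReal := 1 + 3 / 2 * (κ ^ 2).toNNReal

lemma one_le_subGaussianParam (κ : ℝ) : 1 ≤ subGaussianParam κ := by
  unfold subGaussianParam; exact le_self_add

lemma coe_subGaussianParam (κ : ℝ) : (subGaussianParam κ : ℝ) = 1 + 3 / 2 * κ ^ 2 := by
  simp [subGaussianParam, Real.coe_toNNReal _ (sq_nonneg κ)]

lemma measurable_row (h : D.SubGaussianDesign P κ) (k : Fin M.n) : Measurable fun ω => D.X ω k :=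
  (measurable_pi_apply k).comp h.measurable

lemma measurable_dotProduct_row (h : D.SubGaussianDesign P κ) (u : Fin M.p → ℝ) (k : Fin M.n) :
    Measurable fun ω => u ⬝ᵥ D.X ω k := by
  unfold dotProduct
  exact Finset.measurable_sum _ fun i _ =>
    measurable_const.mul ((measurable_pi_apply i).comp (measurable_row h k))

/-- Write `u ⬝ x = (Σ^{1/2} u) ⬝ (Σ^{-1/2} x)` and `‖Σ^{1/2} u‖² = uᵀΣu`. Bounding this quadratic
form, rather than `‖u‖₂`, covers both unit test vectors and the columns of `Σ⁻¹` with one constant.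
-/
lemma hasSubgaussianMGF_dotProduct_row (h : D.SubGaussianDesign P κ) {u : Fin M.p → ℝ}
    (hu : u ⬝ᵥ M.Sig *ᵥ u ≤ 3 / 2) (k : Fin M.n) :
    HasSubgaussianMGF (fun ω => u ⬝ᵥ D.X ω k) (subGaussianParam κ) P := by
  have hpd := posDef_Sig h
  set S := CFC.sqrt M.Sig with hS
  have hSS : S * S = M.Sig := CFC.sqrt_mul_sqrt_self _ hpd.posSemidef.nonneg
  have hSt : Sᵀ = S := by
    have h1 : IsSelfAdjoint S := (CFC.sqrt_nonneg M.Sig).isSelfAdjoint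
    have h2 : star S = S := h1
    rwa [Matrix.star_eq_conjTranspose, Matrix.conjTranspose_eq_transpose_of_trivial] at h2
  have hdet : IsUnit S.det := by
    have h1 : IsUnit (S * S) := hSS ▸ hpd.isUnit
    rw [Matrix.isUnit_iff_isUnit_det, Matrix.det_mul] at h1
    exact isUnit_of_mul_isUnit_left h1
  have hid : ∀ x : Fin M.p → ℝ, ∀ t : ℝ, t * (u ⬝ᵥ x) = (t • S *ᵥ u) ⬝ᵥ S⁻¹ *ᵥ x := by
    intro x t
    rw [smul_dotProduct, Matrix.dotProduct_mulVec, ← Matrix.mulVec_transpose,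
      Matrix.transpose_nonsing_inv, hSt, Matrix.mulVec_mulVec, Matrix.nonsing_inv_mul _ hdet,
      Matrix.one_mulVec, smul_eq_mul]
  have hn : norm2 (S *ᵥ u) ^ 2 = u ⬝ᵥ M.Sig *ᵥ u := by
    rw [← dotProduct_self_eq_norm2_sq, Matrix.dotProduct_mulVec, ← Matrix.mulVec_transpose, hSt,
      Matrix.mulVec_mulVec, hSS, dotProduct_comm]
  have hn' : ∀ t : ℝ, norm2 (t • S *ᵥ u) ^ 2 = t ^ 2 * (u ⬝ᵥ M.Sig *ᵥ u) := by
    intro t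
    rw [← hn, norm2_sq, norm2_sq, Finset.mul_sum]
    exact Finset.sum_congr rfl fun i _ => by simp [mul_pow]
  refine ⟨fun t => ?_, fun t => ?_⟩
  · simp_rw [hid]
    exact (h.subGaussian k _).1
  · simp_rw [mgf, hid]
    refine (h.subGaussian k _).2.trans (Real.exp_le_exp.2 ?_)
    rw [hn', coe_subGaussianParam]
    have h1 : κ ^ 2 * (t ^ 2 * (u ⬝ᵥ M.Sig *ᵥ u)) ≤ κ ^ 2 * (t ^ 2 * (3 / 2)) := by gcongr
    nlinarith [sq_nonneg t]

lemma quadraticForm_single_le (h : D.SubGaussianDesign P κ) (i : Fin M.p) :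
    (Pi.single i 1 : Fin M.p → ℝ) ⬝ᵥ M.Sig *ᵥ Pi.single i 1 ≤ 3 / 2 := by
  simpa [norm2_single] using (quadraticForm_Sig_bounds h (Pi.single i 1)).2

lemma quadraticForm_le_of_norm2_le (h : D.SubGaussianDesign P κ) {u : Fin M.p → ℝ}
    (hu : norm2 u ≤ 1) : u ⬝ᵥ M.Sig *ᵥ u ≤ 3 / 2 := by
  have h1 : norm2 u ^ 2 ≤ 1 := pow_le_one₀ (norm2_nonneg u) hu
  linarith [(quadraticForm_Sig_bounds h u).2]

lemma Sig_mulVec_inv_mulVec (h : D.SubGaussianDesign P κ) (v : Fin M.p → ℝ) :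
    M.Sig *ᵥ (M.Sig⁻¹ *ᵥ v) = v := by
  have hdet := (Matrix.isUnit_iff_isUnit_det _).1 (posDef_Sig h).isUnit
  rw [Matrix.mulVec_mulVec, Matrix.mul_nonsing_inv _ hdet, Matrix.one_mulVec]

/-- For `u = Σ⁻¹e_i` the form equals `u_i ≤ ‖u‖₂`, while it is at least `(2/3)‖u‖₂²`; hence `‖u‖₂ ≤
3/2`. -/
lemma quadraticForm_inv_single_le (h : D.SubGaussianDesign P κ) (i : Fin M.p) :
    (M.Sig⁻¹ *ᵥ Pi.single i 1) ⬝ᵥ M.Sig *ᵥ (M.Sig⁻¹ *ᵥ Pi.single i 1) ≤ 3 / 2 := by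
  set u := M.Sig⁻¹ *ᵥ (Pi.single i 1 : Fin M.p → ℝ) with hu
  have h1 : u ⬝ᵥ M.Sig *ᵥ u = u i := by
    rw [hu, Sig_mulVec_inv_mulVec h]; simp
  have h2 := (quadraticForm_Sig_bounds h u).1
  have h3 := (le_abs_self _).trans (abs_apply_le_norm2 u i)
  rw [h1] at h2 ⊢
  have h4 := norm2_nonneg u
  by_contra! hcon
  nlinarith

lemma integral_row_mul_row [IsProbabilityMeasure P] (h : D.SubGaussianDesign P κ) (k : Fin M.n) (u v : Fin M.p → ℝ) :
    ∫ ω, (u ⬝ᵥ D.X ω k) * (v ⬝ᵥ D.X ω k) ∂P = u ⬝ᵥ M.Sig *ᵥ v := by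
  have hL : ∀ i, MemLp (fun ω => D.X ω k i) 2 P := by
    intro i
    have := (hasSubgaussianMGF_dotProduct_row h (quadraticForm_single_le h i) k).memLp 2
    simpa using this
  have hij : ∀ i j, ∫ ω, D.X ω k i * D.X ω k j ∂P = M.Sig i j := by
    intro i j
    have := h.cov k i j
    simpa [covariance, h.mean] using this
  have hint : ∀ i j, Integrable (fun ω => D.X ω k i * D.X ω k j) P := fun i j =>
    (hL i).integrable_mul (hL j)
  have hexp : ∀ ω, (u ⬝ᵥ D.X ω k) * (v ⬝ᵥ D.X ω k) =
      ∑ i, ∑ j, u i * v j * (D.X ω k i * D.X ω k j) := by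
    intro ω
    rw [dotProduct, dotProduct, Finset.sum_mul_sum]
    exact Finset.sum_congr rfl fun i _ => Finset.sum_congr rfl fun j _ => by ring
  simp_rw [hexp]
  rw [integral_finsetSum _ fun i _ => integrable_finsetSum _ fun j _ => (hint i j).const_mul _]
  simp_rw [integral_finsetSum _ fun j _ => (hint _ j).const_mul _, integral_const_mul, hij]
  rw [dotProduct]
  refine Finset.sum_congr rfl fun i _ => ?_
  rw [Matrix.mulVec, dotProduct, Finset.mul_sum]
  exact Finset.sum_congr rfl fun j _ => by ring

lemma dotProduct_sampleCov_mulVec (x : Fin M.n → Fin M.p → ℝ) (u v : Fin M.p → ℝ) :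
    u ⬝ᵥ M.sampleCov x *ᵥ v = (1 / (M.n : ℝ)) * ∑ k, (u ⬝ᵥ x k) * (v ⬝ᵥ x k) := by
  rw [Problem.sampleCov, Matrix.smul_mulVec, dotProduct_smul, smul_eq_mul, Matrix.sum_mulVec,
    dotProduct_sum]
  congr 1
  refine Finset.sum_congr rfl fun k _ => ?_
  rw [Matrix.vecMulVec_mulVec, dotProduct_comm v]
  simp [dotProduct_smul, mul_comm]

/-- The rate in the Bernstein bounds below. -/
noncomputable def bernsteinRate (κ : ℝ) : ℝ := 1 / (3072 * (1 + 3 / 2 * κ ^ 2) ^ 2)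

lemma bernsteinRate_pos (κ : ℝ) : 0 < bernsteinRate κ := by
  unfold bernsteinRate; positivity

lemma measure_abs_sampleCov_sub_ge_le [IsProbabilityMeasure P] (h : D.SubGaussianDesign P κ) (hn : 0 < M.n)
    {u v : Fin M.p → ℝ} (hu : u ⬝ᵥ M.Sig *ᵥ u ≤ 3 / 2) (hv : v ⬝ᵥ M.Sig *ᵥ v ≤ 3 / 2)
    {t : ℝ} (ht0 : 0 ≤ t) (ht1 : t ≤ 1) :
    P.real {ω | t ≤ |u ⬝ᵥ M.sampleCov (D.X ω) *ᵥ v - u ⬝ᵥ M.Sig *ᵥ v|} ≤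
      2 * Real.exp (-(bernsteinRate κ * M.n * t ^ 2)) := by
  have hn' : (0 : ℝ) < M.n := by exact_mod_cast hn
  have key := measure_abs_sum_mul_sub_ge_le (one_le_subGaussianParam κ)
    (fun k => measurable_dotProduct_row h u k) (fun k => measurable_dotProduct_row h v k)
    (fun k => hasSubgaussianMGF_dotProduct_row h hu k)
    (fun k => hasSubgaussianMGF_dotProduct_row h hv k)
    (h.indep.comp (fun _ x => (u ⬝ᵥ x) * (v ⬝ᵥ x)) fun _ => by unfold dotProduct; fun_prop)
    (fun k => integral_row_mul_row h k u v) ht0 ht1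
  convert key using 3
  · ext ω
    rw [dotProduct_sampleCov_mulVec]
    have : 1 / (M.n : ℝ) * ∑ k, (u ⬝ᵥ D.X ω k) * (v ⬝ᵥ D.X ω k) - u ⬝ᵥ M.Sig *ᵥ v =
        (1 / (M.n : ℝ)) * (∑ k, (u ⬝ᵥ D.X ω k) * (v ⬝ᵥ D.X ω k) - M.n * (u ⬝ᵥ M.Sig *ᵥ v)) := by
      field_simp
    rw [this, abs_mul, abs_of_pos (by positivity : 0 < 1 / (M.n : ℝ)), one_div,
      le_inv_mul_iff₀ hn']
  · rw [bernsteinRate, coe_subGaussianParam]; ring_nf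

/-- The rows of the design, paired with the noise variables, are independent. -/
lemma iIndepFun_row_prodMk_noise [IsProbabilityMeasure P] (h : D.SubGaussianDesign P κ) (hε : D.GaussianNoise P σ) :
    iIndepFun (fun k ω => (D.X ω k, D.eps ω k)) P := by
  have hXm := measurable_row h
  have hεm : ∀ k, Measurable fun ω => D.eps ω k := fun k =>
    (measurable_pi_apply k).comp hε.measurable
  rw [iIndepFun_iff_map_fun_eq_pi_map fun k => ((hXm k).prodMk (hεm k)).aemeasurable]
  have hX := (iIndepFun_iff_map_fun_eq_pi_map fun k => (hXm k).aemeasurable).1 h.indep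
  have hE := (iIndepFun_iff_map_fun_eq_pi_map fun k => (hεm k).aemeasurable).1 hε.indep
  have hXE := (indepFun_iff_map_prod_eq_prod_map_map h.measurable.aemeasurable
    hε.measurable.aemeasurable).1 hε.indep_design
  have : ∀ k, IsProbabilityMeasure (P.map fun ω => D.X ω k) := fun k =>
    Measure.isProbabilityMeasure_map (hXm k).aemeasurable
  have : ∀ k, IsProbabilityMeasure (P.map fun ω => D.eps ω k) := fun k =>
    Measure.isProbabilityMeasure_map (hεm k).aemeasurable
  have hk : ∀ k, P.map (fun ω => (D.X ω k, D.eps ω k)) =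
      (P.map fun ω => D.X ω k).prod (P.map fun ω => D.eps ω k) := fun k =>
    (indepFun_iff_map_prod_eq_prod_map_map (hXm k).aemeasurable (hεm k).aemeasurable).1
      (hε.indep_design.comp (measurable_pi_apply k) (measurable_pi_apply k))
  simp_rw [hk]
  -- The joint law of `(X, ε)` is a product of two product measures; this equivalence regroups it
  -- row by row.
  have hmp := measurePreserving_arrowProdEquivProdArrow (Fin M.p → ℝ) ℝ (Fin M.n)
    (fun k => P.map fun ω => D.X ω k) (fun k => P.map fun ω => D.eps ω k)
  rw [← hX, ← hE] at hmp
  change MeasurePreserving _ _ ((P.map D.X).prod (P.map D.eps)) at hmp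
  rw [← hXE] at hmp
  have hmp' := hmp.symm
  rw [← hmp'.map_eq, Measure.map_map (MeasurableEquiv.measurable _)
    (h.measurable.prodMk hε.measurable)]
  rfl

lemma hasSubgaussianMGF_noise (hε : D.GaussianNoise P σ) (hσ : 0 < σ) (k : Fin M.n) :
    HasSubgaussianMGF (fun ω => σ⁻¹ * D.eps ω k) (subGaussianParam κ) P := by
  have hm : Measurable fun ω => D.eps ω k := (measurable_pi_apply k).comp hε.measurable
  have h0 : HasSubgaussianMGF id (subGaussianParam κ) (gaussianReal 0 1) := by
    refine ⟨fun t => integrable_exp_mul_gaussianReal t, fun t => ?_⟩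
    rw [mgf_id_gaussianReal, coe_subGaussianParam]
    refine Real.exp_le_exp.2 ?_
    simp only [NNReal.coe_one]
    nlinarith [mul_nonneg (sq_nonneg κ) (sq_nonneg t)]
  rw [← HasSubgaussianMGF.id_map_iff (by fun_prop)]
  convert h0
  have : (fun ω => σ⁻¹ * D.eps ω k) = (fun x => σ⁻¹ * x) ∘ fun ω => D.eps ω k := rfl
  rw [this, ← Measure.map_map (by fun_prop) hm, hε.law k, gaussianReal_map_const_mul]
  congr 1
  · simp
  · rw [← NNReal.coe_inj]
    simp [Real.coe_toNNReal _ (sq_nonneg σ), hσ.ne']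

lemma measure_abs_noise_ge_le [IsProbabilityMeasure P] (h : D.SubGaussianDesign P κ) (hε : D.GaussianNoise P σ) (hσ : 0 < σ)
    {u : Fin M.p → ℝ} (hu : u ⬝ᵥ M.Sig *ᵥ u ≤ 3 / 2) {t : ℝ} (ht0 : 0 ≤ t) (ht1 : t ≤ 1) :
    P.real {ω | M.n * t * σ ≤ |u ⬝ᵥ (Matrix.of (D.X ω))ᵀ *ᵥ D.eps ω|} ≤
      2 * Real.exp (-(bernsteinRate κ * M.n * t ^ 2)) := by
  have hεm : ∀ k, Measurable fun ω => D.eps ω k := fun k =>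
    (measurable_pi_apply k).comp hε.measurable
  have key := measure_abs_sum_mul_sub_ge_le (m := 0) (one_le_subGaussianParam κ)
    (fun k => measurable_dotProduct_row h u k) (fun k => (hεm k).const_mul σ⁻¹)
    (fun k => hasSubgaussianMGF_dotProduct_row h hu k)
    (fun k => hasSubgaussianMGF_noise hε hσ k)
    ((iIndepFun_row_prodMk_noise h hε).comp (fun _ x => (u ⬝ᵥ x.1) * (σ⁻¹ * x.2)) fun _ => by
      unfold dotProduct; fun_prop) (fun k => ?_) ht0 ht1
  · convert key using 3
    · ext ω
      have : u ⬝ᵥ (Matrix.of (D.X ω))ᵀ *ᵥ D.eps ω =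
          σ * (∑ k, (u ⬝ᵥ D.X ω k) * (σ⁻¹ * D.eps ω k) - M.n * 0) := by
        rw [Matrix.dotProduct_mulVec, Matrix.vecMul_transpose, dotProduct, mul_zero, sub_zero,
          Finset.mul_sum]
        refine Finset.sum_congr rfl fun k _ => ?_
        rw [Matrix.mulVec, dotProduct_comm]
        change u ⬝ᵥ D.X ω k * D.eps ω k = _
        field_simp
      rw [this, abs_mul, abs_of_pos hσ, mul_comm σ, mul_le_mul_iff_left₀ hσ]
    · rw [bernsteinRate, coe_subGaussianParam]; ring_nf
  · have hind : IndepFun (fun ω => u ⬝ᵥ D.X ω k) (fun ω => σ⁻¹ * D.eps ω k) P :=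
      hε.indep_design.comp (φ := fun x : Fin M.n → Fin M.p → ℝ => u ⬝ᵥ x k)
        (ψ := fun e : Fin M.n → ℝ => σ⁻¹ * e k)
        (by unfold dotProduct; fun_prop) (by fun_prop)
    rw [hind.integral_fun_mul_eq_mul_integral
      (measurable_dotProduct_row h u k).aestronglyMeasurable
      ((hεm k).const_mul σ⁻¹).aestronglyMeasurable, integral_const_mul]
    have h0 : ∫ ω, D.eps ω k ∂P = 0 := by
      have := integral_map (μ := P) (hεm k).aemeasurable (f := fun x : ℝ => x)
        (by fun_prop)
      rw [hε.law k] at this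
      rw [← this, integral_id_gaussianReal]
    rw [h0]; simp

end Design

/-! ### Deterministic analysis of the estimators -/

section Deterministic

variable {p d : ℕ} {g : Fin p → Fin d}

/-- The property of a finite set of vectors of testing the mass on all doubly sparse sets. -/
def IsNet (g : Fin p → Fin d) (m k : ℕ) (N : Finset (Fin p → ℝ)) : Prop :=
  ∀ (v : Fin p → ℝ) (M : ℝ), (∀ w ∈ N, |w ⬝ᵥ v| ≤ M) →
    ∀ S : Finset (Fin p), S.card ≤ m → (S.image g).card ≤ k → ∑ l ∈ S, v l ^ 2 ≤ (2 * M) ^ 2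

lemma IsNet.abs_dotProduct_le {s sg : ℕ} {N : Finset (Fin p → ℝ)} (hN : IsNet g (2 * s) sg N)
    (hsg : 0 < sg) (hs : sg ≤ s) {v : Fin p → ℝ} {M : ℝ} (hM : 0 ≤ M)
    (h : ∀ w ∈ N, |w ⬝ᵥ v| ≤ M) (x : Fin p → ℝ) : |v ⬝ᵥ x| ≤ 2 * M * atomicNorm g s sg x :=
  abs_dotProduct_le_atomicNorm hsg hs (by positivity) (hN v M h) x

/-- The duality is applied once in each argument of the bilinear form, losing a factor `2` each
time. -/
lemma IsNet.abs_quadraticForm_le {s sg : ℕ} {N : Finset (Fin p → ℝ)} (hN : IsNet g (2 * s) sg N)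
    (hsg : 0 < sg) (hs : sg ≤ s) {A : Matrix (Fin p) (Fin p) ℝ} (hA : Aᵀ = A) {δ : ℝ} (hδ : 0 ≤ δ)
    (h : ∀ w ∈ N, ∀ w' ∈ N, |w ⬝ᵥ A *ᵥ w'| ≤ δ) (x : Fin p → ℝ) :
    |x ⬝ᵥ A *ᵥ x| ≤ 4 * δ * atomicNorm g s sg x ^ 2 := by
  have hQ := atomicNorm_nonneg (g := g) s sg x
  have h1 : ∀ w ∈ N, |w ⬝ᵥ A *ᵥ x| ≤ 2 * δ * atomicNorm g s sg x := by
    intro w hw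
    have h2 := hN.abs_dotProduct_le hsg hs hδ (fun w' hw' => h w' hw' w hw) x
    rwa [Matrix.dotProduct_mulVec, ← Matrix.mulVec_transpose, hA]
  have h3 := hN.abs_dotProduct_le hsg hs (by positivity) h1 x
  rw [dotProduct_comm]
  refine h3.trans (le_of_eq ?_)
  ring

lemma sum_abs_le_sqrt_card_mul {ι : Type*} [Fintype ι] (T : Finset ι) (f : ι → ℝ) {c : ℝ}
    (hc : 0 ≤ c) (hf : ∑ i, f i ^ 2 ≤ c ^ 2) {s : ℕ} (hT : T.card ≤ s) :
    ∑ i ∈ T, |f i| ≤ √(s : ℝ) * c := by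
  have h := sum_mul_le_of_sum_sq_le (A := T) (u := fun _ => 1) (h := f) (Real.sqrt_nonneg (s : ℝ))
    hc (by rw [Real.sq_sqrt (Nat.cast_nonneg s)]; simpa using hT)
    (le_trans (Finset.sum_le_sum_of_subset_of_nonneg (Finset.subset_univ _)
      fun _ _ _ => sq_nonneg _) hf)
  simpa using h

/-- Off the support of `β` the difference contributes exactly `-|h i|`, and on it at most `|h i|`.
Adding `‖h‖₁` leaves twice a sum over at most `s` coordinates, to which Cauchy-Schwarz applies. The
group version below is the same with groups as coordinates. -/
lemma norm1_sub_norm1_add_le {β : Fin p → ℝ} {s : ℕ} (hβ : (supp β).card ≤ s) (h : Fin p → ℝ) :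
    norm1 β - norm1 (β + h) ≤ 2 * (√(s : ℝ) * norm2 h) - norm1 h := by
  have h1 := sum_abs_le_sqrt_card_mul (supp β) h (norm2_nonneg h) (norm2_sq h).ge hβ
  have h2 : norm1 β - norm1 (β + h) + norm1 h ≤ 2 * ∑ i ∈ supp β, |h i| := by
    unfold norm1
    rw [← Finset.sum_sub_distrib, ← Finset.sum_add_distrib, Finset.mul_sum, supp,
      Finset.sum_filter]
    refine Finset.sum_le_sum fun i _ => ?_
    rw [Pi.add_apply]
    split_ifs with hi
    · have := abs_sub_abs_le_abs_sub (β i) (β i + h i)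
      rw [show β i - (β i + h i) = -h i by ring, abs_neg] at this
      linarith
    · rw [not_not.1 hi]; simp
  linarith

lemma groupNorm_le_add (u v : Fin p → ℝ) (j : Fin d) :
    groupNorm g u j ≤ groupNorm g (u + v) j + groupNorm g v j := by
  have hu := groupNorm_nonneg (g := g) (u + v) j
  have hv := groupNorm_nonneg (g := g) v j
  refine Real.sqrt_le_iff.2 ⟨by positivity, ?_⟩
  have h1 := sum_mul_le_of_sum_sq_le hu hv (groupNorm_sq (g := g) (u + v) j).ge
    (groupNorm_sq (g := g) v j).ge
  have h2 : ∑ i with g i = j, u i ^ 2 ≤ ∑ i with g i = j, (u + v) i ^ 2 +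
      2 * ∑ i with g i = j, |(u + v) i * v i| + ∑ i with g i = j, v i ^ 2 := by
    rw [Finset.mul_sum, ← Finset.sum_add_distrib, ← Finset.sum_add_distrib]
    refine Finset.sum_le_sum fun i _ => ?_
    have := neg_abs_le ((u + v) i * v i)
    have h3 : u i ^ 2 = (u + v) i ^ 2 - 2 * ((u + v) i * v i) + v i ^ 2 := by
      simp only [Pi.add_apply]; ring
    have := le_abs_self (-((u + v) i * v i))
    rw [abs_neg] at this
    linarith
  rw [← groupNorm_sq u, ← groupNorm_sq (u + v), ← groupNorm_sq v] at h2
  rw [← groupNorm_sq u]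
  nlinarith

lemma normOneTwo_sub_normOneTwo_add_le {β : Fin p → ℝ} {sg : ℕ} (hβ : (groupSupp g β).card ≤ sg)
    (h : Fin p → ℝ) :
    normOneTwo g β - normOneTwo g (β + h) ≤ 2 * (√(sg : ℝ) * norm2 h) - normOneTwo g h := by
  have h1 := sum_abs_le_sqrt_card_mul (groupSupp g β) (groupNorm g h) (norm2_nonneg h)
    (sum_groupNorm_sq h).le hβ
  have h2 : normOneTwo g β - normOneTwo g (β + h) + normOneTwo g h ≤
      2 * ∑ i ∈ groupSupp g β, |groupNorm g h i| := by
    unfold normOneTwo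
    rw [← Finset.sum_sub_distrib, ← Finset.sum_add_distrib, Finset.mul_sum, groupSupp,
      Finset.sum_filter]
    refine Finset.sum_le_sum fun j _ => ?_
    rw [abs_of_nonneg (groupNorm_nonneg h j)]
    split_ifs with hj
    · have := groupNorm_le_add (g := g) β h j
      linarith
    · push Not at hj
      have e1 : groupNorm g β j = 0 := by
        rw [groupNorm, Finset.sum_eq_zero, Real.sqrt_zero]
        intro i hi
        rw [hj i (Finset.mem_filter.1 hi).2]; ring
      have e2 : groupNorm g (β + h) j = groupNorm g h j := by
        unfold groupNorm
        congr 1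
        refine Finset.sum_congr rfl fun i hi => ?_
        rw [Pi.add_apply, hj i (Finset.mem_filter.1 hi).2, zero_add]
      rw [e1, e2]; linarith
  linarith

/-! ### Consequences for the two optimization programs. -/

variable {M : Problem}

lemma norm2_mulVec_sq (x : Fin M.n → Fin M.p → ℝ) (hn : 0 < M.n) (h : Fin M.p → ℝ) :
    norm2 (Matrix.of x *ᵥ h) ^ 2 = M.n * (h ⬝ᵥ M.sampleCov x *ᵥ h) := by
  have hn' : (M.n : ℝ) ≠ 0 := by exact_mod_cast hn.ne'
  rw [dotProduct_sampleCov_mulVec, norm2_sq, ← mul_assoc, mul_one_div_cancel hn', one_mul]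
  refine Finset.sum_congr rfl fun k _ => ?_
  have : (Matrix.of x *ᵥ h) k = h ⬝ᵥ x k := by rw [dotProduct_comm]; rfl
  rw [this, sq]

/-- The basic inequality for a sparse group Lasso estimate. -/
lemma isSGLasso_basic_inequality {lam lamg : ℝ} {x : Fin M.n → Fin M.p → ℝ} {e : Fin M.n → ℝ}
    {v : Fin M.p → ℝ} (hv : M.IsSGLasso lam lamg x (Matrix.of x *ᵥ M.beta + e) v) :
    norm2 (Matrix.of x *ᵥ (v - M.beta)) ^ 2 ≤
      2 * ((Matrix.of x)ᵀ *ᵥ e ⬝ᵥ (v - M.beta)) +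
        lam * (norm1 M.beta - norm1 (M.beta + (v - M.beta))) +
        lamg * (normOneTwo M.group M.beta - normOneTwo M.group (M.beta + (v - M.beta))) := by
  have h := hv M.beta
  set h' := v - M.beta with hh
  have hv' : v = M.beta + h' := by rw [hh]; abel
  have e1 : Matrix.of x *ᵥ M.beta + e - Matrix.of x *ᵥ M.beta = e := by abel
  have e2 : Matrix.of x *ᵥ M.beta + e - Matrix.of x *ᵥ v = e - Matrix.of x *ᵥ h' := by
    rw [hv', Matrix.mulVec_add]; abel
  unfold Problem.objective at h
  rw [e1, e2, hv'] at h
  have e3 : norm2 (e - Matrix.of x *ᵥ h') ^ 2 =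
      norm2 e ^ 2 - 2 * ((Matrix.of x)ᵀ *ᵥ e ⬝ᵥ h') + norm2 (Matrix.of x *ᵥ h') ^ 2 := by
    rw [← dotProduct_self_eq_norm2_sq, ← dotProduct_self_eq_norm2_sq,
      ← dotProduct_self_eq_norm2_sq, Matrix.mulVec_transpose, ← Matrix.dotProduct_mulVec,
      sub_dotProduct, dotProduct_sub, dotProduct_sub, dotProduct_comm (Matrix.of x *ᵥ h') e]
    ring
  rw [e3] at h
  linarith

/-- The error of a row satisfying the thresholded constraint. -/
lemma abs_sub_le_of_feasible {al ga : ℝ} (hal : 0 ≤ al) {x : Fin M.n → Fin M.p → ℝ} {i : Fin M.p}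
    {m : Fin M.p → ℝ} (hm : M.Feasible al ga x i m) (h : Fin M.p → ℝ) :
    |h i - m ⬝ᵥ M.sampleCov x *ᵥ h| ≤ al * norm1 h + ga * normOneTwo M.group h := by
  set v : Fin M.p → ℝ := fun j => (M.sampleCov x *ᵥ m) j - (Pi.single i 1 : Fin M.p → ℝ) j with hv
  have h1 : h i - m ⬝ᵥ M.sampleCov x *ᵥ h = -(v ⬝ᵥ h) := by
    have e1 : v = M.sampleCov x *ᵥ m - Pi.single i 1 := rfl
    have e2 : m ⬝ᵥ M.sampleCov x *ᵥ h = M.sampleCov x *ᵥ m ⬝ᵥ h := by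
      rw [dotProduct_comm _ h, dotProduct_sampleCov_mulVec, dotProduct_sampleCov_mulVec]
      congr 1
      exact Finset.sum_congr rfl fun k _ => mul_comm _ _
    rw [e1, sub_dotProduct, e2]; simp
  have hgn : ∀ j, groupNorm M.group (fun l => softThreshold al (v l)) j ≤ ga := fun j =>
    (groupNorm_le_normInfTwo _ j).trans hm
  rw [h1, abs_neg]
  calc |v ⬝ᵥ h| ≤ ∑ l, |v l * h l| := Finset.abs_sum_le_sum_abs _ _
    -- From `|v l| ≤ al + |H_al (v l)|`; the second part is then handled by Cauchy-Schwarz within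
    -- each group.
    _ ≤ ∑ l, (al * |h l| + |softThreshold al (v l) * h l|) := by
      refine Finset.sum_le_sum fun l _ => ?_
      rw [abs_mul, abs_mul, ← add_mul, abs_softThreshold hal]
      have := le_max_left (|v l| - al) 0
      gcongr
      linarith
    _ = al * norm1 h + ∑ j, ∑ l with M.group l = j, |softThreshold al (v l) * h l| := by
      rw [Finset.sum_add_distrib, ← Finset.mul_sum, Finset.sum_fiberwise, norm1]
    _ ≤ al * norm1 h + ∑ j, ga * groupNorm M.group h j := by
      gcongr with j
      refine (sum_mul_le_of_sum_sq_le (groupNorm_nonneg _ j) (groupNorm_nonneg _ j)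
        (groupNorm_sq _ j).ge (groupNorm_sq _ j).ge).trans ?_
      exact mul_le_mul_of_nonneg_right (hgn j) (groupNorm_nonneg _ j)
    _ = _ := by rw [← Finset.mul_sum, normOneTwo]

lemma norm1_single (i : Fin M.p) : norm1 (Pi.single i 1 : Fin M.p → ℝ) = 1 := by
  rw [norm1, Finset.sum_eq_single i] <;> simp +contextual

lemma normOneTwo_single (i : Fin M.p) :
    normOneTwo M.group (Pi.single i 1 : Fin M.p → ℝ) = 1 := by
  rw [normOneTwo, Finset.sum_eq_single (M.group i)]
  · rw [groupNorm, Finset.sum_eq_single i] <;> simp +contextual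
  · intro j _ hj
    rw [groupNorm, Finset.sum_eq_zero, Real.sqrt_zero]
    intro l hl
    have : l ≠ i := by rintro rfl; exact hj (Finset.mem_filter.1 hl).2.symm
    simp [this]
  · simp

/-- The variance proxy of a feasible row is bounded below. -/
lemma one_sixteenth_le_of_feasible {al ga : ℝ} (hal : 0 ≤ al) (hag : al + ga ≤ 1 / 2)
    {x : Fin M.n → Fin M.p → ℝ} {i : Fin M.p} {m : Fin M.p → ℝ} (hn : 0 < M.n)
    (hm : M.Feasible al ga x i m)
    (hii : (Pi.single i 1 : Fin M.p → ℝ) ⬝ᵥ M.sampleCov x *ᵥ Pi.single i 1 ≤ 2) :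
    1 / 16 ≤ m ⬝ᵥ M.sampleCov x *ᵥ m := by
  set e : Fin M.p → ℝ := Pi.single i 1 with he
  -- Testing the constraint against `e_i` gives `mᵀΣ̂e_i ≥ 1/2`; Cauchy-Schwarz for the form `Σ̂`,
  -- with `Σ̂_ii ≤ 2`, then bounds `mᵀΣ̂m` below.
  have h1 := abs_sub_le_of_feasible hal hm e
  rw [he, norm1_single, normOneTwo_single, ← he, mul_one, mul_one, show e i = 1 by simp [he]] at h1
  have h2 : 1 / 2 ≤ m ⬝ᵥ M.sampleCov x *ᵥ e := by
    have := (le_abs_self _).trans (h1.trans hag)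
    linarith
  rw [dotProduct_sampleCov_mulVec] at h2 hii ⊢
  have hn' : (0 : ℝ) < M.n := by exact_mod_cast hn
  have hcs := Finset.sum_mul_sq_le_sq_mul_sq Finset.univ (fun k => m ⬝ᵥ x k) (fun k => e ⬝ᵥ x k)
  simp_rw [← sq] at hii ⊢
  set a := ∑ k, (m ⬝ᵥ x k) * (e ⬝ᵥ x k)
  set b := ∑ k, (m ⬝ᵥ x k) ^ 2
  set c := ∑ k, (e ⬝ᵥ x k) ^ 2
  have hb : 0 ≤ b := Finset.sum_nonneg fun _ _ => sq_nonneg _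
  rw [one_div_mul_eq_div] at h2 hii ⊢
  rw [le_div_iff₀ hn'] at h2 ⊢
  rw [div_le_iff₀ hn'] at hii
  have h3 : (1 / 2 * (M.n : ℝ)) ^ 2 ≤ a ^ 2 := pow_le_pow_left₀ (by positivity) h2 2
  have h4 : (1 / 2 * (M.n : ℝ)) ^ 2 ≤ b * (2 * M.n) :=
    h3.trans (hcs.trans (mul_le_mul_of_nonneg_left hii hb))
  have h5 : (M.n : ℝ) * (1 / 4 * M.n) ≤ M.n * (2 * b) := by linarith
  have h6 := le_of_mul_le_mul_left h5 hn'
  linarith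

lemma lam_mul_sqrt (hs : 0 < M.s) (K σ : ℝ) :
    M.lam K σ * √(M.s : ℝ) = K * σ * √(M.rate * M.n) := by
  have hs' : (0 : ℝ) < M.s := by exact_mod_cast hs
  rw [Problem.lam, mul_assoc, ← Real.sqrt_mul' _ hs'.le, div_mul_cancel₀ _ hs'.ne']

lemma lamg_mul_sqrt (hsg : 0 < M.sg) (K σ : ℝ) :
    M.lamg K σ * √(M.sg : ℝ) = M.lam K σ * √(M.s : ℝ) := by
  have hs' : (0 : ℝ) < M.sg := by exact_mod_cast hsg
  rw [Problem.lamg, mul_right_comm, ← Real.sqrt_mul' _ hs'.le, div_mul_cancel₀ _ hs'.ne', mul_comm]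

/-- The ratio `λ_g / λ` is chosen so that `λ_g √s_g = λ √s`; this makes the penalty a multiple of a
single norm. -/
lemma lam_mul_norm1_add (hsg : 0 < M.sg) (hs : 0 < M.s) (K σ : ℝ) (h : Fin M.p → ℝ) :
    M.lam K σ * norm1 h + M.lamg K σ * normOneTwo M.group h =
      M.lam K σ * √(M.s : ℝ) * mixedNorm M.group M.s M.sg h := by
  have hs' : 0 < √(M.s : ℝ) := Real.sqrt_pos.2 (by exact_mod_cast hs)
  have hsg' : 0 < √(M.sg : ℝ) := Real.sqrt_pos.2 (by exact_mod_cast hsg)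
  rw [mixedNorm, mul_add]
  congr 1
  · field_simp
  · rw [← lamg_mul_sqrt hsg]; field_simp

lemma lam_nonneg {K σ : ℝ} (hK : 0 ≤ K) (hσ : 0 ≤ σ) : 0 ≤ M.lam K σ := by
  unfold Problem.lam; positivity

lemma alpha_mul_norm1_add (hsg : 0 < M.sg) (hs : 0 < M.s) (K σ : ℝ) (h : Fin M.p → ℝ) :
    M.alpha K σ * norm1 h + M.gam K σ * normOneTwo M.group h =
      M.lam K σ * √(M.s : ℝ) / (M.n * σ) * mixedNorm M.group M.s M.sg h := by
  have := lam_mul_norm1_add hsg hs K σ h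
  rw [div_mul_eq_mul_div, ← this, Problem.alpha, Problem.gam, Problem.lamg]
  ring

/-- The basic inequality after using the sparsity of the true coefficient vector. -/
lemma isSGLasso_sparse_inequality {K σ : ℝ} (hK : 0 ≤ K) (hσ : 0 ≤ σ)
    (hsp : IsSparse M.group M.s M.sg M.beta)
    {x : Fin M.n → Fin M.p → ℝ} {e : Fin M.n → ℝ} {v : Fin M.p → ℝ}
    (hv : M.IsSGLasso (M.lam K σ) (M.lamg K σ) x (Matrix.of x *ᵥ M.beta + e) v) :
    norm2 (Matrix.of x *ᵥ (v - M.beta)) ^ 2 ≤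
      2 * ((Matrix.of x)ᵀ *ᵥ e ⬝ᵥ (v - M.beta)) +
        M.lam K σ * √(M.s : ℝ) *
          (4 * norm2 (v - M.beta) - mixedNorm M.group M.s M.sg (v - M.beta)) := by
  have h1 := isSGLasso_basic_inequality hv
  have h2 := norm1_sub_norm1_add_le hsp.card_supp (v - M.beta)
  have h3 := normOneTwo_sub_normOneTwo_add_le hsp.card_groupSupp (v - M.beta)
  have hl := lam_nonneg (M := M) hK hσ
  have hlg : 0 ≤ M.lamg K σ := by unfold Problem.lamg; positivity
  have h4 := mul_le_mul_of_nonneg_left h2 hl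
  have h5 := mul_le_mul_of_nonneg_left h3 hlg
  have h6 := lam_mul_norm1_add hsp.sg_pos (hsp.sg_pos.trans_le hsp.sg_le_s) K σ (v - M.beta)
  have h7 := lamg_mul_sqrt hsp.sg_pos K σ
  have h8 : M.lamg K σ * (2 * (√(M.sg : ℝ) * norm2 (v - M.beta))) =
      2 * (M.lam K σ * √(M.s : ℝ)) * norm2 (v - M.beta) := by
    rw [← h7]; ring
  nlinarith

/-- Error bound for the sparse group Lasso under a restricted isometry property and a bound on
the noise. -/
lemma isSGLasso_mixedNorm_le {K σ : ℝ} (hK : 0 < K) (hσ : 0 < σ) (hn : 0 < M.n)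
    (hr : 0 < M.rate) (hsp : IsSparse M.group M.s M.sg M.beta)
    {x : Fin M.n → Fin M.p → ℝ} {e : Fin M.n → ℝ} {v : Fin M.p → ℝ}
    (hv : M.IsSGLasso (M.lam K σ) (M.lamg K σ) x (Matrix.of x *ᵥ M.beta + e) v)
    (hSig : ∀ u, 2 / 3 * norm2 u ^ 2 ≤ u ⬝ᵥ M.Sig *ᵥ u)
    (hRE : ∀ u, |u ⬝ᵥ M.sampleCov x *ᵥ u - u ⬝ᵥ M.Sig *ᵥ u| ≤
      1 / 300 * atomicNorm M.group M.s M.sg u ^ 2)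
    (hnoise : ∀ u, |(Matrix.of x)ᵀ *ᵥ e ⬝ᵥ u| ≤
      M.lam K σ * √(M.s : ℝ) / 4 * atomicNorm M.group M.s M.sg u) :
    mixedNorm M.group M.s M.sg (v - M.beta) ≤ 122 * (M.lam K σ * √(M.s : ℝ)) / M.n := by
  have hn' : (0 : ℝ) < M.n := by exact_mod_cast hn
  have h1 := isSGLasso_sparse_inequality hK.le hσ.le hsp hv
  have h2 := (le_abs_self _).trans (hnoise (v - M.beta))
  have hS := hSig (v - M.beta)
  have hR := (abs_le.1 (hRE (v - M.beta))).1
  rw [norm2_mulVec_sq x hn] at h1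
  have hl : 0 < M.lam K σ * √(M.s : ℝ) := by
    rw [lam_mul_sqrt (hsp.sg_pos.trans_le hsp.sg_le_s)]
    have := Real.sqrt_pos.2 (mul_pos hr hn')
    positivity
  set l := M.lam K σ * √(M.s : ℝ)
  have hN := mixedNorm_nonneg (g := M.group) M.s M.sg (v - M.beta)
  have h2n := norm2_nonneg (v - M.beta)
  unfold atomicNorm at h2 hR
  set N := mixedNorm M.group M.s M.sg (v - M.beta)
  set y := norm2 (v - M.beta)
  set Q := (v - M.beta) ⬝ᵥ M.sampleCov x *ᵥ (v - M.beta)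
  have hQ0 : 0 ≤ M.n * Q := by
    rw [← norm2_mulVec_sq x hn]; positivity
  -- The noise bound turns the basic inequality into `n Q ≤ l (9/2 y - N/2)`, and the left side is
  -- nonnegative.
  have hcone : N ≤ 9 * y := by
    have h3 : l * N ≤ l * (9 * y) := by nlinarith
    exact le_of_mul_le_mul_left h3 hl
  -- On the cone the isometry error is at most `(10 y)² / 300 = y² / 3`, half of the lower bound for
  -- `Σ`. Then `n y ≤ 27/2 l`, and `9 * 27/2 ≤ 122`.
  have hQ : 1 / 3 * y ^ 2 ≤ Q := by
    have h4 : (N + y) ^ 2 ≤ (10 * y) ^ 2 := pow_le_pow_left₀ (by positivity) (by linarith) 2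
    nlinarith
  have h5 : M.n * Q ≤ 9 / 2 * l * y := by nlinarith
  have h6 : y * (M.n * y) ≤ y * (27 / 2 * l) := by nlinarith
  have h7 : M.n * y ≤ 27 / 2 * l := by
    rcases h2n.eq_or_lt with h0 | h0
    · rw [← h0]; nlinarith
    · exact le_of_mul_le_mul_left h6 h0
  rw [le_div_iff₀ hn']
  nlinarith

end Deterministic

/-! ### The complexity of double sparsity -/

section Rates

variable {M : Problem}

lemma s_le_sg_mul_b (h : IsSparse M.group M.s M.sg M.beta) : M.s ≤ M.sg * M.b := by
  obtain ⟨S, hS, hs⟩ := h.s_le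
  refine hs.trans ((Finset.sum_le_card_nsmul S _ M.b fun j _ =>
    Finset.le_sup (f := groupSize M.group) (Finset.mem_univ j)).trans ?_)
  rw [hS, smul_eq_mul]

lemma s_pos_of_isSparse (h : IsSparse M.group M.s M.sg M.beta) : 0 < M.s :=
  h.sg_pos.trans_le h.sg_le_s

lemma b_pos_of_isSparse (h : IsSparse M.group M.s M.sg M.beta) : 0 < M.b :=
  Nat.pos_of_mul_pos_left ((s_pos_of_isSparse h).trans_le (s_le_sg_mul_b h))

lemma p_le_d_mul_b : M.p ≤ M.d * M.b := by
  have h := card_groups_le (g := M.group) Finset.univ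
  simpa [Problem.b] using h

lemma log_exp_mul (h : IsSparse M.group M.s M.sg M.beta) :
    Real.log (Real.exp 1 * M.sg * M.b) = 1 + Real.log (M.sg * M.b) := by
  have h1 : (M.sg : ℝ) ≠ 0 := by exact_mod_cast h.sg_pos.ne'
  have h2 : (M.b : ℝ) ≠ 0 := by exact_mod_cast (b_pos_of_isSparse h).ne'
  rw [mul_assoc, Real.log_mul (Real.exp_pos 1).ne' (mul_ne_zero h1 h2), Real.log_exp]

lemma log_sg_mul_b_nonneg : 0 ≤ Real.log ((M.sg : ℝ) * M.b) := by
  have := Real.log_natCast_nonneg (M.sg * M.b)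
  simpa using this

lemma log_d_div_sg_nonneg (h : IsSparse M.group M.s M.sg M.beta) :
    0 ≤ Real.log ((M.d : ℝ) / M.sg) := by
  refine Real.log_nonneg ?_
  rw [one_le_div (by exact_mod_cast h.sg_pos)]
  exact_mod_cast h.sg_le_d

lemma rate_eq (h : IsSparse M.group M.s M.sg M.beta) :
    M.rate = M.s * (1 + Real.log (M.sg * M.b)) + M.sg * Real.log (M.d / M.sg) := by
  rw [Problem.rate, log_exp_mul h]

lemma rate'_eq (h : IsSparse M.group M.s M.sg M.beta) : M.rate' = M.rate + M.sg := by
  have h1 : (M.sg : ℝ) ≠ 0 := by exact_mod_cast h.sg_pos.ne'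
  have h2 : (M.d : ℝ) ≠ 0 := by exact_mod_cast (h.sg_pos.trans_le h.sg_le_d).ne'
  rw [Problem.rate', Problem.rate, mul_div_assoc,
    Real.log_mul (Real.exp_pos 1).ne' (div_ne_zero h2 h1), Real.log_exp]
  ring

lemma s_le_rate (h : IsSparse M.group M.s M.sg M.beta) : (M.s : ℝ) ≤ M.rate := by
  rw [rate_eq h]
  have h1 := mul_nonneg (Nat.cast_nonneg (α := ℝ) M.s) (log_sg_mul_b_nonneg (M := M))
  have h2 := mul_nonneg (Nat.cast_nonneg (α := ℝ) M.sg) (log_d_div_sg_nonneg h)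
  linarith

lemma one_le_s (h : IsSparse M.group M.s M.sg M.beta) : (1 : ℝ) ≤ M.s := by
  exact_mod_cast s_pos_of_isSparse h

lemma one_le_rate (h : IsSparse M.group M.s M.sg M.beta) : 1 ≤ M.rate :=
  (one_le_s h).trans (s_le_rate h)

lemma rate_le_rate' (h : IsSparse M.group M.s M.sg M.beta) : M.rate ≤ M.rate' := by
  rw [rate'_eq h]
  linarith [Nat.cast_nonneg (α := ℝ) M.sg]

lemma choose_le_exp {d k : ℕ} (hk : 0 < k) (hd : 0 < d) :
    (d.choose k : ℝ) ≤ Real.exp (k * (1 + Real.log (d / k))) := by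
  have hk' : (0 : ℝ) < k := by exact_mod_cast hk
  have hd' : (0 : ℝ) < d := by exact_mod_cast hd
  have hf : (0 : ℝ) < k.factorial := by exact_mod_cast k.factorial_pos
  have h1 := Nat.choose_le_pow_div (α := ℝ) k d
  have h2 := Real.pow_div_factorial_le_exp (k : ℝ) hk'.le k
  have h3 : Real.exp (k * Real.log (d / k)) = (d / k : ℝ) ^ k := by
    rw [Real.exp_nat_mul, Real.exp_log (by positivity)]
  rw [mul_add, mul_one, Real.exp_add, h3]
  calc (d.choose k : ℝ) ≤ d ^ k / k.factorial := h1
    _ = k ^ k / k.factorial * (d / k) ^ k := by rw [div_pow]; field_simp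
    _ ≤ _ := by gcongr

lemma five_le_exp_two : (5 : ℝ) ≤ Real.exp 2 := by
  have := Real.quadratic_le_exp_of_nonneg (x := 2) (by norm_num)
  norm_num at this ⊢
  linarith

lemma pow_le_exp {x y : ℝ} (hx : 0 ≤ x) (h : x ≤ Real.exp y) (m : ℕ) :
    x ^ m ≤ Real.exp (m * y) := by
  rw [Real.exp_nat_mul]; exact pow_le_pow_left₀ hx h m

/-- The binomial coefficient contributes `s_g ≤ s` beyond its logarithmic term, and `5 ^ (2s)`
contributes at most `4s` in the exponent; this explains the factor `5`. -/
lemma sparse_net_card_le (h : IsSparse M.group M.s M.sg M.beta) :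
    ((M.d.choose M.sg * (M.sg * M.b) ^ (2 * M.s) * 5 ^ (2 * M.s) : ℕ) : ℝ) ≤
      Real.exp (5 * M.rate) := by
  have hb : (0 : ℝ) < M.b := by exact_mod_cast b_pos_of_isSparse h
  have hsg : (0 : ℝ) < M.sg := by exact_mod_cast h.sg_pos
  have hss : (M.sg : ℝ) ≤ M.s := by exact_mod_cast h.sg_le_s
  have h1 := choose_le_exp h.sg_pos (h.sg_pos.trans_le h.sg_le_d)
  have h2 : ((M.sg : ℝ) * M.b) ^ (2 * M.s) ≤
      Real.exp ((2 * M.s : ℕ) * Real.log (M.sg * M.b)) :=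
    pow_le_exp (by positivity) (Real.exp_log (by positivity)).ge _
  have h3 : (5 : ℝ) ^ (2 * M.s) ≤ Real.exp ((2 * M.s : ℕ) * 2) :=
    pow_le_exp (by norm_num) five_le_exp_two _
  push_cast at h2 h3 ⊢
  calc _ ≤ Real.exp (M.sg * (1 + Real.log (M.d / M.sg))) *
        Real.exp (2 * M.s * Real.log (M.sg * M.b)) * Real.exp (2 * M.s * 2) := by gcongr
    _ = Real.exp (M.sg * (1 + Real.log (M.d / M.sg)) + 2 * M.s * Real.log (M.sg * M.b) +
        2 * M.s * 2) := by rw [Real.exp_add, Real.exp_add]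
    _ ≤ _ := by
      refine Real.exp_le_exp.2 ?_
      rw [rate_eq h]
      have h4 := mul_nonneg (Nat.cast_nonneg (α := ℝ) M.s) (log_sg_mul_b_nonneg (M := M))
      have h5 := mul_nonneg (Nat.cast_nonneg (α := ℝ) M.sg) (log_d_div_sg_nonneg h)
      nlinarith

/-- The number of coordinates allowed in a block of a single group. -/
def blockSize (M : Problem) : ℕ := (M.s + M.sg - 1) / M.sg

lemma s_le_blockSize_mul (h : IsSparse M.group M.s M.sg M.beta) :
    M.s ≤ blockSize M * M.sg := by
  have := Nat.lt_div_mul_add (a := M.s + M.sg - 1) h.sg_pos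
  have := h.sg_pos
  unfold blockSize
  omega

lemma blockSize_mul_le (h : IsSparse M.group M.s M.sg M.beta) :
    blockSize M * M.sg ≤ 2 * M.s := by
  have := Nat.div_mul_le_self (M.s + M.sg - 1) M.sg
  have := h.sg_le_s
  unfold blockSize
  omega

lemma blockSize_pos (h : IsSparse M.group M.s M.sg M.beta) : 0 < blockSize M :=
  Nat.pos_of_mul_pos_right ((s_pos_of_isSparse h).trans_le (s_le_blockSize_mul h))

/-- The factor `p` pays for a union over all rows. With `r ≤ 2s/s_g` and `p ≤ d b`, the logarithm
involves `2 log d = 2 log(d/s_g) + 2 log s_g`, and `s/s_g ≥ 1` absorbs the terms without that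
factor. -/
lemma block_net_card_le (h : IsSparse M.group M.s M.sg M.beta) :
    ((M.p * (M.d.choose 1 * (1 * M.b) ^ blockSize M * 5 ^ blockSize M) : ℕ) : ℝ) ≤
      Real.exp (4 * (M.rate / M.sg)) := by
  have hb : (1 : ℝ) ≤ M.b := by exact_mod_cast b_pos_of_isSparse h
  have hsg1 : (1 : ℝ) ≤ M.sg := by exact_mod_cast h.sg_pos
  have hsg : (0 : ℝ) < M.sg := by linarith
  have hss : (M.sg : ℝ) ≤ M.s := by exact_mod_cast h.sg_le_s
  have hd : (0 : ℝ) < M.d := by exact_mod_cast h.sg_pos.trans_le h.sg_le_d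
  set r := blockSize M with hr
  have hr2 : (r : ℝ) ≤ 2 * (M.s / M.sg) := by
    have : (r : ℝ) * M.sg ≤ 2 * M.s := by exact_mod_cast blockSize_mul_le h
    rw [← mul_div_assoc, le_div_iff₀ hsg]; exact this
  have hρ : (1 : ℝ) ≤ M.s / M.sg := by rwa [one_le_div hsg]
  have hp : (M.p : ℝ) ≤ M.d * M.b := by exact_mod_cast p_le_d_mul_b
  have hlb := Real.log_nonneg hb
  have hlsg := Real.log_nonneg hsg1
  have hG := log_d_div_sg_nonneg h
  have h2 : (M.b : ℝ) ^ r ≤ Real.exp (r * Real.log M.b) :=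
    pow_le_exp (by positivity) (Real.exp_log (by positivity)).ge _
  have h3 : (5 : ℝ) ^ r ≤ Real.exp (r * 2) := pow_le_exp (by norm_num) five_le_exp_two _
  have hR : M.rate / M.sg = M.s / M.sg * (1 + (Real.log M.sg + Real.log M.b)) +
      Real.log (M.d / M.sg) := by
    rw [rate_eq h, Real.log_mul hsg.ne' (by positivity)]; field_simp
  have hld : Real.log M.d = Real.log (M.d / M.sg) + Real.log M.sg := by
    rw [Real.log_div hd.ne' hsg.ne']; ring
  have hde : (M.d : ℝ) = Real.exp (Real.log M.d) := (Real.exp_log hd).symm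
  have hbe : (M.b : ℝ) = Real.exp (Real.log M.b) := (Real.exp_log (by positivity)).symm
  push_cast
  rw [Nat.choose_one_right, one_mul]
  calc _ ≤ (M.d * M.b : ℝ) * (M.d * Real.exp (r * Real.log M.b) * Real.exp (r * 2)) := by gcongr
    _ = Real.exp (Real.log M.d + Real.log M.b + (Real.log M.d + r * Real.log M.b + r * 2)) := by
      rw [Real.exp_add, Real.exp_add, Real.exp_add, Real.exp_add, ← hde, ← hbe]
    _ ≤ _ := by
      refine Real.exp_le_exp.2 ?_
      rw [hR, hld]
      set ρ : ℝ := M.s / M.sg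
      have e1 : r * Real.log M.b ≤ 2 * ρ * Real.log M.b := by gcongr
      have e2 : Real.log M.b ≤ ρ * Real.log M.b := le_mul_of_one_le_left hlb hρ
      have e3 : Real.log M.sg ≤ ρ * Real.log M.sg := le_mul_of_one_le_left hlsg hρ
      have e4 : 0 ≤ ρ * Real.log M.b := by positivity
      have e5 : 0 ≤ ρ * Real.log M.sg := by positivity
      nlinarith

end Rates

/-! ### The good event -/

section GoodEvent

variable {Ω : Type*} [MeasurableSpace Ω] {P : Measure Ω} {M : Problem} {D : Sample M Ω} {κ σ K : ℝ}

lemma measureReal_exists_le [IsFiniteMeasure P] {ι : Type*} (F : Finset ι) (A : ι → Set Ω) {c : ℝ}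
    (h : ∀ a ∈ F, P.real (A a) ≤ c) : P.real {ω | ∃ a ∈ F, ω ∈ A a} ≤ F.card * c := by
  have e : {ω | ∃ a ∈ F, ω ∈ A a} = ⋃ a ∈ F, A a := by ext ω; simp
  rw [e]
  refine (measureReal_biUnion_finset_le F A).trans ((Finset.sum_le_sum h).trans ?_)
  rw [Finset.sum_const, nsmul_eq_mul]

lemma gam_eq (hsp : IsSparse M.group M.s M.sg M.beta) (hσ : 0 < σ) (hK : 0 ≤ K) (hn : 0 < M.n) :
    M.gam K σ = K * √(M.rate / (M.sg * M.n)) := by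
  have hs : (0 : ℝ) < M.s := by exact_mod_cast s_pos_of_isSparse hsp
  have hsg : (0 : ℝ) < M.sg := by exact_mod_cast hsp.sg_pos
  have hn' : (0 : ℝ) < M.n := by exact_mod_cast hn
  have hr := (zero_lt_one.trans_le (one_le_rate hsp))
  refine (pow_left_inj₀ (by unfold Problem.gam Problem.lam; positivity) (by positivity)
    two_ne_zero).1 ?_
  rw [Problem.gam, Problem.lam]
  simp only [mul_pow, div_pow]
  rw [Real.sq_sqrt (by positivity), Real.sq_sqrt (by positivity), Real.sq_sqrt (by positivity)]
  field_simp

lemma gam_sq (hsp : IsSparse M.group M.s M.sg M.beta) :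
    M.gam K σ ^ 2 = M.s / M.sg * M.alpha K σ ^ 2 := by
  have hs : (0 : ℝ) < M.s := by exact_mod_cast s_pos_of_isSparse hsp
  have hsg : (0 : ℝ) < M.sg := by exact_mod_cast hsp.sg_pos
  rw [Problem.gam, Problem.alpha, mul_pow, Real.sq_sqrt (by positivity)]

lemma alpha_nonneg (hσ : 0 < σ) (hK : 0 ≤ K) : 0 ≤ M.alpha K σ := by
  unfold Problem.alpha Problem.lam; positivity

lemma sampleCov_transpose (x : Fin M.n → Fin M.p → ℝ) : (M.sampleCov x)ᵀ = M.sampleCov x := by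
  rw [Problem.sampleCov, Matrix.transpose_smul, Matrix.transpose_sum]
  simp_rw [Matrix.transpose_vecMulVec]

/-- The restricted isometry constant used below requires this many samples per unit of the rate. -/
noncomputable def sampleConst (κ : ℝ) : ℝ := 11 * 1200 ^ 2 / bernsteinRate κ

/-- The smallest admissible constant in the tuning parameter. -/
noncomputable def tuningConst (κ : ℝ) : ℝ := 8 * √(6 / bernsteinRate κ)

lemma sampleConst_pos (κ : ℝ) : 0 < sampleConst κ := by
  have := bernsteinRate_pos κ
  unfold sampleConst; positivity

lemma tuningConst_pos (κ : ℝ) : 0 < tuningConst κ := by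
  have := bernsteinRate_pos κ
  unfold tuningConst; positivity

/-- There are at most `exp(10 L)` pairs of net points, and the sample size makes a deviation of
`1/1200` on one pair cost `exp(-11 L)`. Duality in both arguments multiplies `1/1200` by `4`. -/
lemma measure_not_restricted_isometry_le [IsProbabilityMeasure P] (hD : D.SubGaussianDesign P κ)
    (hsp : IsSparse M.group M.s M.sg M.beta) (hn0 : 0 < M.n) (hn : sampleConst κ * M.rate ≤ M.n) :
    P.real {ω | ¬ ∀ u, |u ⬝ᵥ M.sampleCov (D.X ω) *ᵥ u - u ⬝ᵥ M.Sig *ᵥ u| ≤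
      1 / 300 * atomicNorm M.group M.s M.sg u ^ 2} ≤ 2 * Real.exp (-M.rate) := by
  have hq := bernsteinRate_pos κ
  obtain ⟨N, hNc, hN1, hN⟩ := exists_net M.group (2 * M.s) hsp.sg_le_d
  have hNc' : (N.card : ℝ) ≤ Real.exp (5 * M.rate) :=
    le_trans (by exact_mod_cast hNc) (sparse_net_card_le hsp)
  set A : (Fin M.p → ℝ) × (Fin M.p → ℝ) → Set Ω := fun w =>
    {ω | 1 / 1200 ≤ |w.1 ⬝ᵥ M.sampleCov (D.X ω) *ᵥ w.2 - w.1 ⬝ᵥ M.Sig *ᵥ w.2|} with hA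
  have hAb : ∀ w ∈ N ×ˢ N, P.real (A w) ≤
      2 * Real.exp (-(bernsteinRate κ * M.n * (1 / 1200) ^ 2)) := by
    intro w hw
    obtain ⟨h1, h2⟩ := Finset.mem_product.1 hw
    exact measure_abs_sampleCov_sub_ge_le hD hn0 (quadraticForm_le_of_norm2_le hD (hN1 _ h1))
      (quadraticForm_le_of_norm2_le hD (hN1 _ h2)) (by norm_num) (by norm_num)
  have hsym : M.Sigᵀ = M.Sig := by
    have := (posDef_Sig hD).isHermitian
    rwa [Matrix.IsHermitian, Matrix.conjTranspose_eq_transpose_of_trivial] at this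
  have hsub : {ω | ¬ ∀ u, |u ⬝ᵥ M.sampleCov (D.X ω) *ᵥ u - u ⬝ᵥ M.Sig *ᵥ u| ≤
      1 / 300 * atomicNorm M.group M.s M.sg u ^ 2} ⊆ {ω | ∃ w ∈ N ×ˢ N, ω ∈ A w} := by
    intro ω hω
    by_contra hcon
    refine hω fun u => ?_
    have h1 : ∀ w ∈ N, ∀ w' ∈ N, |w ⬝ᵥ (M.sampleCov (D.X ω) - M.Sig) *ᵥ w'| ≤ 1 / 1200 := by
      intro w hw w' hw'
      by_contra! hlt
      refine hcon ⟨(w, w'), Finset.mem_product.2 ⟨hw, hw'⟩, ?_⟩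
      rw [Matrix.sub_mulVec, dotProduct_sub] at hlt
      exact hlt.le
    have h2 := IsNet.abs_quadraticForm_le hN hsp.sg_pos hsp.sg_le_s
      (by rw [Matrix.transpose_sub, sampleCov_transpose, hsym]) (by norm_num) h1 u
    rw [Matrix.sub_mulVec, dotProduct_sub] at h2
    linarith
  calc _ ≤ _ := measureReal_mono hsub
    _ ≤ _ := measureReal_exists_le _ _ hAb
    _ = N.card * N.card * (2 * Real.exp (-(bernsteinRate κ * M.n * (1 / 1200) ^ 2))) := by
      rw [Finset.card_product]; push_cast; rfl
    _ ≤ Real.exp (5 * M.rate) * Real.exp (5 * M.rate) *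
        (2 * Real.exp (-(bernsteinRate κ * M.n * (1 / 1200) ^ 2))) := by gcongr
    _ = 2 * Real.exp (5 * M.rate + 5 * M.rate - bernsteinRate κ * M.n * (1 / 1200) ^ 2) := by
      rw [sub_eq_add_neg, Real.exp_add, Real.exp_add]; ring
    _ ≤ _ := by
      have h1 : 11 * M.rate ≤ bernsteinRate κ * M.n * (1 / 1200) ^ 2 := by
        calc 11 * M.rate = bernsteinRate κ * (sampleConst κ * M.rate) * (1 / 1200) ^ 2 := by
              rw [sampleConst]; field_simp
          _ ≤ _ := by gcongr
      gcongr
      linarith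

lemma six_div_mul_rate_le (hr : 0 ≤ M.rate) (hn : sampleConst κ * M.rate ≤ M.n) :
    6 / bernsteinRate κ * M.rate ≤ M.n := by
  have hq := bernsteinRate_pos κ
  refine le_trans ?_ hn
  unfold sampleConst
  gcongr
  norm_num

/-- The level `t² = 6L/(qn)`, with `q` the Bernstein rate, costs `exp(-6 L)` against a net of size
`exp(5 L)`. Duality doubles `n t σ`, and `tuningConst` is chosen so that the result is at most `λ√s
/ 4`. -/
lemma measure_not_noise_bound_le [IsProbabilityMeasure P] (hD : D.SubGaussianDesign P κ)
    (hε : D.GaussianNoise P σ) (hσ : 0 < σ) (hK : tuningConst κ ≤ K)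
    (hsp : IsSparse M.group M.s M.sg M.beta) (hn0 : 0 < M.n) (hn : sampleConst κ * M.rate ≤ M.n) :
    P.real {ω | ¬ ∀ u, |(Matrix.of (D.X ω))ᵀ *ᵥ D.eps ω ⬝ᵥ u| ≤
      M.lam K σ * √(M.s : ℝ) / 4 * atomicNorm M.group M.s M.sg u} ≤ 2 * Real.exp (-M.rate) := by
  have hq := bernsteinRate_pos κ
  have hn' : (0 : ℝ) < M.n := by exact_mod_cast hn0
  have hr : 0 < M.rate := zero_lt_one.trans_le (one_le_rate hsp)
  obtain ⟨N, hNc, hN1, hN⟩ := exists_net M.group (2 * M.s) hsp.sg_le_d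
  have hNc' : (N.card : ℝ) ≤ Real.exp (5 * M.rate) :=
    le_trans (by exact_mod_cast hNc) (sparse_net_card_le hsp)
  set t := √(6 / bernsteinRate κ * (M.rate / M.n)) with ht
  have ht2 : t ^ 2 = 6 / bernsteinRate κ * (M.rate / M.n) := Real.sq_sqrt (by positivity)
  have ht1 : t ≤ 1 := by
    rw [ht, Real.sqrt_le_one, ← mul_div_assoc, div_le_one hn']
    exact six_div_mul_rate_le hr.le hn
  have hnt : M.n * t = √(6 / bernsteinRate κ) * √(M.rate * M.n) := by
    rw [ht, ← Real.sqrt_mul (by positivity)]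
    nth_rewrite 1 [← Real.sqrt_sq hn'.le]
    rw [← Real.sqrt_mul (by positivity)]
    congr 1
    field_simp
  set A : (Fin M.p → ℝ) → Set Ω := fun w =>
    {ω | M.n * t * σ ≤ |w ⬝ᵥ (Matrix.of (D.X ω))ᵀ *ᵥ D.eps ω|} with hA
  have hAb : ∀ w ∈ N, P.real (A w) ≤ 2 * Real.exp (-(bernsteinRate κ * M.n * t ^ 2)) :=
    fun w hw => measure_abs_noise_ge_le hD hε hσ (quadraticForm_le_of_norm2_le hD (hN1 _ hw))
      (Real.sqrt_nonneg _) ht1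
  have hsub : {ω | ¬ ∀ u, |(Matrix.of (D.X ω))ᵀ *ᵥ D.eps ω ⬝ᵥ u| ≤
      M.lam K σ * √(M.s : ℝ) / 4 * atomicNorm M.group M.s M.sg u} ⊆
        {ω | ∃ w ∈ N, ω ∈ A w} := by
    intro ω hω
    by_contra hcon
    refine hω fun u => ?_
    have h1 : ∀ w ∈ N, |w ⬝ᵥ (Matrix.of (D.X ω))ᵀ *ᵥ D.eps ω| ≤ M.n * t * σ := by
      intro w hw
      by_contra! hlt
      exact hcon ⟨w, hw, hlt.le⟩
    refine (IsNet.abs_dotProduct_le hN hsp.sg_pos hsp.sg_le_s (by positivity) h1 u).trans ?_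
    refine mul_le_mul_of_nonneg_right ?_ (atomicNorm_nonneg _ _ _)
    rw [lam_mul_sqrt (s_pos_of_isSparse hsp), hnt]
    have h2 : tuningConst κ * (σ * √(M.rate * M.n)) ≤ K * (σ * √(M.rate * M.n)) := by gcongr
    unfold tuningConst at h2
    linarith
  calc _ ≤ _ := measureReal_mono hsub
    _ ≤ _ := measureReal_exists_le _ _ hAb
    _ ≤ Real.exp (5 * M.rate) * (2 * Real.exp (-(bernsteinRate κ * M.n * t ^ 2))) := by gcongr
    _ = 2 * Real.exp (5 * M.rate + -(bernsteinRate κ * M.n * t ^ 2)) := by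
      rw [Real.exp_add]; ring
    _ = _ := by
      rw [ht2]; congr 2; field_simp; ring

/-- The witness is `Σ⁻¹e_i`, whose residual is `(Σ̂ - Σ)Σ⁻¹e_i`. The constraint is a maximum over
groups, so only blocks of about `s/s_g` coordinates in one group are tested. The net has size `exp(4
L/s_g)` including the union over `i`, and the level `t` costs `exp(-5 L/s_g)`. -/
lemma measure_not_feasible_le [IsProbabilityMeasure P] (hD : D.SubGaussianDesign P κ)
    (hσ : 0 < σ) (hK : tuningConst κ ≤ K)
    (hsp : IsSparse M.group M.s M.sg M.beta) (hn0 : 0 < M.n) (hn : sampleConst κ * M.rate ≤ M.n) :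
    P.real {ω | ¬ ∀ i, ∃ m, M.Feasible (M.alpha K σ) (M.gam K σ) (D.X ω) i m} ≤
      2 * Real.exp (-(M.rate / M.sg)) := by
  have hq := bernsteinRate_pos κ
  have hK0 : 0 < K := (tuningConst_pos κ).trans_le hK
  have hn' : (0 : ℝ) < M.n := by exact_mod_cast hn0
  have hsg1 : (1 : ℝ) ≤ M.sg := by exact_mod_cast hsp.sg_pos
  have hr : 0 < M.rate := zero_lt_one.trans_le (one_le_rate hsp)
  obtain ⟨N, hNc, hN1, hN⟩ := exists_net M.group (blockSize M) (k := 1)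
    (hsp.sg_pos.trans_le hsp.sg_le_d)
  have hNc' : (M.p * N.card : ℝ) ≤ Real.exp (4 * (M.rate / M.sg)) :=
    le_trans (by exact_mod_cast Nat.mul_le_mul_left _ hNc) (block_net_card_le hsp)
  set t := √(5 / bernsteinRate κ * (M.rate / (M.sg * M.n))) with ht
  have ht2 : t ^ 2 = 5 / bernsteinRate κ * (M.rate / (M.sg * M.n)) := Real.sq_sqrt (by positivity)
  have ht1 : t ≤ 1 := by
    rw [ht, Real.sqrt_le_one, ← mul_div_assoc, div_le_one (by positivity)]
    have h1 := six_div_mul_rate_le hr.le hn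
    have h2 : 5 / bernsteinRate κ * M.rate ≤ 6 / bernsteinRate κ * M.rate := by gcongr; norm_num
    nlinarith
  have htg : 2 * t ≤ M.gam K σ := by
    rw [gam_eq hsp hσ hK0.le hn0, ht, Real.sqrt_mul (by positivity), ← mul_assoc]
    refine mul_le_mul_of_nonneg_right (le_trans ?_ hK) (Real.sqrt_nonneg _)
    unfold tuningConst
    gcongr <;> norm_num
  set A : Fin M.p × (Fin M.p → ℝ) → Set Ω := fun w =>
    {ω | t ≤ |w.2 ⬝ᵥ M.sampleCov (D.X ω) *ᵥ (M.Sig⁻¹ *ᵥ Pi.single w.1 1) -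
      w.2 ⬝ᵥ M.Sig *ᵥ (M.Sig⁻¹ *ᵥ Pi.single w.1 1)|} with hA
  have hAb : ∀ w ∈ Finset.univ ×ˢ N, P.real (A w) ≤
      2 * Real.exp (-(bernsteinRate κ * M.n * t ^ 2)) := fun w hw =>
    measure_abs_sampleCov_sub_ge_le hD hn0
      (quadraticForm_le_of_norm2_le hD (hN1 _ (Finset.mem_product.1 hw).2))
      (quadraticForm_inv_single_le hD w.1) (Real.sqrt_nonneg _) ht1
  have hsub : {ω | ¬ ∀ i, ∃ m, M.Feasible (M.alpha K σ) (M.gam K σ) (D.X ω) i m} ⊆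
      {ω | ∃ w ∈ Finset.univ ×ˢ N, ω ∈ A w} := by
    intro ω hω
    by_contra hcon
    refine hω fun i => ⟨M.Sig⁻¹ *ᵥ Pi.single i 1, ?_⟩
    have h1 : ∀ w ∈ N, |w ⬝ᵥ fun l => (M.sampleCov (D.X ω) *ᵥ (M.Sig⁻¹ *ᵥ Pi.single i 1)) l -
        (Pi.single i 1 : Fin M.p → ℝ) l| ≤ t := by
      intro w hw
      by_contra! hlt
      refine hcon ⟨(i, w), Finset.mem_product.2 ⟨Finset.mem_univ _, hw⟩, ?_⟩
      have h2 := hlt.le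
      change t ≤ |w ⬝ᵥ (M.sampleCov (D.X ω) *ᵥ (M.Sig⁻¹ *ᵥ Pi.single i 1) - Pi.single i 1)| at h2
      rw [dotProduct_sub] at h2
      change t ≤ |_ - w ⬝ᵥ M.Sig *ᵥ (M.Sig⁻¹ *ᵥ Pi.single i 1)|
      rwa [Sig_mulVec_inv_mulVec hD]
    refine (normInfTwo_softThreshold_le (alpha_nonneg hσ hK0.le)
      (by positivity : 0 ≤ 2 * t) (blockSize_pos hsp) ?_ (hN _ t h1)).trans htg
    calc (2 * t) ^ 2 ≤ M.gam K σ ^ 2 := pow_le_pow_left₀ (by positivity) htg 2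
      _ = M.s / M.sg * M.alpha K σ ^ 2 := gam_sq hsp
      _ ≤ _ := by
        gcongr
        rw [div_le_iff₀ (by linarith)]
        exact_mod_cast s_le_blockSize_mul hsp
  calc _ ≤ _ := measureReal_mono hsub
    _ ≤ _ := measureReal_exists_le _ _ hAb
    _ = M.p * N.card * (2 * Real.exp (-(bernsteinRate κ * M.n * t ^ 2))) := by
      rw [Finset.card_product]; simp
    _ ≤ Real.exp (4 * (M.rate / M.sg)) *
        (2 * Real.exp (-(bernsteinRate κ * M.n * t ^ 2))) := by gcongr
    _ = 2 * Real.exp (4 * (M.rate / M.sg) + -(bernsteinRate κ * M.n * t ^ 2)) := by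
      rw [Real.exp_add]; ring
    _ = _ := by
      rw [ht2]; congr 2; field_simp; ring

end GoodEvent

/-! ### Decomposition of the debiased estimator -/

section Decomposition

variable {Ω : Type*} {M : Problem} (D : Sample M Ω)

/-- The remainder `√n (I - M̂ Σ̂) (β̂ - β*)`. -/
noncomputable def remainder (ω : Ω) : Fin M.p → ℝ := fun i =>
  √(M.n : ℝ) * ((D.betaHat ω - M.beta) i -
    D.Mhat (D.X ω) i ⬝ᵥ M.sampleCov (D.X ω) *ᵥ (D.betaHat ω - M.beta))

/-- The noise term `n^{-1/2} M̂ Xᵀ ε` as a function of the design and the noise. -/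
noncomputable def noiseTerm (z : (Fin M.n → Fin M.p → ℝ) × (Fin M.n → ℝ)) : Fin M.p → ℝ :=
  (√(M.n : ℝ))⁻¹ • (Matrix.of (D.Mhat z.1) *ᵥ ((Matrix.of z.1)ᵀ *ᵥ z.2))

lemma transpose_mulVec_mulVec (hn : 0 < M.n) (x : Fin M.n → Fin M.p → ℝ) (h : Fin M.p → ℝ) :
    (Matrix.of x)ᵀ *ᵥ (Matrix.of x *ᵥ h) = (M.n : ℝ) • M.sampleCov x *ᵥ h := by
  have hn' : (M.n : ℝ) ≠ 0 := by exact_mod_cast hn.ne'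
  have e : (Matrix.of x)ᵀ * Matrix.of x = (M.n : ℝ) • M.sampleCov x := by
    rw [Problem.sampleCov, smul_smul, mul_one_div_cancel hn', one_smul]
    ext i j
    simp [Matrix.mul_apply, Matrix.sum_apply, Matrix.vecMulVec_apply]
  rw [Matrix.mulVec_mulVec, e, Matrix.smul_mulVec]

lemma sqrt_smul_betaU_sub (hn : 0 < M.n) (ω : Ω) :
    √(M.n : ℝ) • (D.betaU ω - M.beta) = remainder D ω + noiseTerm D (D.X ω, D.eps ω) := by
  have hn' : (0 : ℝ) < M.n := by exact_mod_cast hn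
  have e1 : D.Y ω - Matrix.of (D.X ω) *ᵥ D.betaHat ω =
      D.eps ω - Matrix.of (D.X ω) *ᵥ (D.betaHat ω - M.beta) := by
    rw [Sample.Y, Matrix.mulVec_sub]; abel
  ext i
  rw [Sample.betaU, e1, Matrix.mulVec_sub, transpose_mulVec_mulVec hn, Matrix.mulVec_sub,
    Matrix.mulVec_smul]
  have e2 : ∀ v, (Matrix.of (D.Mhat (D.X ω)) *ᵥ v) i = D.Mhat (D.X ω) i ⬝ᵥ v := fun v => rfl
  have hs : √(M.n : ℝ) ≠ 0 := (Real.sqrt_pos.2 hn').ne'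
  simp only [noiseTerm, remainder, Pi.add_apply, Pi.sub_apply, Pi.smul_apply, smul_eq_mul, e2]
  have hsq : (M.n : ℝ) = √(M.n : ℝ) * √(M.n : ℝ) := (Real.mul_self_sqrt hn'.le).symm
  set r := √(M.n : ℝ)
  rw [hsq]
  field_simp
  ring

variable {D}

lemma measurable_dotProduct {α ι : Type*} [MeasurableSpace α] [Fintype ι] {u v : α → ι → ℝ}
    (hu : Measurable u) (hv : Measurable v) : Measurable fun a => u a ⬝ᵥ v a := by
  unfold dotProduct
  exact Finset.measurable_sum _ fun i _ => ((measurable_pi_apply i).comp hu).mul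
    ((measurable_pi_apply i).comp hv)

lemma measurable_row_dotProduct {α : Type*} [MeasurableSpace α] {x : α → Fin M.n → Fin M.p → ℝ}
    {u : α → Fin M.p → ℝ} (hx : Measurable x) (hu : Measurable u) (k : Fin M.n) :
    Measurable fun a => u a ⬝ᵥ x a k :=
  measurable_dotProduct hu ((measurable_pi_apply k).comp hx)

lemma measurable_sampleCov_form {α : Type*} [MeasurableSpace α] {x : α → Fin M.n → Fin M.p → ℝ}
    {u v : α → Fin M.p → ℝ} (hx : Measurable x) (hu : Measurable u) (hv : Measurable v) :
    Measurable fun a => u a ⬝ᵥ M.sampleCov (x a) *ᵥ v a := by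
  simp_rw [dotProduct_sampleCov_mulVec]
  exact measurable_const.mul (Finset.measurable_sum _ fun k _ =>
    (measurable_row_dotProduct hx hu k).mul (measurable_row_dotProduct hx hv k))

lemma measurable_Mhat_row {α : Type*} [MeasurableSpace α] {x : α → Fin M.n → Fin M.p → ℝ}
    (hD : Measurable D.Mhat) (hx : Measurable x) (i : Fin M.p) :
    Measurable fun a => D.Mhat (x a) i :=
  (measurable_pi_apply i).comp (hD.comp hx)

lemma measurable_remainder [MeasurableSpace Ω] (hX : Measurable D.X) (hM : Measurable D.Mhat)
    (hb : Measurable D.betaHat) : Measurable (remainder D) := by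
  refine measurable_pi_iff.2 fun i => measurable_const.mul (Measurable.sub ?_ ?_)
  · exact (measurable_pi_apply i).comp (hb.sub_const _)
  · exact measurable_sampleCov_form hX (measurable_Mhat_row hM hX i) (hb.sub_const _)

lemma transpose_mulVec_dotProduct (x : Fin M.n → Fin M.p → ℝ) (u : Fin M.p → ℝ) (e : Fin M.n → ℝ) :
    u ⬝ᵥ (Matrix.of x)ᵀ *ᵥ e = (fun k => u ⬝ᵥ x k) ⬝ᵥ e := by
  rw [Matrix.dotProduct_mulVec, Matrix.vecMul_transpose]
  congr 1
  ext k
  rw [dotProduct_comm]; rfl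

lemma noiseTerm_apply (z : (Fin M.n → Fin M.p → ℝ) × (Fin M.n → ℝ)) (i : Fin M.p) :
    noiseTerm D z i = (√(M.n : ℝ))⁻¹ * ((fun k => D.Mhat z.1 i ⬝ᵥ z.1 k) ⬝ᵥ z.2) := by
  rw [← transpose_mulVec_dotProduct]; rfl

lemma measurable_noiseTerm (hM : Measurable D.Mhat) : Measurable (noiseTerm D) := by
  refine measurable_pi_iff.2 fun i => ?_
  simp_rw [noiseTerm_apply]
  exact measurable_const.mul (measurable_dotProduct (measurable_pi_iff.2 fun k =>
    measurable_row_dotProduct measurable_fst (measurable_Mhat_row hM measurable_fst i) k)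
    measurable_snd)

variable [MeasurableSpace Ω] {P : Measure Ω} {κ σ c K : ℝ}

/-- Error bound for the remainder on the good event. -/
lemma abs_remainder_le (hσ : 0 < σ) (hK : 0 < K) (hn : 0 < M.n)
    (hA : D.Assumptions P κ σ c K) {ω : Ω}
    (hRE : ∀ u, |u ⬝ᵥ M.sampleCov (D.X ω) *ᵥ u - u ⬝ᵥ M.Sig *ᵥ u| ≤
      1 / 300 * atomicNorm M.group M.s M.sg u ^ 2)
    (hnoise : ∀ u, |(Matrix.of (D.X ω))ᵀ *ᵥ D.eps ω ⬝ᵥ u| ≤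
      M.lam K σ * √(M.s : ℝ) / 4 * atomicNorm M.group M.s M.sg u)
    (hF : ∀ i, ∃ m, M.Feasible (M.alpha K σ) (M.gam K σ) (D.X ω) i m) (i : Fin M.p) :
    |remainder D ω i| ≤ 122 * K ^ 2 * M.rate / √(M.n : ℝ) * σ := by
  have hn' : (0 : ℝ) < M.n := by exact_mod_cast hn
  have hr : 0 < M.rate := zero_lt_one.trans_le (one_le_rate hA.sparse)
  have hs0 := s_pos_of_isSparse hA.sparse
  have h1 := isSGLasso_mixedNorm_le hK hσ hn hr hA.sparse (hA.betaHat_spec ω)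
    (fun u => (quadraticForm_Sig_bounds hA.design u).1) hRE hnoise
  have h2 := abs_sub_le_of_feasible (alpha_nonneg hσ hK.le) (hA.Mhat_spec _ i (hF i)).1
    (D.betaHat ω - M.beta)
  rw [alpha_mul_norm1_add hA.sparse.sg_pos hs0] at h2
  set l := M.lam K σ * √(M.s : ℝ) with hl
  have hl2 : l ^ 2 = K ^ 2 * σ ^ 2 * (M.rate * M.n) := by
    rw [hl, lam_mul_sqrt hs0, mul_pow, mul_pow, Real.sq_sqrt (by positivity)]
  have hl0 : 0 ≤ l := mul_nonneg (lam_nonneg hK.le hσ.le) (Real.sqrt_nonneg _)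
  rw [remainder, abs_mul, abs_of_nonneg (Real.sqrt_nonneg _)]
  -- The product of the two errors, each proportional to `l = λ√s`.
  calc _ ≤ √(M.n : ℝ) * (l / (M.n * σ) * (122 * l / M.n)) := by
        refine mul_le_mul_of_nonneg_left (h2.trans ?_) (Real.sqrt_nonneg _)
        gcongr
    _ = √(M.n : ℝ) * (122 * l ^ 2 / (M.n ^ 2 * σ)) := by field_simp
    _ = √(M.n : ℝ) * (122 * K ^ 2 * M.rate * σ / M.n) := by rw [hl2]; field_simp
    _ = _ := by
      have hs : √(M.n : ℝ) ≠ 0 := (Real.sqrt_pos.2 hn').ne'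
      nth_rewrite 2 [← Real.mul_self_sqrt hn'.le]
      field_simp

/-- The three bad events have small probability. -/
lemma measure_not_good_le [IsProbabilityMeasure P] (hσ : 0 < σ) (hK : tuningConst κ ≤ K)
    (hA : D.Assumptions P κ σ c K) (hn0 : 0 < M.n) (hn : sampleConst κ * M.rate ≤ M.n) :
    P.real {ω | ¬ ((∀ u, |u ⬝ᵥ M.sampleCov (D.X ω) *ᵥ u - u ⬝ᵥ M.Sig *ᵥ u| ≤
        1 / 300 * atomicNorm M.group M.s M.sg u ^ 2) ∧
      (∀ u, |(Matrix.of (D.X ω))ᵀ *ᵥ D.eps ω ⬝ᵥ u| ≤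
        M.lam K σ * √(M.s : ℝ) / 4 * atomicNorm M.group M.s M.sg u) ∧
      ∀ i, ∃ m, M.Feasible (M.alpha K σ) (M.gam K σ) (D.X ω) i m)} ≤
      6 * Real.exp (-M.rate / M.s) := by
  have hsp := hA.sparse
  have h1 := measure_not_restricted_isometry_le hA.design hsp hn0 hn
  have h2 := measure_not_noise_bound_le hA.design hA.noise hσ hK hsp hn0 hn
  have h3 := measure_not_feasible_le hA.design hσ hK hsp hn0 hn
  have hr : 0 < M.rate := zero_lt_one.trans_le (one_le_rate hsp)
  have hsg : (0 : ℝ) < M.sg := by exact_mod_cast hsp.sg_pos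
  have hss : (M.sg : ℝ) ≤ M.s := by exact_mod_cast hsp.sg_le_s
  -- Since `1 ≤ s` and `s_g ≤ s`, the exponents `L` and `L/s_g` are both at least `L/s`.
  have e1 : Real.exp (-M.rate) ≤ Real.exp (-M.rate / M.s) := by
    rw [neg_div]
    gcongr
    exact div_le_self hr.le (one_le_s hsp)
  have e2 : Real.exp (-(M.rate / M.sg)) ≤ Real.exp (-M.rate / M.s) := by
    rw [neg_div]
    gcongr
  simp_rw [not_and_or, Set.ofPred_or]
  refine (measureReal_union_le _ _).trans ?_
  have := measureReal_union_le (μ := P) {ω | ¬ ∀ u, |(Matrix.of (D.X ω))ᵀ *ᵥ D.eps ω ⬝ᵥ u| ≤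
        M.lam K σ * √(M.s : ℝ) / 4 * atomicNorm M.group M.s M.sg u}
    {ω | ¬ ∀ i, ∃ m, M.Feasible (M.alpha K σ) (M.gam K σ) (D.X ω) i m}
  linarith

end Decomposition

/-! ### The conditional law of the noise term -/

section ConditionalLaw

lemma charFun_map_pi_gaussianReal {n : ℕ} (v : NNReal) (a : Fin n → ℝ) :
    ∫ e, Complex.exp ((a ⬝ᵥ e : ℝ) * Complex.I)
      ∂(Measure.pi fun _ : Fin n => gaussianReal 0 v) =
      Complex.exp (-(v * (∑ k, a k ^ 2) / 2 : ℝ)) := by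
  have h := charFun_pi (μ := fun _ : Fin n => gaussianReal 0 v) (WithLp.toLp 2 a)
  rw [charFun_apply, integral_map (by fun_prop) (by fun_prop)] at h
  simp_rw [charFun_gaussianReal, ← Complex.exp_sum] at h
  convert h using 2
  · ext e
    congr 3
  · simp [Finset.mul_sum, Finset.sum_div]

lemma map_dotProduct_pi_gaussianReal {n : ℕ} (v : NNReal) {a : Fin n → ℝ}
    (ha : ∑ k, a k ^ 2 = 1) :
    (Measure.pi fun _ : Fin n => gaussianReal 0 v).map (fun e => a ⬝ᵥ e) = gaussianReal 0 v := by
  have hm : Measurable fun e : Fin n → ℝ => a ⬝ᵥ e := measurable_dotProduct measurable_const measurable_id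
  have := Measure.isProbabilityMeasure_map (μ := Measure.pi fun _ : Fin n => gaussianReal 0 v)
    hm.aemeasurable
  refine Measure.ext_of_charFun (funext fun t => ?_)
  rw [charFun_apply_real, integral_map hm.aemeasurable (by fun_prop), charFun_gaussianReal]
  have h := charFun_map_pi_gaussianReal v (t • a)
  simp only [smul_dotProduct, smul_eq_mul, Pi.smul_apply, mul_pow, ← Finset.mul_sum, ha] at h
  push_cast at h ⊢
  rw [h]
  congr 1
  simp

variable {Ω : Type*} {M : Problem} {D : Sample M Ω} {κ σ : ℝ}

lemma covMat_posSemidef (x : Fin M.n → Fin M.p → ℝ) : (D.covMat σ x).PosSemidef := by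
  refine Matrix.PosSemidef.smul ?_ (sq_nonneg σ)
  have h1 : (M.sampleCov x).PosSemidef := by
    refine Matrix.PosSemidef.of_dotProduct_mulVec_nonneg ?_ fun u => ?_
    · rw [Matrix.IsHermitian, Matrix.conjTranspose_eq_transpose_of_trivial, sampleCov_transpose]
    · rw [star_trivial, dotProduct_sampleCov_mulVec]
      exact mul_nonneg (by positivity) (Finset.sum_nonneg fun k _ => mul_self_nonneg _)
  have := h1.mul_mul_conjTranspose_same (Matrix.of (D.Mhat x))
  rwa [Matrix.conjTranspose_eq_transpose_of_trivial] at this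

lemma dotProduct_covMat_mulVec (x : Fin M.n → Fin M.p → ℝ) (t : Fin M.p → ℝ) :
    t ⬝ᵥ D.covMat σ x *ᵥ t = σ ^ 2 * ∑ k, ((√(M.n : ℝ))⁻¹ *
      (((Matrix.of (D.Mhat x))ᵀ *ᵥ t) ⬝ᵥ x k)) ^ 2 := by
  rw [Sample.covMat, Matrix.smul_mulVec, dotProduct_smul, smul_eq_mul, ← Matrix.mulVec_mulVec,
    ← Matrix.mulVec_mulVec, Matrix.dotProduct_mulVec, ← Matrix.mulVec_transpose,
    dotProduct_sampleCov_mulVec, Finset.mul_sum]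
  congr 1
  refine Finset.sum_congr rfl fun k _ => ?_
  rw [mul_pow, inv_pow, Real.sq_sqrt (Nat.cast_nonneg _)]
  ring

/-- For a frozen design the noise term is linear in `ε`, so its characteristic function is the
exponential of a sum of squares, identified by `dotProduct_covMat_mulVec`. The covariance may be
singular. -/
lemma map_noiseTerm_eq_multivariateGaussian (x : Fin M.n → Fin M.p → ℝ) :
    (Measure.pi fun _ : Fin M.n => gaussianReal 0 (σ ^ 2).toNNReal).map
      (fun e => (WithLp.toLp 2 (noiseTerm D (x, e)) : EuclideanSpace ℝ (Fin M.p))) =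
      multivariateGaussian 0 (D.covMat σ x) := by
  have hm : Measurable fun e : Fin M.n → ℝ =>
      (WithLp.toLp 2 (noiseTerm D (x, e)) : EuclideanSpace ℝ (Fin M.p)) := by
    refine (by fun_prop : Measurable (WithLp.toLp 2 : (Fin M.p → ℝ) → _)).comp
      (measurable_pi_iff.2 fun i => ?_)
    simp_rw [noiseTerm_apply]
    exact measurable_const.mul (measurable_dotProduct measurable_const measurable_id)
  have := Measure.isProbabilityMeasure_map
    (μ := Measure.pi fun _ : Fin M.n => gaussianReal 0 (σ ^ 2).toNNReal) hm.aemeasurable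
  refine Measure.ext_of_charFun (funext fun t => ?_)
  rw [charFun_multivariateGaussian (covMat_posSemidef x), dotProduct_covMat_mulVec, charFun_apply,
    integral_map hm.aemeasurable (by fun_prop)]
  have hin : ∀ e : Fin M.n → ℝ, inner ℝ (WithLp.toLp 2 (noiseTerm D (x, e))) t =
      (fun k => (√(M.n : ℝ))⁻¹ * (((Matrix.of (D.Mhat x))ᵀ *ᵥ t.ofLp) ⬝ᵥ x k)) ⬝ᵥ e := by
    intro e
    have e1 : inner ℝ (WithLp.toLp 2 (noiseTerm D (x, e))) t = t.ofLp ⬝ᵥ noiseTerm D (x, e) := by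
      rw [PiLp.inner_apply, dotProduct]
      exact Finset.sum_congr rfl fun i _ => by simp
    have e2 : (fun k => (√(M.n : ℝ))⁻¹ * (((Matrix.of (D.Mhat x))ᵀ *ᵥ t.ofLp) ⬝ᵥ x k)) =
        (√(M.n : ℝ))⁻¹ • fun k => ((Matrix.of (D.Mhat x))ᵀ *ᵥ t.ofLp) ⬝ᵥ x k := rfl
    rw [e1, e2, smul_dotProduct, ← transpose_mulVec_dotProduct, noiseTerm, dotProduct_smul,
      Matrix.dotProduct_mulVec t.ofLp, ← Matrix.mulVec_transpose]
  simp_rw [hin]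
  rw [charFun_map_pi_gaussianReal]
  congr 1
  simp [Real.coe_toNNReal _ (sq_nonneg σ)]

variable [MeasurableSpace Ω] {P : Measure Ω}

lemma map_prodMk_eq_prod [IsProbabilityMeasure P] (hX : Measurable D.X)
    (hε : D.GaussianNoise P σ) :
    P.map (fun ω => (D.X ω, D.eps ω)) = (P.map D.X).prod
      (Measure.pi fun _ : Fin M.n => gaussianReal 0 (σ ^ 2).toNNReal) := by
  have hεm : ∀ k, Measurable fun ω => D.eps ω k := fun k =>
    (measurable_pi_apply k).comp hε.measurable
  have hE := (iIndepFun_iff_map_fun_eq_pi_map fun k => (hεm k).aemeasurable).1 hε.indep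
  simp_rw [hε.law] at hE
  rw [← hE]
  exact (indepFun_iff_map_prod_eq_prod_map_map hX.aemeasurable
    hε.measurable.aemeasurable).1 hε.indep_design

/-- By independence the joint law of `(X, ε)` is a product, so the kernel sending `x` to the law of
the noise term at the frozen design `x` disintegrates the joint law of design and noise term;
conditional distributions are almost surely unique. -/
lemma condGaussian_noiseTerm [IsProbabilityMeasure P] (hX : Measurable D.X)
    (hM : Measurable D.Mhat) (hε : D.GaussianNoise P σ) :
    D.CondGaussian P σ fun ω => noiseTerm D (D.X ω, D.eps ω) := by
  set ν := Measure.pi fun _ : Fin M.n => gaussianReal 0 (σ ^ 2).toNNReal with hν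
  let F : (Fin M.n → Fin M.p → ℝ) × (Fin M.n → ℝ) → EuclideanSpace ℝ (Fin M.p) :=
    fun z => WithLp.toLp 2 (noiseTerm D z)
  have hF : Measurable F := (by fun_prop : Measurable (WithLp.toLp 2 : (Fin M.p → ℝ) → _)).comp
    (measurable_noiseTerm hM)
  let k : Kernel (Fin M.n → Fin M.p → ℝ) (EuclideanSpace ℝ (Fin M.p)) :=
    (Kernel.id ×ₖ Kernel.const _ ν).map F
  have hk : ∀ x, k x = ν.map fun e => F (x, e) := by
    intro x
    rw [Kernel.map_apply _ hF, Kernel.prod_apply, Kernel.id_apply, Kernel.const_apply,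
      Measure.dirac_prod, Measure.map_map hF measurable_prodMk_left]
    rfl
  have : IsMarkovKernel k := Kernel.IsMarkovKernel.map _ hF
  have hprob : IsProbabilityMeasure (P.map D.X) :=
    Measure.isProbabilityMeasure_map hX.aemeasurable
  have key : condDistrib (fun ω => F (D.X ω, D.eps ω)) D.X P =ᵐ[P.map D.X] k := by
    refine condDistrib_ae_eq_of_measure_eq_compProd D.X
      (hF.comp (hX.prodMk hε.measurable)).aemeasurable ?_
    have hG : Measurable fun z : (Fin M.n → Fin M.p → ℝ) × (Fin M.n → ℝ) => (z.1, F z) :=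
      measurable_fst.prodMk hF
    change P.map ((fun z => (z.1, F z)) ∘ fun ω => (D.X ω, D.eps ω)) = _
    rw [← Measure.map_map hG (hX.prodMk hε.measurable), map_prodMk_eq_prod hX hε]
    ext s hs
    rw [Measure.map_apply hG hs, Measure.prod_apply (hG hs), Measure.compProd_apply hs]
    refine lintegral_congr fun x => ?_
    have hFx : Measurable fun e => F (x, e) := hF.comp measurable_prodMk_left
    rw [hk x, Measure.map_apply hFx (measurable_prodMk_left hs)]
    rfl
  filter_upwards [key] with x hx
  rw [hx, hk x]
  exact map_noiseTerm_eq_multivariateGaussian x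

end ConditionalLaw

/-! ### Convergence in distribution along varying probability spaces -/

section Slutsky

/-- Slutsky's theorem concerns variables on one space. Lifting all of them to the product of the
spaces `Ω k` preserves each law and each deviation probability, and convergence in distribution
depends on the laws only. -/
lemma tendstoInDistribution_of_approx {Ω : ℕ → Type*} [∀ k, MeasurableSpace (Ω k)]
    {P : ∀ k, Measure (Ω k)} [∀ k, IsProbabilityMeasure (P k)] {S G : ∀ k, Ω k → ℝ}
    {μ : Measure ℝ} [IsProbabilityMeasure μ] (hS : ∀ k, Measurable (S k))
    (hG : ∀ k, Measurable (G k)) (hlaw : ∀ᶠ k in atTop, (P k).map (G k) = μ)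
    (h : ∀ ε > 0, Tendsto (fun k => (P k).real {ω | ε ≤ |S k ω - G k ω|}) atTop (𝓝 0)) :
    TendstoInDistribution S atTop (id : ℝ → ℝ) P μ := by
  have hev : ∀ k, MeasurePreserving (Function.eval k) (Measure.infinitePi P) (P k) :=
    measurePreserving_eval_infinitePi P
  have hmap : ∀ (F : ∀ k, Ω k → ℝ), (∀ k, Measurable (F k)) → ∀ k,
      (Measure.infinitePi P).map (fun ω => F k (ω k)) = (P k).map (F k) := by
    intro F hF k
    rw [← (hev k).map_eq, Measure.map_map (hF k) (hev k).measurable]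
    rfl
  have hSm : ∀ k, AEMeasurable (fun ω : ∀ k, Ω k => S k (ω k)) (Measure.infinitePi P) :=
    fun k => ((hS k).comp (measurable_pi_apply k)).aemeasurable
  have hGm : ∀ k, AEMeasurable (fun ω : ∀ k, Ω k => G k (ω k)) (Measure.infinitePi P) :=
    fun k => ((hG k).comp (measurable_pi_apply k)).aemeasurable
  have hGt : TendstoInDistribution (fun k (ω : ∀ k, Ω k) => G k (ω k)) atTop (id : ℝ → ℝ)
      (fun _ => Measure.infinitePi P) μ := by
    refine ⟨hGm, measurable_id.aemeasurable, ?_⟩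
    refine tendsto_const_nhds.congr' ?_
    filter_upwards [hlaw] with k hk
    refine Subtype.ext ?_
    change μ.map id = (Measure.infinitePi P).map fun ω => G k (ω k)
    rw [hmap G hG k, hk, Measure.map_id]
  have hSt : TendstoInDistribution (fun k (ω : ∀ k, Ω k) => S k (ω k)) atTop (id : ℝ → ℝ)
      (fun _ => Measure.infinitePi P) μ := by
    refine tendstoInDistribution_of_tendstoInMeasure_sub _ _ hGt ?_ hSm
    rw [tendstoInMeasure_iff_measureReal_norm]
    intro ε hε
    refine (h ε hε).congr fun k => ?_
    have hms : MeasurableSet {ω | ε ≤ |S k ω - G k ω|} :=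
      measurableSet_le measurable_const ((hS k).sub (hG k)).abs
    rw [← (hev k).measureReal_preimage hms.nullMeasurableSet]
    simp [Set.preimage_ofPred_eq]
  refine ⟨fun k => (hS k).aemeasurable, measurable_id.aemeasurable, ?_⟩
  refine hSt.tendsto.congr fun k => Subtype.ext ?_
  exact hmap S hS k

end Slutsky

/-! ### The exceptional event for a single coordinate -/

section SingleCoordinate

variable {Ω : Type*} [MeasurableSpace Ω] {P : Measure Ω} {M : Problem} {D : Sample M Ω}
  {κ σ c K : ℝ}

/-- The variance proxy `m̂_iᵀ Σ̂ m̂_i`. -/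
noncomputable def varianceProxy (D : Sample M Ω) (i : Fin M.p) (ω : Ω) : ℝ :=
  D.Mhat (D.X ω) i ⬝ᵥ M.sampleCov (D.X ω) *ᵥ D.Mhat (D.X ω) i

lemma atomicNorm_single_le (hsp : IsSparse M.group M.s M.sg M.beta) (i : Fin M.p) :
    atomicNorm M.group M.s M.sg (Pi.single i 1) ≤ 3 := by
  rw [atomicNorm, mixedNorm, norm1_single, normOneTwo_single, norm2_single]
  have h1 : 1 ≤ √(M.s : ℝ) := Real.one_le_sqrt.2 (one_le_s hsp)
  have h2 : 1 ≤ √(M.sg : ℝ) := Real.one_le_sqrt.2 (by exact_mod_cast hsp.sg_pos)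
  have h3 := div_le_one_of_le₀ h1 (by positivity)
  have h4 := div_le_one_of_le₀ h2 (by positivity)
  linarith

lemma rate_facts (hsp : IsSparse M.group M.s M.sg M.beta) {N : ℝ} (hN : 0 < N)
    (h : N ≤ √(M.n : ℝ) / M.rate') :
    0 < M.n ∧ N ≤ √(M.n : ℝ) ∧ N * M.rate ≤ √(M.n : ℝ) ∧ N ^ 2 * M.rate ≤ M.n := by
  have h1 := one_le_rate hsp
  have h2 := h1.trans (rate_le_rate' hsp)
  have h3 := rate_le_rate' hsp
  rw [le_div_iff₀ (by linarith)] at h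
  have h4 : N * M.rate ≤ √(M.n : ℝ) := le_trans (by gcongr) h
  have h5 : N ≤ √(M.n : ℝ) := le_trans (le_mul_of_one_le_right hN.le h1) h4
  have h6 : 0 < √(M.n : ℝ) := hN.trans_le h5
  refine ⟨by exact_mod_cast Real.sqrt_pos.1 h6, h5, h4, ?_⟩
  have h7 : (N * M.rate) ^ 2 ≤ √(M.n : ℝ) ^ 2 := pow_le_pow_left₀ (by positivity) h4 2
  rw [Real.sq_sqrt (Nat.cast_nonneg _)] at h7
  refine le_trans ?_ h7
  rw [mul_pow]
  have : M.rate ≤ M.rate ^ 2 := by nlinarith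
  gcongr

/-- Since `s_g ≤ s`, `α ≤ γ`, and `γ = K √(L/(s_g n)) ≤ K L/√n ≤ K/N ≤ 1/4`. -/
lemma alpha_add_gam_le (hsp : IsSparse M.group M.s M.sg M.beta) (hσ : 0 < σ) (hK : 0 < K) {N : ℝ}
    (hN : 0 < N) (hKN : 4 * K ≤ N) (h : N ≤ √(M.n : ℝ) / M.rate') :
    M.alpha K σ + M.gam K σ ≤ 1 / 2 := by
  obtain ⟨hn, h1, h2, h3⟩ := rate_facts hsp hN h
  have hn' : (0 : ℝ) < M.n := by exact_mod_cast hn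
  have hsg1 : (1 : ℝ) ≤ M.sg := by exact_mod_cast hsp.sg_pos
  have hss : (M.sg : ℝ) ≤ M.s := by exact_mod_cast hsp.sg_le_s
  have hr := one_le_rate hsp
  have hs0 : 0 < √(M.n : ℝ) := hN.trans_le h1
  have hg : M.gam K σ ≤ 1 / 4 := by
    rw [gam_eq hsp hσ hK.le hn]
    have e1 : √(M.rate / (M.sg * M.n)) ≤ M.rate / √(M.n : ℝ) := by
      refine Real.sqrt_le_iff.2 ⟨by positivity, ?_⟩
      rw [div_pow, Real.sq_sqrt hn'.le]
      have : M.rate ≤ M.rate ^ 2 := by nlinarith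
      gcongr
      nlinarith
    have e2 : M.rate / √(M.n : ℝ) ≤ 1 / N := by
      rw [div_le_div_iff₀ hs0 hN]; linarith
    calc K * √(M.rate / (M.sg * M.n)) ≤ K * (1 / N) := by gcongr; exact e1.trans e2
      _ ≤ 1 / 4 := by rw [mul_one_div, div_le_div_iff₀ hN (by norm_num)]; linarith
  have ha : M.alpha K σ ≤ M.gam K σ := by
    rw [Problem.gam, Problem.alpha]
    refine le_mul_of_one_le_left ?_ (Real.one_le_sqrt.2 ((one_le_div (by linarith)).2 hss))
    have := lam_nonneg (M := M) hK.le hσ.le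
    positivity
  linarith

/-- The exceptional event when the rate is large relative to the sparsity. -/
lemma measure_exceptional_le_exp [IsProbabilityMeasure P] (hσ : 0 < σ) (hK : tuningConst κ ≤ K)
    (hA : D.Assumptions P κ σ c K) (i : Fin M.p) {N η : ℝ} (hN : 0 < N)
    (h : N ≤ √(M.n : ℝ) / M.rate') (hN1 : sampleConst κ ≤ N ^ 2) (hN2 : 4 * K ≤ N)
    (hN3 : 122 * K ^ 2 * σ ≤ N * η) :
    P.real {ω | ¬ (1 / 16 ≤ varianceProxy D i ω ∧ |remainder D ω i| ≤ η)} ≤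
      6 * Real.exp (-M.rate / M.s) := by
  have hK0 : 0 < K := (tuningConst_pos κ).trans_le hK
  have hsp := hA.sparse
  obtain ⟨hn, h1, h2, h3⟩ := rate_facts hsp hN h
  have hr := one_le_rate hsp
  have hs0 : 0 < √(M.n : ℝ) := hN.trans_le h1
  refine le_trans (measureReal_mono ?_) (measure_not_good_le hσ hK hA hn
    (le_trans (by gcongr) h3))
  intro ω hω hgood
  obtain ⟨g1, g2, g3⟩ := hgood
  refine hω ⟨?_, ?_⟩
  · refine one_sixteenth_le_of_feasible (alpha_nonneg hσ hK0.le)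
      (alpha_add_gam_le hsp hσ hK0 hN hN2 h) hn (hA.Mhat_spec _ i (g3 i)).1 ?_
    have e1 := (abs_le.1 (g1 (Pi.single i 1))).2
    have e2 := quadraticForm_single_le hA.design i
    have e3 := pow_le_pow_left₀ (atomicNorm_nonneg (g := M.group) M.s M.sg (Pi.single i 1))
      (atomicNorm_single_le hsp i) 2
    linarith
  · refine (abs_remainder_le hσ hK0 hn hA g1 g2 g3 i).trans ?_
    rw [div_mul_eq_mul_div, div_le_iff₀ hs0]
    have hη : 0 ≤ η := by
      by_contra! hlt
      have : N * η < 0 := mul_neg_of_pos_of_neg hN hlt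
      have : 0 ≤ 122 * K ^ 2 * σ := by positivity
      linarith
    calc 122 * K ^ 2 * M.rate * σ = 122 * K ^ 2 * σ * M.rate := by ring
      _ ≤ N * η * M.rate := by gcongr
      _ = η * (N * M.rate) := by ring
      _ ≤ _ := by gcongr

/-! ### Estimates in bounded dimension. -/

lemma norm1_le_sqrt_mul_norm2 {p : ℕ} (u : Fin p → ℝ) : norm1 u ≤ √(p : ℝ) * norm2 u :=
  sum_abs_le_sqrt_card_mul Finset.univ u (norm2_nonneg u) (norm2_sq u).ge (by simp)

lemma normOneTwo_le_sqrt_mul_norm2 {p d : ℕ} (g : Fin p → Fin d) (u : Fin p → ℝ) :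
    normOneTwo g u ≤ √(d : ℝ) * norm2 u := by
  have h := sum_abs_le_sqrt_card_mul Finset.univ (groupNorm g u) (norm2_nonneg u)
    (sum_groupNorm_sq u).le (s := d) (by simp)
  simp_rw [abs_of_nonneg (groupNorm_nonneg (g := g) u _)] at h
  exact h

lemma abs_quadraticForm_le_norm1_sq {p : ℕ} {A : Matrix (Fin p) (Fin p) ℝ} {τ : ℝ}
    (hA : ∀ k l, |A k l| ≤ τ) (u : Fin p → ℝ) : |u ⬝ᵥ A *ᵥ u| ≤ τ * norm1 u ^ 2 := by
  have h1 : ∀ k, |(A *ᵥ u) k| ≤ τ * norm1 u := by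
    intro k
    rw [Matrix.mulVec, norm1, Finset.mul_sum]
    refine (Finset.abs_sum_le_sum_abs _ _).trans (Finset.sum_le_sum fun l _ => ?_)
    rw [abs_mul]
    exact mul_le_mul_of_nonneg_right (hA k l) (abs_nonneg _)
  calc |u ⬝ᵥ A *ᵥ u| ≤ ∑ k, |u k * (A *ᵥ u) k| := Finset.abs_sum_le_sum_abs _ _
    _ ≤ ∑ k, |u k| * (τ * norm1 u) := by
      refine Finset.sum_le_sum fun k _ => ?_
      rw [abs_mul]
      exact mul_le_mul_of_nonneg_left (h1 k) (abs_nonneg _)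
    _ = _ := by rw [← Finset.sum_mul, ← norm1]; ring

lemma abs_dotProduct_le_norm1 {p : ℕ} {v : Fin p → ℝ} {τ : ℝ} (hv : ∀ k, |v k| ≤ τ)
    (u : Fin p → ℝ) : |v ⬝ᵥ u| ≤ τ * norm1 u := by
  rw [norm1, Finset.mul_sum]
  refine (Finset.abs_sum_le_sum_abs _ _).trans (Finset.sum_le_sum fun k _ => ?_)
  rw [abs_mul]
  exact mul_le_mul_of_nonneg_right (hv k) (abs_nonneg _)

/-- A row is feasible once the sample covariance matrix is invertible. -/
lemma exists_feasible_of_pos {x : Fin M.n → Fin M.p → ℝ} {al ga : ℝ} (hga : 0 ≤ ga)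
    (hpos : ∀ u, u ≠ 0 → 0 < u ⬝ᵥ M.sampleCov x *ᵥ u) (i : Fin M.p) :
    ∃ m, M.Feasible al ga x i m := by
  have hpd : (M.sampleCov x).PosDef := by
    refine Matrix.PosDef.of_dotProduct_mulVec_pos ?_ fun u hu => ?_
    · rw [Matrix.IsHermitian, Matrix.conjTranspose_eq_transpose_of_trivial, sampleCov_transpose]
    · rw [star_trivial]; exact hpos u hu
  have hdet := (Matrix.isUnit_iff_isUnit_det _).1 hpd.isUnit
  refine ⟨(M.sampleCov x)⁻¹ *ᵥ Pi.single i 1, ?_⟩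
  have e : M.sampleCov x *ᵥ ((M.sampleCov x)⁻¹ *ᵥ Pi.single i 1) = Pi.single i 1 := by
    rw [Matrix.mulVec_mulVec, Matrix.mul_nonsing_inv _ hdet, Matrix.one_mulVec]
  refine normInfTwo_le hga fun j => ?_
  rw [e, groupNorm, Finset.sum_eq_zero, Real.sqrt_zero]
  · exact hga
  · intro l _
    simp [softThreshold]

/-- Deterministic bounds in fixed dimension. -/
lemma fixed_dimension_bounds (hσ : 0 < σ) (hK : 0 < K) (hA : D.Assumptions P κ σ c K)
    (i : Fin M.p) {B R N η : ℝ} (hB : 1 ≤ B) (hp : (M.p : ℝ) ≤ B) (hd : (M.d : ℝ) ≤ B)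
    (hR : 0 ≤ R) (hN : 0 < N) (h : N ≤ √(M.n : ℝ) / M.rate') (hN2 : 4 * K ≤ N)
    (hN3 : 6 * K * σ * √B * (2 * √B * R + 4 * K) ≤ N * η) {ω : Ω}
    (h1 : ∀ k l, |(M.sampleCov (D.X ω) - M.Sig) k l| ≤ 1 / (3 * B))
    (h2 : ∀ k, |((Matrix.of (D.X ω))ᵀ *ᵥ D.eps ω) k| ≤ M.n * (R / √(M.n : ℝ)) * σ) :
    1 / 16 ≤ varianceProxy D i ω ∧ |remainder D ω i| ≤ η := by
  have hsp := hA.sparse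
  obtain ⟨hn, f1, f2, f3⟩ := rate_facts hsp hN h
  have hn' : (0 : ℝ) < M.n := by exact_mod_cast hn
  have hr := one_le_rate hsp
  have hs0 : 0 < √(M.n : ℝ) := hN.trans_le f1
  have hB0 : 0 < B := by linarith
  have hsB : 0 ≤ √B := Real.sqrt_nonneg B
  have hn1 : ∀ u : Fin M.p → ℝ, norm1 u ≤ √B * norm2 u := fun u =>
    (norm1_le_sqrt_mul_norm2 u).trans
      (mul_le_mul_of_nonneg_right (Real.sqrt_le_sqrt hp) (norm2_nonneg u))
  have hn12 : ∀ u : Fin M.p → ℝ, normOneTwo M.group u ≤ √B * norm2 u := fun u =>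
    (normOneTwo_le_sqrt_mul_norm2 M.group u).trans
      (mul_le_mul_of_nonneg_right (Real.sqrt_le_sqrt hd) (norm2_nonneg u))
  -- Entrywise error `1/(3B)` and `‖u‖₁² ≤ B‖u‖₂²` give error `1/3`, which leaves `Σ̂` bounded below
  -- by `1/3`.
  have hdiff : ∀ u, |u ⬝ᵥ M.sampleCov (D.X ω) *ᵥ u - u ⬝ᵥ M.Sig *ᵥ u| ≤ 1 / 3 * norm2 u ^ 2 := by
    intro u
    rw [← dotProduct_sub, ← Matrix.sub_mulVec]
    refine (abs_quadraticForm_le_norm1_sq h1 u).trans ?_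
    have := pow_le_pow_left₀ (norm1_nonneg u) (hn1 u) 2
    rw [mul_pow, Real.sq_sqrt hB0.le] at this
    calc 1 / (3 * B) * norm1 u ^ 2 ≤ 1 / (3 * B) * (B * norm2 u ^ 2) := by gcongr
      _ = _ := by field_simp
  have hlow : ∀ u, 1 / 3 * norm2 u ^ 2 ≤ u ⬝ᵥ M.sampleCov (D.X ω) *ᵥ u := by
    intro u
    have := (abs_le.1 (hdiff u)).1
    have := (quadraticForm_Sig_bounds hA.design u).1
    linarith
  have hF := exists_feasible_of_pos (al := M.alpha K σ)
    (by have := gam_eq hsp hσ hK.le hn; rw [this]; positivity : 0 ≤ M.gam K σ)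
    (fun u hu => (by have := norm2_pos hu; positivity :
      0 < 1 / 3 * norm2 u ^ 2).trans_le (hlow u)) i
  have hm := (hA.Mhat_spec _ i hF).1
  refine ⟨?_, ?_⟩
  · refine one_sixteenth_le_of_feasible (alpha_nonneg hσ hK.le)
      (alpha_add_gam_le hsp hσ hK hN hN2 h) hn hm ?_
    have e1 := (abs_le.1 (hdiff (Pi.single i 1))).2
    have e2 := quadraticForm_single_le hA.design i
    rw [norm2_single] at e1
    linarith
  · set u := D.betaHat ω - M.beta with hu
    have hb := isSGLasso_sparse_inequality hK.le hσ.le hsp (hA.betaHat_spec ω)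
    rw [← hu, norm2_mulVec_sq _ hn, lam_mul_sqrt (s_pos_of_isSparse hsp)] at hb
    have e1 := (le_abs_self _).trans (abs_dotProduct_le_norm1 h2 u)
    have e2 := hlow u
    have e3 := abs_sub_le_of_feasible (alpha_nonneg hσ hK.le) hm u
    rw [alpha_mul_norm1_add hsp.sg_pos (s_pos_of_isSparse hsp), lam_mul_sqrt (s_pos_of_isSparse hsp)] at e3
    have hrn : √(M.rate * M.n) = √M.rate * √(M.n : ℝ) := Real.sqrt_mul (by linarith) _
    have ha1 : 1 ≤ √M.rate := Real.one_le_sqrt.2 hr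
    have ha2 : √M.rate * √M.rate = M.rate := Real.mul_self_sqrt (by linarith)
    have hr2 : √(M.n : ℝ) * √(M.n : ℝ) = M.n := Real.mul_self_sqrt hn'.le
    rw [hrn] at hb e3
    set a := √M.rate
    set r := √(M.n : ℝ)
    rw [← hr2] at hb e1 e3
    set Q := 2 * √B * R + 4 * K with hQ
    have hQ0 : 0 < Q := by positivity
    have hmix0 := mixedNorm_nonneg (g := M.group) M.s M.sg u
    have hu0 := norm2_nonneg u
    have hmix : mixedNorm M.group M.s M.sg u ≤ 2 * √B * norm2 u := by
      have t1 := div_le_self (norm1_nonneg u) (Real.one_le_sqrt.2 (one_le_s hsp))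
      have t2 := div_le_self (normOneTwo_nonneg (g := M.group) u)
        (Real.one_le_sqrt.2 (by exact_mod_cast hsp.sg_pos : (1 : ℝ) ≤ M.sg))
      rw [mixedNorm]
      linarith [hn1 u, hn12 u]
    have hX : (Matrix.of (D.X ω))ᵀ *ᵥ D.eps ω ⬝ᵥ u ≤ R * r * σ * (√B * norm2 u) := by
      refine e1.trans ?_
      have : r * r * (R / r) * σ = R * r * σ := by field_simp
      rw [this]
      exact mul_le_mul_of_nonneg_left (hn1 u) (by positivity)
    -- From the sparse basic inequality, dropping the negative `mixedNorm` term and using `a = √L ≥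
    -- 1` to put the noise and penalty terms on the same scale.
    have hl2 : r * norm2 u ≤ 3 * (σ * a * Q) := by
      rcases hu0.eq_or_lt with h0 | h0
      · rw [← h0, mul_zero]; positivity
      have t1 : R * r * σ * (√B * norm2 u) ≤ a * (R * r * σ * (√B * norm2 u)) :=
        le_mul_of_one_le_left (by positivity) ha1
      have t2 : 0 ≤ K * σ * (a * r) * mixedNorm M.group M.s M.sg u := by positivity
      have t3 : r * r * (1 / 3 * norm2 u ^ 2) ≤ r * r * (u ⬝ᵥ M.sampleCov (D.X ω) *ᵥ u) := by
        gcongr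
      have t4 : (r * norm2 u) * (r * norm2 u) ≤ (r * norm2 u) * (3 * (σ * a * Q)) := by
        rw [hQ]; linarith
      exact le_of_mul_le_mul_left t4 (by positivity)
    refine le_of_mul_le_mul_left ?_ hs0
    have hηN : 0 ≤ N * η := le_trans (by positivity) hN3
    have hη : 0 ≤ η := nonneg_of_mul_nonneg_right hηN hN
    rw [remainder, abs_mul, abs_of_nonneg (Real.sqrt_nonneg _)]
    calc _ ≤ r * (r * (K * σ * (a * r) / (r * r * σ) * (2 * √B * norm2 u))) := by
          refine mul_le_mul_of_nonneg_left (mul_le_mul_of_nonneg_left (e3.trans ?_) hs0.le) hs0.le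
          exact mul_le_mul_of_nonneg_left hmix (by positivity)
      _ = 2 * K * a * √B * (r * norm2 u) := by field_simp
      _ ≤ 2 * K * a * √B * (3 * (σ * a * Q)) := by gcongr
      _ = 6 * K * σ * √B * Q * (a * a) := by ring
      _ ≤ N * η * M.rate := by rw [ha2]; gcongr
      _ = η * (N * M.rate) := by ring
      _ ≤ η * r := by gcongr
      _ = r * η := mul_comm _ _

/-- The exceptional event in fixed dimension. -/
lemma measure_exceptional_le_of_dimension_le [IsProbabilityMeasure P] (hσ : 0 < σ) (hK : 0 < K)
    (hA : D.Assumptions P κ σ c K) (i : Fin M.p) {B R N η : ℝ} (hB : 1 ≤ B) (hp : (M.p : ℝ) ≤ B)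
    (hd : (M.d : ℝ) ≤ B) (hR : 0 ≤ R) (hRN : R ≤ N) (hN : 0 < N)
    (h : N ≤ √(M.n : ℝ) / M.rate') (hN2 : 4 * K ≤ N)
    (hN3 : 6 * K * σ * √B * (2 * √B * R + 4 * K) ≤ N * η) :
    P.real {ω | ¬ (1 / 16 ≤ varianceProxy D i ω ∧ |remainder D ω i| ≤ η)} ≤
      B ^ 2 * (2 * Real.exp (-(bernsteinRate κ * N ^ 2 * (1 / (3 * B)) ^ 2))) +
        B * (2 * Real.exp (-(bernsteinRate κ * R ^ 2))) := by
  have hsp := hA.sparse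
  obtain ⟨hn, f1, -, -⟩ := rate_facts hsp hN h
  have hn' : (0 : ℝ) < M.n := by exact_mod_cast hn
  have hs0 : 0 < √(M.n : ℝ) := hN.trans_le f1
  have hq := bernsteinRate_pos κ
  have hnN : N ^ 2 ≤ M.n := by
    have := pow_le_pow_left₀ hN.le f1 2
    rwa [Real.sq_sqrt hn'.le] at this
  have hent : ∀ a ∈ (Finset.univ : Finset (Fin M.p × Fin M.p)),
      P.real {ω | 1 / (3 * B) ≤ |(M.sampleCov (D.X ω) - M.Sig) a.1 a.2|} ≤
        2 * Real.exp (-(bernsteinRate κ * N ^ 2 * (1 / (3 * B)) ^ 2)) := by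
    rintro ⟨k, l⟩ -
    have e : ∀ A : Matrix (Fin M.p) (Fin M.p) ℝ,
        (Pi.single k 1 : Fin M.p → ℝ) ⬝ᵥ A *ᵥ Pi.single l 1 = A k l := by intro A; simp
    have key := measure_abs_sampleCov_sub_ge_le hA.design hn (quadraticForm_single_le hA.design k)
      (quadraticForm_single_le hA.design l) (t := 1 / (3 * B)) (by positivity)
      (by rw [div_le_one (by positivity)]; linarith)
    simp_rw [e] at key
    refine key.trans ?_
    gcongr
  have hnoise : ∀ k ∈ (Finset.univ : Finset (Fin M.p)),
      P.real {ω | M.n * (R / √(M.n : ℝ)) * σ ≤ |((Matrix.of (D.X ω))ᵀ *ᵥ D.eps ω) k|} ≤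
        2 * Real.exp (-(bernsteinRate κ * R ^ 2)) := by
    intro k _
    have key := measure_abs_noise_ge_le hA.design hA.noise hσ (quadraticForm_single_le hA.design k)
      (t := R / √(M.n : ℝ)) (by positivity) (by rw [div_le_one hs0]; exact hRN.trans f1)
    simp_rw [single_one_dotProduct] at key
    refine key.trans (le_of_eq ?_)
    rw [div_pow, Real.sq_sqrt hn'.le]
    field_simp
  have h1 := measureReal_exists_le _ _ hent
  have h2 := measureReal_exists_le _ _ hnoise
  refine LE.le.trans (measureReal_mono ?_) ((measureReal_union_le _ _).trans
    (add_le_add (h1.trans ?_) (h2.trans ?_)))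
  · intro ω hω
    by_contra hcon
    rw [Set.mem_union, not_or] at hcon
    obtain ⟨c1, c2⟩ := hcon
    refine hω (fixed_dimension_bounds hσ hK hA i hB hp hd hR hN h hN2 hN3 (fun k l => ?_)
      fun k => ?_)
    · by_contra! hlt
      exact c1 ⟨(k, l), Finset.mem_univ _, hlt.le⟩
    · by_contra! hlt
      exact c2 ⟨k, Finset.mem_univ _, hlt.le⟩
  · rw [Finset.card_univ, Fintype.card_prod, Fintype.card_fin, Nat.cast_mul, ← pow_two]
    gcongr
  · rw [Finset.card_univ, Fintype.card_fin]
    gcongr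

/-- A small rate relative to the sparsity bounds the dimension. -/
lemma dimension_le (hsp : IsSparse M.group M.s M.sg M.beta) {B : ℝ} (h : M.rate / M.s ≤ B) :
    (M.p : ℝ) ≤ Real.exp (2 * B + B * Real.exp B) ∧
      (M.d : ℝ) ≤ Real.exp (2 * B + B * Real.exp B) := by
  have hs : (0 : ℝ) < M.s := zero_lt_one.trans_le (one_le_s hsp)
  have hsg : (1 : ℝ) ≤ M.sg := by exact_mod_cast hsp.sg_pos
  have hsg0 : (0 : ℝ) < M.sg := by linarith
  have hb : (1 : ℝ) ≤ M.b := by exact_mod_cast b_pos_of_isSparse hsp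
  have hd : (0 : ℝ) < M.d := by exact_mod_cast hsp.sg_pos.trans_le hsp.sg_le_d
  have hsb : (M.s : ℝ) ≤ M.sg * M.b := by exact_mod_cast s_le_sg_mul_b hsp
  have hpd : (M.p : ℝ) ≤ M.d * M.b := by exact_mod_cast p_le_d_mul_b (M := M)
  rw [div_le_iff₀ hs, rate_eq hsp] at h
  have l1 := log_sg_mul_b_nonneg (M := M)
  have l2 := log_d_div_sg_nonneg hsp
  -- This bounds `s_g` and `b` by `exp B`. Then `s_g log(d/s_g) ≤ B s ≤ B s_g b` bounds `d/s_g` as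
  -- well.
  have hB : Real.log (M.sg * M.b) ≤ B := by
    have : 0 ≤ M.sg * Real.log (M.d / M.sg) := by positivity
    have h' : M.s * Real.log (M.sg * M.b) ≤ M.s * B := by nlinarith
    exact le_of_mul_le_mul_left h' hs
  have hB0 : 0 ≤ B := l1.trans hB
  rw [Real.log_le_iff_le_exp (by positivity)] at hB
  have hsg' : (M.sg : ℝ) ≤ Real.exp B := (le_mul_of_one_le_right (by linarith) hb).trans hB
  have hb' : (M.b : ℝ) ≤ Real.exp B := (le_mul_of_one_le_left (by linarith) hsg).trans hB
  have hld : Real.log (M.d / M.sg) ≤ B * Real.exp B := by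
    have h1 : M.sg * Real.log (M.d / M.sg) ≤ M.sg * (B * M.b) := by
      have : 0 ≤ M.s * (1 + Real.log (M.sg * M.b)) := by positivity
      have : B * M.s ≤ B * (M.sg * M.b) := by gcongr
      linarith
    refine (le_of_mul_le_mul_left h1 hsg0).trans ?_
    gcongr
  rw [Real.log_le_iff_le_exp (by positivity), div_le_iff₀ hsg0] at hld
  have hd' : (M.d : ℝ) ≤ Real.exp (B * Real.exp B) * Real.exp B :=
    hld.trans (by gcongr)
  have e : Real.exp (2 * B + B * Real.exp B) =
      Real.exp (B * Real.exp B) * Real.exp B * Real.exp B := by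
    rw [← Real.exp_add, ← Real.exp_add]; ring_nf
  rw [e]
  refine ⟨hpd.trans (by gcongr), hd'.trans (le_mul_of_one_le_right (by positivity) ?_)⟩
  exact Real.one_le_exp hB0

end SingleCoordinate

/-! ### Combining the two regimes. -/

lemma eventually_mul_exp_neg_le {a q δ : ℝ} (hq : 0 < q) (hδ : 0 < δ) :
    ∀ᶠ t : ℝ in atTop, a * (2 * Real.exp (-(q * t ^ 2))) ≤ δ := by
  have h1 : Tendsto (fun t : ℝ => q * t ^ 2) atTop atTop :=
    (tendsto_pow_atTop two_ne_zero).const_mul_atTop hq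
  have h2 := ((Real.tendsto_exp_neg_atTop_nhds_zero.comp h1).const_mul 2).const_mul a
  rw [mul_zero, mul_zero] at h2
  exact (h2.eventually (gt_mem_nhds hδ)).mono fun t ht => ht.le

/-- Uniform control of the exceptional event. -/
lemma exists_measure_exceptional_le {κ σ K : ℝ} (c : ℝ) (hσ : 0 < σ) (hK : tuningConst κ ≤ K)
    {η : ℝ} (hη : 0 < η) :
    ∃ N : ℝ, ∀ (M : Problem) (Ω : Type*) [MeasurableSpace Ω] (P : Measure Ω)
      [IsProbabilityMeasure P] (D : Sample M Ω), D.Assumptions P κ σ c K → ∀ i : Fin M.p,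
      N ≤ √(M.n : ℝ) / M.rate' →
      P.real {ω | ¬ (1 / 16 ≤ varianceProxy D i ω ∧ |remainder D ω i| ≤ η)} ≤ η := by
  have hK0 : 0 < K := (tuningConst_pos κ).trans_le hK
  have hq := bernsteinRate_pos κ
  -- The threshold for `L/s` beyond which `6 exp(-L/s) ≤ η`. Below it the dimension is at most `B`;
  -- the noise level `R` depends on `B` and `η`, and `N` is chosen last.
  set B₀ := max 0 (Real.log (6 / η)) with hB₀
  have hB₀0 : 0 ≤ B₀ := le_max_left _ _
  set B := Real.exp (2 * B₀ + B₀ * Real.exp B₀) with hBdef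
  have hB : 1 ≤ B := Real.one_le_exp (by positivity)
  obtain ⟨R, hR, hR0⟩ := ((eventually_mul_exp_neg_le (a := B) hq (half_pos hη)).and
    (eventually_ge_atTop 0)).exists
  have hlin : ∀ a : ℝ, ∀ᶠ N : ℝ in atTop, a ≤ N * η := fun a =>
    (tendsto_id.atTop_mul_const hη).eventually_ge_atTop a
  have hq' : 0 < bernsteinRate κ * (1 / (3 * B)) ^ 2 := by positivity
  obtain ⟨N, h1, h2, h3, h4, h5, h6, h7⟩ :=
    ((eventually_mul_exp_neg_le (a := B ^ 2) hq' (half_pos hη)).and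
    ((eventually_ge_atTop R).and ((eventually_gt_atTop 0).and ((eventually_ge_atTop (4 * K)).and
    ((hlin (6 * K * σ * √B * (2 * √B * R + 4 * K))).and ((hlin (122 * K ^ 2 * σ)).and
    ((tendsto_pow_atTop (two_ne_zero)).eventually_ge_atTop (sampleConst κ)))))))).exists
  refine ⟨N, fun M Ω _ P _ D hA i hN => ?_⟩
  have hs : (0 : ℝ) < M.s := zero_lt_one.trans_le (one_le_s hA.sparse)
  -- Either `L/s` is large and the general bound suffices, or the dimension is bounded and the
  -- classical bounds apply.
  rcases le_total B₀ (M.rate / M.s) with hr | hr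
  · refine (measure_exceptional_le_exp hσ hK hA i h3 hN h7 h4 h6).trans ?_
    have e1 : Real.exp (-M.rate / M.s) ≤ Real.exp (-Real.log (6 / η)) := by
      rw [neg_div]
      exact Real.exp_le_exp.2 (neg_le_neg ((le_max_right _ _).trans hr))
    rw [Real.exp_neg, Real.exp_log (by positivity), inv_div] at e1
    linarith
  · obtain ⟨hp, hd⟩ := dimension_le hA.sparse hr
    have := measure_exceptional_le_of_dimension_le hσ hK0 hA i hB hp hd hR0 h2 h3 hN h4 h5
    have e : bernsteinRate κ * N ^ 2 * (1 / (3 * B)) ^ 2 =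
      bernsteinRate κ * (1 / (3 * B)) ^ 2 * N ^ 2 := by ring
    rw [e] at this
    linarith

/-! ### The standardized coordinate -/

section Standardized

variable {Ω : Type*} {M : Problem} {D : Sample M Ω}

/-- The vector `X m̂_i`, normalized. -/
noncomputable def direction (D : Sample M Ω) (i : Fin M.p) (x : Fin M.n → Fin M.p → ℝ) :
    Fin M.n → ℝ := fun k =>
  -- When `X m̂_i = 0` a fixed coordinate vector is substituted, so that for `n > 0` the result is
  -- always a unit vector.
  if norm2 (fun l => D.Mhat x i ⬝ᵥ x l) = 0 then (if k.val = 0 then 1 else 0)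
  else D.Mhat x i ⬝ᵥ x k / norm2 (fun l => D.Mhat x i ⬝ᵥ x l)

lemma sum_direction_sq (hn : 0 < M.n) (i : Fin M.p) (x : Fin M.n → Fin M.p → ℝ) :
    ∑ k, direction D i x k ^ 2 = 1 := by
  unfold direction
  split_ifs with h
  · rw [Finset.sum_eq_single ⟨0, hn⟩]
    · simp
    · intro k _ hk
      have : k.val ≠ 0 := fun h0 => hk (Fin.ext h0)
      simp [this]
    · simp
  · simp_rw [div_pow]
    rw [← Finset.sum_div, ← norm2_sq, div_self (pow_ne_zero _ h)]

lemma measurable_norm2 {α ι : Type*} [MeasurableSpace α] [Fintype ι] {u : α → ι → ℝ}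
    (hu : Measurable u) : Measurable fun a => norm2 (u a) :=
  (Finset.measurable_sum _ fun i _ => ((measurable_pi_apply i).comp hu).pow_const 2).sqrt

lemma measurable_direction (hM : Measurable D.Mhat) (i : Fin M.p) :
    Measurable (direction D i) := by
  have h1 : ∀ k : Fin M.n, Measurable fun x : Fin M.n → Fin M.p → ℝ => D.Mhat x i ⬝ᵥ x k :=
    fun k => measurable_row_dotProduct measurable_id (measurable_Mhat_row hM measurable_id i) k
  have h2 := measurable_norm2 (measurable_pi_iff.2 h1)
  exact measurable_pi_iff.2 fun k => Measurable.ite (h2 (measurableSet_singleton 0))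
    measurable_const ((h1 k).div h2)

lemma measurable_direction_dotProduct (hM : Measurable D.Mhat) (i : Fin M.p) :
    Measurable fun z : (Fin M.n → Fin M.p → ℝ) × (Fin M.n → ℝ) => direction D i z.1 ⬝ᵥ z.2 :=
  measurable_dotProduct ((measurable_direction hM i).comp measurable_fst) measurable_snd

lemma measurable_direction_dotProduct_eps [MeasurableSpace Ω] (hX : Measurable D.X)
    (hε : Measurable D.eps) (hM : Measurable D.Mhat) (i : Fin M.p) :
    Measurable fun ω => direction D i (D.X ω) ⬝ᵥ D.eps ω :=
  measurable_dotProduct ((measurable_direction hM i).comp hX) hε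

/-- Given the design, this is the product of a unit vector with a spherical Gaussian. The
conditional law does not depend on the design, so it is also the unconditional law. -/
lemma map_direction_dotProduct [MeasurableSpace Ω] {P : Measure Ω} [IsProbabilityMeasure P] {σ : ℝ}
    (hn : 0 < M.n) (hX : Measurable D.X) (hM : Measurable D.Mhat) (hε : D.GaussianNoise P σ)
    (i : Fin M.p) :
    P.map (fun ω => direction D i (D.X ω) ⬝ᵥ D.eps ω) = gaussianReal 0 (σ ^ 2).toNNReal := by
  have hF := measurable_direction_dotProduct hM i
  have hprob : IsProbabilityMeasure (P.map D.X) :=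
    Measure.isProbabilityMeasure_map hX.aemeasurable
  change P.map ((fun z : _ × _ => direction D i z.1 ⬝ᵥ z.2) ∘ fun ω => (D.X ω, D.eps ω)) = _
  rw [← Measure.map_map hF (hX.prodMk hε.measurable), map_prodMk_eq_prod hX hε]
  ext s hs
  rw [Measure.map_apply hF hs, Measure.prod_apply (hF hs)]
  have h : ∀ x, (Measure.pi fun _ : Fin M.n => gaussianReal 0 (σ ^ 2).toNNReal)
      (Prod.mk x ⁻¹' ((fun z : (Fin M.n → Fin M.p → ℝ) × (Fin M.n → ℝ) =>
        direction D i z.1 ⬝ᵥ z.2) ⁻¹' s)) = gaussianReal 0 (σ ^ 2).toNNReal s := by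
    intro x
    have hm : Measurable fun e : Fin M.n → ℝ => direction D i x ⬝ᵥ e :=
      measurable_dotProduct measurable_const measurable_id
    have key := map_dotProduct_pi_gaussianReal (σ ^ 2).toNNReal (sum_direction_sq (D := D) hn i x)
    rw [← key, Measure.map_apply hm hs, key]
    rfl
  simp_rw [h]
  rw [lintegral_const, measure_univ, mul_one]

lemma varianceProxy_eq (i : Fin M.p) (ω : Ω) :
    √(varianceProxy D i ω) = norm2 (fun l => D.Mhat (D.X ω) i ⬝ᵥ D.X ω l) / √(M.n : ℝ) := by
  rw [varianceProxy, dotProduct_sampleCov_mulVec, norm2, ← Real.sqrt_div' _ (Nat.cast_nonneg _),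
    one_div_mul_eq_div]
  simp_rw [pow_two]

lemma standardized_eq (hn : 0 < M.n) (i : Fin M.p) (ω : Ω) :
    D.standardized i ω =
      (remainder D ω i + noiseTerm D (D.X ω, D.eps ω) i) / √(varianceProxy D i ω) := by
  have h := congrFun (sqrt_smul_betaU_sub D hn ω) i
  simp only [Pi.smul_apply, Pi.sub_apply, Pi.add_apply, smul_eq_mul] at h
  rw [Sample.standardized, h, varianceProxy]

/-- A positive variance proxy excludes the default direction, so the standardized noise is exactly
the Gaussian variable; what is left is the remainder divided by at least `1/4`. -/
lemma abs_standardized_sub_le (hn : 0 < M.n) {i : Fin M.p} {ω : Ω} {η : ℝ}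
    (h1 : 1 / 16 ≤ varianceProxy D i ω) (h2 : |remainder D ω i| ≤ η) :
    |D.standardized i ω - direction D i (D.X ω) ⬝ᵥ D.eps ω| ≤ 4 * η := by
  have hs : 1 / 4 ≤ √(varianceProxy D i ω) := Real.le_sqrt_of_sq_le (by norm_num; linarith)
  have hs0 : 0 < √(varianceProxy D i ω) := by linarith
  have hrn : 0 < √(M.n : ℝ) := Real.sqrt_pos.2 (by exact_mod_cast hn)
  have e : noiseTerm D (D.X ω, D.eps ω) i / √(varianceProxy D i ω) =
      direction D i (D.X ω) ⬝ᵥ D.eps ω := by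
    have hne : norm2 (fun l => D.Mhat (D.X ω) i ⬝ᵥ D.X ω l) ≠ 0 := by
      intro h0
      rw [varianceProxy_eq, h0, zero_div] at hs0
      exact lt_irrefl _ hs0
    have hdir : direction D i (D.X ω) = (norm2 (fun l => D.Mhat (D.X ω) i ⬝ᵥ D.X ω l))⁻¹ •
        fun l => D.Mhat (D.X ω) i ⬝ᵥ D.X ω l := by
      ext k
      rw [direction, if_neg hne, Pi.smul_apply, smul_eq_mul, div_eq_inv_mul]
    rw [hdir, smul_dotProduct, smul_eq_mul, noiseTerm_apply, varianceProxy_eq]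
    field_simp
  rw [standardized_eq hn, add_div, e, add_sub_cancel_right, abs_div, abs_of_pos hs0,
    div_le_iff₀ hs0]
  have : 0 ≤ η := (abs_nonneg _).trans h2
  nlinarith

variable [MeasurableSpace Ω]

lemma measurable_standardized (hX : Measurable D.X) (hε : Measurable D.eps)
    (hM : Measurable D.Mhat) (hb : Measurable D.betaHat) (i : Fin M.p) :
    Measurable (D.standardized i) := by
  rcases Nat.eq_zero_or_pos M.n with hn | hn
  · have e : D.standardized i = fun _ => 0 := funext fun ω => by simp [Sample.standardized, hn]
    rw [e]
    exact measurable_const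
  have e : D.standardized i = fun ω =>
      (remainder D ω i + noiseTerm D (D.X ω, D.eps ω) i) / √(varianceProxy D i ω) :=
    funext fun ω => standardized_eq hn i ω
  rw [e]
  have h1 := (measurable_pi_apply i).comp (measurable_remainder hX hM hb)
  have h2 := (measurable_pi_apply i).comp ((measurable_noiseTerm hM).comp (hX.prodMk hε))
  have h3 := measurable_sampleCov_form hX (measurable_Mhat_row hM hX i)
    (measurable_Mhat_row hM hX i)
  exact (h1.add h2).div h3.sqrt

end Standardized

/-! ### The two conclusions. -/

lemma exists_remainder_noise_decomposition {κ σ c K : ℝ} (hσ : 0 < σ)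
    (hK : tuningConst κ ≤ K) {M : Problem} {Ω : Type*} [MeasurableSpace Ω] {P : Measure Ω}
    [IsProbabilityMeasure P] {D : Sample M Ω} (hA : D.Assumptions P κ σ c K)
    (hn : sampleConst κ * M.rate ≤ M.n) :
    ∃ Δ w : Ω → Fin M.p → ℝ, Measurable Δ ∧ Measurable w ∧
      (∀ ω, √(M.n : ℝ) • (D.betaU ω - M.beta) = Δ ω + w ω) ∧
      1 - (6 + 122 * K ^ 2) * Real.exp (-1 * M.rate / M.s) ≤
        P.real {ω | ∀ i, |Δ ω i| ≤ (6 + 122 * K ^ 2) * M.rate' / √(M.n : ℝ) * σ} ∧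
      D.CondGaussian P σ w := by
  have hsp := hA.sparse
  have hX := hA.design.measurable
  have hM := hA.measurable_Mhat
  have hK0 : 0 < K := (tuningConst_pos κ).trans_le hK
  have hr := one_le_rate hsp
  have hn0 : 0 < M.n := by
    have : (0 : ℝ) < M.n := (mul_pos (sampleConst_pos κ) (by linarith)).trans_le hn
    exact_mod_cast this
  have hΔ := measurable_remainder hX hM hA.measurable_betaHat
  refine ⟨remainder D, fun ω => noiseTerm D (D.X ω, D.eps ω), hΔ,
    (measurable_noiseTerm hM).comp (hX.prodMk hA.noise.measurable),
    fun ω => sqrt_smul_betaU_sub D hn0 ω, ?_, condGaussian_noiseTerm hX hM hA.noise⟩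
  set A := {ω | ∀ i, |remainder D ω i| ≤ (6 + 122 * K ^ 2) * M.rate' / √(M.n : ℝ) * σ} with hAdef
  have hA' : MeasurableSet A := by
    have : A = ⋂ i, {ω | |remainder D ω i| ≤ (6 + 122 * K ^ 2) * M.rate' / √(M.n : ℝ) * σ} := by
      ext ω; simp [hAdef]
    rw [this]
    exact MeasurableSet.iInter fun i =>
      measurableSet_le ((measurable_pi_apply i).comp hΔ).abs measurable_const
  have hc : P.real Aᶜ ≤ 6 * Real.exp (-M.rate / M.s) := by
    refine (measureReal_mono ?_).trans (measure_not_good_le hσ hK hA hn0 hn)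
    intro ω hω hgood
    obtain ⟨g1, g2, g3⟩ := hgood
    refine hω fun i => (abs_remainder_le hσ hK0 hn0 hA g1 g2 g3 i).trans ?_
    have hr' := rate_le_rate' hsp
    gcongr
    linarith
  rw [probReal_compl_eq_one_sub hA'] at hc
  rw [neg_one_mul]
  have : 0 ≤ 122 * K ^ 2 * Real.exp (-M.rate / M.s) := by positivity
  linarith

lemma tendstoInDistribution_standardized {κ σ c K : ℝ} (hσ : 0 < σ) (hK : tuningConst κ ≤ K)
    {M : ℕ → Problem} {Ω : ℕ → Type*} [∀ k, MeasurableSpace (Ω k)]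
    {P : ∀ k, Measure (Ω k)} [∀ k, IsProbabilityMeasure (P k)]
    {D : ∀ k, Sample (M k) (Ω k)} (i : ∀ k, Fin (M k).p)
    (hA : ∀ k, (D k).Assumptions (P k) κ σ c K)
    (hlim : Tendsto (fun k => √((M k).n : ℝ) / (M k).rate') atTop atTop) :
    TendstoInDistribution (fun k ω => (D k).standardized (i k) ω) atTop (id : ℝ → ℝ)
      P (gaussianReal 0 (σ ^ 2).toNNReal) := by
  have hn : ∀ᶠ k in atTop, 0 < (M k).n :=
    (hlim.eventually_ge_atTop 1).mono fun k hk => (rate_facts (hA k).sparse one_pos hk).1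
  have hS : ∀ k, Measurable ((D k).standardized (i k)) := fun k =>
    measurable_standardized (hA k).design.measurable (hA k).noise.measurable
      (hA k).measurable_Mhat (hA k).measurable_betaHat (i k)
  have hG : ∀ k, Measurable fun ω => direction (D k) (i k) ((D k).X ω) ⬝ᵥ (D k).eps ω := fun k =>
    measurable_direction_dotProduct_eps (hA k).design.measurable (hA k).noise.measurable
      (hA k).measurable_Mhat (i k)
  have hlaw : ∀ᶠ k in atTop, (P k).map (fun ω => direction (D k) (i k) ((D k).X ω) ⬝ᵥ (D k).eps ω) =
      gaussianReal 0 (σ ^ 2).toNNReal :=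
    hn.mono fun k hk => map_direction_dotProduct hk (hA k).design.measurable
      (hA k).measurable_Mhat (hA k).noise (i k)
  refine tendstoInDistribution_of_approx hS hG hlaw fun ε hε => ?_
  rw [Metric.tendsto_nhds]
  intro δ hδ
  -- Off the exceptional event the approximation error is at most `4 * (ε / 8) < ε`; the event
  -- itself has probability at most `δ / 2`.
  have hη : 0 < min (ε / 8) (δ / 2) := by positivity
  obtain ⟨N, hN⟩ := exists_measure_exceptional_le c hσ hK hη
  filter_upwards [hn, hlim.eventually_ge_atTop N] with k hk hkN
  rw [Real.dist_eq, sub_zero, abs_of_nonneg measureReal_nonneg]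
  have hbad := hN (M k) (Ω k) (P k) (D k) (hA k) (i k) hkN
  refine lt_of_le_of_lt (le_trans (measureReal_mono ?_) hbad)
    ((min_le_right _ _).trans_lt (half_lt_self hδ))
  intro ω hω hgood
  have h1 : ε ≤ |(D k).standardized (i k) ω -
    direction (D k) (i k) ((D k).X ω) ⬝ᵥ (D k).eps ω| := hω
  have h2 := abs_standardized_sub_le hk hgood.1 hgood.2
  have h3 := min_le_left (ε / 8) (δ / 2)
  linarith

end SparseGroupLasso

theorem theorem6 (κ : ℝ) (hκ : 0 < κ) :
    ∃ c > (0 : ℝ), ∃ C₀ > (0 : ℝ), ∃ C₁ > (0 : ℝ), ∀ K ≥ C₀,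
      -- decomposition and error bound
      (∃ C > (0 : ℝ), ∃ c' > (0 : ℝ),
        ∀ (M : SparseGroupLasso.Problem) (Ω : Type*) [MeasurableSpace Ω] (P : Measure Ω)
          [IsProbabilityMeasure P] (D : SparseGroupLasso.Sample M Ω) (σ : ℝ), 0 < σ →
          D.Assumptions P κ σ c K →
          C₁ * M.rate ≤ M.n →
          ∃ Δ w : Ω → Fin M.p → ℝ, Measurable Δ ∧ Measurable w ∧
            (∀ ω, √(M.n : ℝ) • (D.betaU ω - M.beta) = Δ ω + w ω) ∧
            1 - C * Real.exp (-c' * M.rate / M.s) ≤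
              P.real {ω | ∀ i, |Δ ω i| ≤ C * M.rate' / √(M.n : ℝ) * σ} ∧
            D.CondGaussian P σ w) ∧
      -- asymptotic normality
      (∀ (σ : ℝ), 0 < σ →
        ∀ (M : ℕ → SparseGroupLasso.Problem) (Ω : ℕ → Type*) [∀ k, MeasurableSpace (Ω k)]
          (P : ∀ k, Measure (Ω k)) [∀ k, IsProbabilityMeasure (P k)]
          (D : ∀ k, SparseGroupLasso.Sample (M k) (Ω k)) (i : ∀ k, Fin (M k).p),
          (∀ k, (D k).Assumptions (P k) κ σ c K) →
          Tendsto (fun k => √((M k).n : ℝ) / (M k).rate') atTop atTop →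
          TendstoInDistribution (fun k ω => (D k).standardized (i k) ω) atTop (id : ℝ → ℝ)
            P (gaussianReal 0 (σ ^ 2).toNNReal)) := by
  refine ⟨1, one_pos, SparseGroupLasso.tuningConst κ, SparseGroupLasso.tuningConst_pos κ,
    SparseGroupLasso.sampleConst κ, SparseGroupLasso.sampleConst_pos κ, fun K hK => ⟨?_, ?_⟩⟩
  · have hK0 : 0 < K := (SparseGroupLasso.tuningConst_pos κ).trans_le hK
    refine ⟨6 + 122 * K ^ 2, by positivity, 1, one_pos, fun M Ω _ P _ D σ hσ hA hn => ?_⟩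
    exact SparseGroupLasso.exists_remainder_noise_decomposition hσ hK hA hn
  · intro σ hσ M Ω _ P _ D i hA hlim
    exact SparseGroupLasso.tendstoInDistribution_standardized hσ hK i hA hlim
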